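/- **Model.** Let $F$ be a probability distribution on $\Theta=[0,1]$ that is absolutely continuous with respect to Lebesgue measure, let $m^\varnothing=\int\theta\,dF(\theta)$, let $k\in(0,m^\varnothing)$ and let $n\ge 1$. A *signal* is a distribution $G$ on $[0,1]$ that is a mean-preserving contraction of $F$; the *null signal* is the point mass at $m^\varnothing$. An *offer* is a pair $(p,G)$ of a price $p\ge 0$ and a signal $G$. An agent searches sequentially without recall. In each period $t=1,2,\dots$ in which he is still searching he pays $k$ and samples a good of quality $\theta_t\sim F$, drawn independently and observed by no one. Each of $n$ brokers simultaneously makes an offer; the agent buys from one broker or takes the null offer (price $0$, null signal). The posterior mean $m_t$ is drawn from the chosen signal and publicly observed, and the agent either consumes the good, which ends the game, or continues. The agent's payoff is the quality of the consumed good minus all search costs and prices paid ($-\infty$ in expectation if expected expenses are infinite), and a broker's payoff is the sum of the prices paid to her. There is no discounting. Histories consist of all past offers, purchases and realizations, and players use (measurable) behavioral strategies; brokers mix independently. An *equilibrium* is a strategy profile that is sequentially rational: at each of his or her decision nodes, on or off path, no player can gain by changing strategy (brokers when making offers; the agent at the beginning of a period, after any offers, and after any signal realization). Let $\mathcal E(n,k)\subseteq\mathbb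 R_+^{n+1}$ be the set of equilibrium payoff profiles $(y_1,\dots,y_n,y_{n+1})$, where $y_i$ is broker $i$'s and $y_{n+1}$ the agent's payoff. For $E\subseteq\mathbb R^{n+1}$ put $\mathcal W(E)=\{\sum_{j=1}^{n+1}y_j: y\in E\}$ and $\mathcal A(E)=\{y_{n+1}:y\in E\}$. Let $\underline u_k=m^\varnothing-k$ and let $\bar u_k$ be the unique $u$ with $k=\int_u^1(\theta-u)\,dF(\theta)$. **Theorem.** There is a unique $k^*\in(0,m^\varnothing)$ such that for all $n\ge1$: (i) $\mathcal W(\mathcal E(n,k))=[\underline u_k,\bar u_k]$ for all $k\in(0,k^*]$, and (ii) $\sup\mathcal W(\mathcal E(n,k))=\inf\mathcal W(\mathcal E(1,k))=\bar u_k$ for all $k\in(k^*,m^\varnothing)$. For this $k^*$ there exist a threshold $k^{**}\in(k^*,m^\varnothing)$ and a constant $\delta>0$ such that for every $k\in(k^*,k^{**}]$ and every $n>1$ the set $\mathcal E(1,k)$ is non-empty and there is a non-empty open subset $E$ of $\mathbb R^{n+1}$ with $E\subseteq\mathcal E(n,k)$ and $$\inf\mathcal W(\mathcal E(1,k))>\sup\mathcal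 W(E)+\delta\qquad\text{and}\qquad \inf\mathcal A(E)>\sup\mathcal A(\mathcal E(1,k))+\delta,$$ where all these suprema and infima are finite. -/

import Mathlib

open MeasureTheory ProbabilityTheory
open scoped NNReal ENNReal

noncomputable section

namespace PersuadedSearch

/-- The quality space `Θ = [0,1]`; it is also the space of posterior means. -/
abbrev Quality : Type := unitInterval

/-- The prior mean of the quality distribution `F`. -/
def priorMean (F : Measure Quality) : ℝ := ∫ θ, (θ : ℝ) ∂F

/-- The prior mean, as a point of `[0,1]` (the projection changes nothing, see the next lemma). -/
def priorMeanPoint (F : Measure Quality) : Quality :=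
  Set.projIcc 0 1 zero_le_one (priorMean F)

theorem coe_priorMeanPoint (F : Measure Quality) [IsProbabilityMeasure F] :
    (priorMeanPoint F : ℝ) = priorMean F := by
  have hint : Integrable (fun θ : Quality => (θ : ℝ)) F :=
    Integrable.of_bound (by fun_prop) 1 (Filter.Eventually.of_forall fun θ => by
      rw [Real.norm_eq_abs, abs_of_nonneg θ.2.1]; exact θ.2.2)
  have h0 : 0 ≤ priorMean F := integral_nonneg fun θ => θ.2.1
  have h1 : priorMean F ≤ 1 := by
    have := integral_mono hint (integrable_const (1 : ℝ)) fun θ => θ.2.2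
    simpa [priorMean] using this
  simp [priorMeanPoint, Set.projIcc, h0, h1]

/-- `G` is a mean-preserving contraction of `F`: the means agree, and
`E_G[(m - u)^+] ≤ E_F[(θ - u)^+]` for every `u` (the integral condition of second-order
stochastic dominance). -/
def IsMPC (G F : Measure Quality) : Prop :=
  (∫ m, (m : ℝ) ∂G = ∫ θ, (θ : ℝ) ∂F) ∧
    ∀ u : ℝ, ∫ m, max ((m : ℝ) - u) 0 ∂G ≤ ∫ θ, max ((θ : ℝ) - u) 0 ∂F

/-- Signals: posterior-mean distributions that are mean-preserving contractions of `F`. -/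
def Signal (F : Measure Quality) : Type :=
  {G : Measure Quality // IsProbabilityMeasure G ∧ IsMPC G F}

instance (F : Measure Quality) : MeasurableSpace (Signal F) :=
  inferInstanceAs (MeasurableSpace {G : Measure Quality // IsProbabilityMeasure G ∧ IsMPC G F})

/-- A take-it-or-leave-it offer: a non-negative price and a signal. -/
abbrev Offer (F : Measure Quality) : Type := ℝ≥0 × Signal F

/-- A profile of offers, one for each of the `n` brokers. -/
abbrev Offers (F : Measure Quality) (n : ℕ) : Type := Fin n → Offer F

/-- Purchase decisions: `some i` buys from broker `i`, `none` takes the null offer. -/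
abbrev Choice (n : ℕ) : Type := Option (Fin n)

instance (n : ℕ) : MeasurableSpace (Choice n) := ⊤

/-- The price of the chosen offer (the null offer is free). -/
def price {F : Measure Quality} {n : ℕ} (O : Offers F n) : Choice n → ℝ≥0∞
  | none => 0
  | some i => ((O i).1 : ℝ≥0∞)

/-- The law of the posterior mean under the chosen offer (the null offer is uninformative). -/
def signalLaw {F : Measure Quality} {n : ℕ} (O : Offers F n) : Choice n → Measure Quality
  | none => Measure.dirac (priorMeanPoint F)
  | some i => (O i).2.1

/-- What happens in a period in which the search goes on: offers, purchase, signal realization. -/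
abbrev Stage (F : Measure Quality) (n : ℕ) : Type := Offers F n × Choice n × Quality

/-- Histories at the beginning of a period: finite sequences of stages, of any length. -/
abbrev History (F : Measure Quality) (n : ℕ) : Type := Σ t : ℕ, (Fin t → Stage F n)

/-- The history before the first period. -/
def initial (F : Measure Quality) (n : ℕ) : History F n := ⟨0, Fin.elim0⟩

/-- The history `h` followed by one more stage. -/
def append {F : Measure Quality} {n : ℕ} (h : History F n) (z : Stage F n) : History F n :=
  ⟨h.1 + 1, Fin.snoc h.2 z⟩

/-- Behavioral strategies of a broker: a (measurable) map from histories to distributions over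
offers. -/
def BrokerStrategy (F : Measure Quality) (n : ℕ) : Type :=
  {κ : Kernel (History F n) (Offer F) // IsMarkovKernel κ}

/-- Behavioral strategies of the agent. `buy h O w` is the probability of the purchase decision
`w` when the offers are `O`; `cont h O w m` is the probability of continuing to search after the
realization `m`. -/
structure AgentStrategy (F : Measure Quality) (n : ℕ) where
  buy : History F n → Offers F n → Choice n → ℝ≥0∞
  cont : History F n → Offers F n → Choice n → Quality → ℝ≥0∞
  sum_buy : ∀ h O, ∑ w, buy h O w = 1
  cont_le_one : ∀ h O w m, cont h O w m ≤ 1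
  measurable_buy : ∀ w, Measurable fun x : History F n × Offers F n => buy x.1 x.2 w
  measurable_cont : ∀ w, Measurable fun x : History F n × Offers F n × Quality =>
    cont x.1 x.2.1 w x.2.2

/-- Strategy profiles. -/
structure Profile (F : Measure Quality) (n : ℕ) where
  broker : Fin n → BrokerStrategy F n
  agent : AgentStrategy F n

section Payoffs

variable {F : Measure Quality} {n : ℕ}

/-- The profile in which broker `i` switches to `τ`. -/
def Profile.withBroker (σ : Profile F n) (i : Fin n) (τ : BrokerStrategy F n) : Profile F n :=
  { σ with broker := Function.update σ.broker i τ }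

/-- The profile in which the agent switches to `A`. -/
def Profile.withAgent (σ : Profile F n) (A : AgentStrategy F n) : Profile F n :=
  { σ with agent := A }

/-- The law of the offers made at `h`; the brokers mix independently. -/
def offerLaw (σ : Profile F n) (h : History F n) : Measure (Offers F n) :=
  Measure.pi fun i => (σ.broker i).1 h

/-- Expectation of `f w m` over the purchase `w` and the realization `m`, given the history and
the offers. -/
def expectStage (σ : Profile F n) (h : History F n) (O : Offers F n)
    (f : Choice n → Quality → ℝ≥0∞) : ℝ≥0∞ :=
  ∑ w, σ.agent.buy h O w * ∫⁻ m, f w m ∂(signalLaw O w)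

/-- A non-negative flow: an amount that accrues within a period, as a function of the history at
the beginning of the period, of the offers, of the purchase and of the realization. -/
abbrev PeriodFlow (F : Measure Quality) (n : ℕ) : Type :=
  History F n → Offers F n → Choice n → Quality → ℝ≥0∞

/-- Expected amount that accrues in the period that begins at `h`. -/
def expectFlow (σ : Profile F n) (g : PeriodFlow F n) (h : History F n) : ℝ≥0∞ :=
  ∫⁻ O, expectStage σ h O (g h O) ∂(offerLaw σ h)

/-- Expectation, in the period that begins at `h`, of `f` evaluated at the next history, on the
event that the agent continues to search. -/
def expectNext (σ : Profile F n) (f : History F n → ℝ≥0∞) (h : History F n) : ℝ≥0∞ :=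
  ∫⁻ O, expectStage σ h O
    (fun w m => σ.agent.cont h O w m * f (append h (O, w, m))) ∂(offerLaw σ h)

/-- Expected total of the flow `g` from the period that begins at `h` up to the (random) period
in which the agent stops, under the distribution that `σ` induces from `h` on. The term of
index `s` is the expectation of the flow `s` periods later, on the event that the search is then
still going on, written as an iterated integral. -/
def expectTotal (σ : Profile F n) (g : PeriodFlow F n) (h : History F n) : ℝ≥0∞ :=
  ∑' s : ℕ, (expectNext σ)^[s] (expectFlow σ g) h

/-- The payments to broker `i`. -/
def payment (i : Fin n) : PeriodFlow F n := fun _ O w _ => if w = some i then price O w else 0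

/-- The expected quality of the good consumed if the agent stops in the current period. -/
def reward (σ : Profile F n) : PeriodFlow F n :=
  fun h O w m => (1 - σ.agent.cont h O w m) * ENNReal.ofReal (m : ℝ)

/-- The agent's expenses in a period: the search cost `k` and the price. -/
def cost (k : ℝ) : PeriodFlow F n := fun _ O w _ => ENNReal.ofReal k + price O w

/-- Broker `i`'s expected payoff from the history `h` on. -/
def brokerPayoff (σ : Profile F n) (i : Fin n) (h : History F n) : ℝ≥0∞ :=
  expectTotal σ (payment i) h

/-- The agent's expected payoff from the history `h` on. The expected quality of the consumed good
is at most one; the payoff is `-∞` if the expected expenses are infinite, for instance if the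
search never ends with positive probability. -/
def agentPayoff (k : ℝ) (σ : Profile F n) (h : History F n) : EReal :=
  (expectTotal σ (reward σ) h : EReal) - (expectTotal σ (cost k) h : EReal)

/-- Expected total of `g` from the period that begins at `h` on, given the offers `O` made in
that period. -/
def expectTotalAtOffers (σ : Profile F n) (g : PeriodFlow F n) (h : History F n) (O : Offers F n) :
    ℝ≥0∞ :=
  expectStage σ h O fun w m =>
    g h O w m + σ.agent.cont h O w m * expectTotal σ g (append h (O, w, m))

/-- The agent's expected payoff at the node where he chooses among the offers `O`. -/
def agentPayoffAtOffers (k : ℝ) (σ : Profile F n) (h : History F n) (O : Offers F n) : EReal :=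
  (expectTotalAtOffers σ (reward σ) h O : EReal) - (expectTotalAtOffers σ (cost k) h O : EReal)

/-- The agent's expected payoff at the node where he has bought `w`, has observed `m`, and
decides whether to stop; the expenses of the current period are sunk. -/
def agentPayoffAtSignal (k : ℝ) (σ : Profile F n) (h : History F n) (O : Offers F n)
    (w : Choice n) (m : Quality) : EReal :=
  ((reward σ h O w m
      + σ.agent.cont h O w m * expectTotal σ (reward σ) (append h (O, w, m)) : ℝ≥0∞) : EReal)
    - ((σ.agent.cont h O w m * expectTotal σ (cost k) (append h (O, w, m)) : ℝ≥0∞) : EReal)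

/-- Equilibrium: sequential rationality of every player at each of his decision nodes, on and
off the path of play. -/
structure IsEquilibrium (k : ℝ) (σ : Profile F n) : Prop where
  broker_rational : ∀ (h : History F n) (i : Fin n) (τ : BrokerStrategy F n),
    brokerPayoff (σ.withBroker i τ) i h ≤ brokerPayoff σ i h
  agent_rational : ∀ (h : History F n) (A : AgentStrategy F n),
    agentPayoff k (σ.withAgent A) h ≤ agentPayoff k σ h
  purchase_rational : ∀ (h : History F n) (O : Offers F n) (A : AgentStrategy F n),
    agentPayoffAtOffers k (σ.withAgent A) h O ≤ agentPayoffAtOffers k σ h O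
  stopping_rational : ∀ (h : History F n) (O : Offers F n) (w : Choice n) (m : Quality)
    (A : AgentStrategy F n),
    agentPayoffAtSignal k (σ.withAgent A) h O w m ≤ agentPayoffAtSignal k σ h O w m

end Payoffs

/-- The set `ℰ(n,k)` of equilibrium payoff profiles. Coordinate `i.castSucc` is broker `i`'s
payoff, the last coordinate is the agent's. -/
def equilibriumPayoffs (F : Measure Quality) (n : ℕ) (k : ℝ) : Set (Fin (n + 1) → ℝ) :=
  {y | ∃ σ : Profile F n, IsEquilibrium k σ ∧
    (∀ i : Fin n, ((y i.castSucc : ℝ) : EReal) = (brokerPayoff σ i (initial F n) : EReal)) ∧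
    ((y (Fin.last n) : ℝ) : EReal) = agentPayoff k σ (initial F n)}

/-- Total surpluses of the payoff profiles in `E`. -/
def surplusSet {n : ℕ} (E : Set (Fin (n + 1) → ℝ)) : Set ℝ := (fun y => ∑ i, y i) '' E

/-- The agent's payoffs in the payoff profiles in `E`. -/
def agentSet {n : ℕ} (E : Set (Fin (n + 1) → ℝ)) : Set ℝ := (fun y => y (Fin.last n)) '' E

/-- The payoff of an agent who searches without information. -/
def autarkyPayoff (F : Measure Quality) (k : ℝ) : ℝ := priorMean F - k

/-- The payoff of an agent who observes every quality for free: the solution `u` of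
`k = ∫_u^1 (θ - u) dF(θ)`, which is unique when `0 < k < priorMean F`. -/
def mcCallPayoff (F : Measure Quality) (k : ℝ) : ℝ :=
  sSup {u : ℝ | k = ∫ θ in {θ : Quality | u ≤ (θ : ℝ)}, ((θ : ℝ) - u) ∂F}

/-- `ks` separates the search costs at which, for any number of brokers, every feasible surplus
is an equilibrium surplus, from those at which the highest equilibrium surplus with any number of
brokers and the lowest equilibrium surplus with one broker are both the full-information
payoff. -/
def IsSurplusThreshold (F : Measure Quality) (ks : ℝ) : Prop :=
  0 < ks ∧ ks < priorMean F ∧ ∀ n : ℕ, 1 ≤ n →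
    (∀ k : ℝ, 0 < k → k ≤ ks →
      surplusSet (equilibriumPayoffs F n k) = Set.Icc (autarkyPayoff F k) (mcCallPayoff F k)) ∧
    (∀ k : ℝ, ks < k → k < priorMean F →
      IsLUB (surplusSet (equilibriumPayoffs F n k)) (mcCallPayoff F k) ∧
      IsGLB (surplusSet (equilibriumPayoffs F 1 k)) (mcCallPayoff F k))

end PersuadedSearch

end

noncomputable section

namespace PersuadedSearch

open Filter Topology

/-! ### Measurability of histories, signals, offer laws and period flows -/

section Measurability

/-! Write `m` for the prior mean, `lo = m - k` for the autarky payoff, `ū` for the full-information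
payoff, and `e(u) = E_F[(θ - u)^+]` for the excess function, so that `e(ū) = k`. The pivotal
quantity is `D = lo + e(lo)` (`autarkyInformed`): the gross value of the best conceivable signal, at
price zero, to an agent whose continuation payoff is as low as an equilibrium allows. The threshold
is where `D` and `ū` cross. Since `e` is strictly decreasing where positive, `D ≤ ū` amounts to `k ≤
e(D)`, and `e(D) - k` is strictly decreasing in `k`, positive at `0` and negative at `m`
(`exists_threshold`).

In every equilibrium the agent gets at least `lo`, because he can search uninformed and stop at
once, and the surplus is at most `ū`, because payments are transfers and `ū` solves the search
problem with free full information.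

If `D ≤ ū`, deviations are deterred through the agent: buying a deviating offer sends the
continuation payoff to `lo`, and refusing it sends it to `ū`. A deviating offer is then worth at
most `D` minus its price, so none with a positive price is bought. Stationary play with free offers
attains every agent payoff `w` in `[lo, ū]`: mix full and no information so that the excess at `w`
is exactly `k` (`Icc_subset_surplusSet`).

If `ū < D`, these threats fail against a monopolist. Let `U` be the supremum of the agent's values
over histories. If `U > m`, a full-information offer at a price `p` with `ū < p + U < D` is bought
whatever the continuation, so the broker earns at least `p` everywhere and `p + U ≤ ū`, a
contradiction (`IsEquilibrium.agentValue_le_priorMean`). Hence rejecting an offer is worth at most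
`m`. The broker can then repeat a two-point signal that separates qualities above and below `ū`, at
any price below `a (ū - lo)`, where `a` is the probability of the high realization. It is always
bought and the search goes on with probability at least `1 - a`, so the geometric series yields
payoffs arbitrarily close to `ū - lo` (`IsEquilibrium.le_brokerPayoff`). Monopoly payoffs are
therefore `ū - lo` and `lo`, and a stationary equilibrium attains them.

With several brokers a refusal need not mean going uninformed: the agent can buy from a broker who
did not deviate. This adds a little to the value `ū` of refusing, so that deterrence still works for
`D` slightly above `ū`, that is, for `k` slightly above the threshold. Positive prices in the first
period can then be shared arbitrarily among the brokers while the first signal is inefficient, which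
yields an open set of payoffs (`mem_equilibriumPayoffs_of_competition`) with less surplus than
monopoly but more for the agent.

All equilibria are finite automata. Their optimality is checked by comparison principles for the
series that define payoffs (`expectTotal_le_of_flow`, `expectTotal_reward_eq`,
`agent_verification`). -/

theorem measurable_of_sigma_prod {ι Z Y : Type*} [Countable ι] {X : ι → Type*}
    [∀ i, MeasurableSpace (X i)] [MeasurableSpace Z] [MeasurableSpace Y]
    {f : (Σ i, X i) × Z → Y} (hf : ∀ i, Measurable fun x : X i × Z => f (⟨i, x.1⟩, x.2)) :
    Measurable f := by
  have hmk : ∀ i, MeasurableEmbedding (Sigma.mk i : X i → Σ i, X i) := fun i =>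
    { injective := sigma_mk_injective
      measurable := fun s hs => (MeasurableSpace.measurableSet_iInf.1 hs) i
      measurableSet_image' := fun s hs => by
        refine MeasurableSpace.measurableSet_iInf.2 fun j => ?_
        change MeasurableSet (Sigma.mk j ⁻¹' (Sigma.mk i '' s))
        by_cases h : j = i
        · subst h
          rwa [Set.preimage_image_eq _ sigma_mk_injective]
        · convert MeasurableSet.empty
          ext x
          simp only [Set.mem_preimage, Set.mem_image, Set.mem_empty_iff_false, iff_false]
          rintro ⟨y, -, hy⟩
          exact h (congrArg Sigma.fst hy).symm }
  intro s hs
  have : f ⁻¹' s = ⋃ i, Prod.map (Sigma.mk i) id ''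
      ((fun x : X i × Z => f (⟨i, x.1⟩, x.2)) ⁻¹' s) := by
    ext ⟨⟨i, x⟩, z⟩
    simp only [Set.mem_preimage, Set.mem_iUnion, Set.mem_image]
    constructor
    · intro h
      exact ⟨i, (x, z), h, rfl⟩
    · rintro ⟨j, ⟨x', z'⟩, h, he⟩
      rw [← he]
      exact h
  rw [this]
  exact MeasurableSet.iUnion fun i =>
    ((hmk i).prodMap MeasurableEmbedding.id).measurableSet_image.2 (hf i hs)

theorem measurable_sigma_mk {ι : Type*} {X : ι → Type*} [∀ i, MeasurableSpace (X i)] (i : ι) :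
    Measurable (Sigma.mk i : X i → Σ i, X i) :=
  fun _ hs => (MeasurableSpace.measurableSet_iInf.1 hs) i

variable {F : Measure Quality} {n : ℕ}

theorem measurable_append :
    Measurable fun x : History F n × Stage F n => append x.1 x.2 := by
  refine measurable_of_sigma_prod fun t => ?_
  refine (measurable_sigma_mk (X := fun t => Fin t → Stage F n) (t + 1)).comp ?_
  refine measurable_pi_lambda _ fun j => ?_
  refine Fin.lastCases ?_ (fun j => ?_) j
  · simpa using measurable_snd
  · simpa using! (measurable_pi_apply j).comp measurable_fst

/-- A law on `[0,1]` is determined by its distribution function at rational points, so a singleton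
is a countable intersection of measurable sets. This makes it a measurable event that a broker
deviates from a prescribed offer. -/
instance : MeasurableSingletonClass (Signal F) where
  measurableSet_singleton := fun G => by
    have hG := G.2.1
    have : ({G} : Set (Signal F)) =
        ⋂ q : ℚ, {H : Signal F | H.1 {m | (m : ℝ) ≤ q} = G.1 {m | (m : ℝ) ≤ q}} := by
      ext H
      have hH := H.2.1
      simp only [Set.mem_singleton_iff, Set.mem_iInter, Set.mem_ofPred_eq]
      refine ⟨fun h q => by rw [h], fun h => Subtype.ext ?_⟩
      have hemb : MeasurableEmbedding (Subtype.val : Quality → ℝ) :=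
        MeasurableEmbedding.subtype_coe measurableSet_Icc
      have hmap : H.1.map (Subtype.val : Quality → ℝ) = G.1.map Subtype.val := by
        refine ext_of_generate_finite _ Real.borel_eq_generateFrom_Iic_rat
          Real.isPiSystem_Iic_rat ?_ ?_
        · intro s hs
          simp only [Set.mem_iUnion, Set.mem_singleton_iff] at hs
          obtain ⟨q, rfl⟩ := hs
          rw [hemb.map_apply, hemb.map_apply]
          exact h q
        · rw [hemb.map_apply, hemb.map_apply]
          simp
      rw [← hemb.comap_map H.1, hmap, hemb.comap_map]
    rw [this]
    refine MeasurableSet.iInter fun q => ?_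
    have hs : MeasurableSet {m : Quality | (m : ℝ) ≤ q} :=
      measurableSet_le measurable_subtype_coe measurable_const
    exact ((Measure.measurable_coe hs).comp measurable_subtype_coe) (measurableSet_singleton _)

instance (O : Offers F n) (w : Choice n) : IsProbabilityMeasure (signalLaw O w) := by
  cases w with
  | none => exact Measure.dirac.isProbabilityMeasure
  | some i => exact (O i).2.2.1

theorem measurable_signalLaw (w : Choice n) :
    Measurable fun O : Offers F n => signalLaw O w := by
  cases w with
  | none => exact measurable_const
  | some i => exact measurable_subtype_coe.comp (measurable_snd.comp (measurable_pi_apply i))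

theorem measurable_price (w : Choice n) : Measurable fun O : Offers F n => price O w := by
  cases w with
  | none => exact measurable_const
  | some i => exact measurable_coe_nnreal_ennreal.comp (measurable_fst.comp (measurable_pi_apply i))

theorem price_ne_top (O : Offers F n) (w : Choice n) : price O w ≠ ⊤ := by
  cases w <;> simp [price]

theorem measurable_lintegral_signalLaw {X : Type*} [MeasurableSpace X] {o : X → Offers F n}
    (ho : Measurable o) (w : Choice n) {f : X → Quality → ℝ≥0∞}
    (hf : Measurable fun x : X × Quality => f x.1 x.2) :
    Measurable fun x => ∫⁻ m, f x m ∂(signalLaw (o x) w) := by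
  let κ : Kernel X Quality := ⟨fun x => signalLaw (o x) w, (measurable_signalLaw w).comp ho⟩
  have : IsMarkovKernel κ := ⟨fun x => inferInstanceAs (IsProbabilityMeasure (signalLaw (o x) w))⟩
  exact hf.lintegral_kernel_prod_right' (κ := κ)

variable (σ : Profile F n)

instance (i : Fin n) (h : History F n) : IsProbabilityMeasure ((σ.broker i).1 h) :=
  (σ.broker i).2.isProbabilityMeasure h

instance (h : History F n) : IsProbabilityMeasure (offerLaw σ h) := by
  unfold offerLaw; infer_instance

/-- On measurable rectangles the product law is a finite product of measurable functions of the
history, and rectangles form a generating π-system. -/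
theorem measurable_offerLaw : Measurable (offerLaw σ) := by
  refine Measurable.measure_of_isPiSystem_of_isProbabilityMeasure
    (generateFrom_pi (α := fun _ : Fin n => Offer F)).symm isPiSystem_pi ?_
  rintro s ⟨t, ht, rfl⟩
  simp only [offerLaw, Measure.pi_pi]
  refine Finset.measurable_prod _ fun i _ => ?_
  exact (σ.broker i).1.measurable_coe (ht i (Set.mem_univ i))

theorem measurable_lintegral_offerLaw {f : History F n → Offers F n → ℝ≥0∞}
    (hf : Measurable fun x : History F n × Offers F n => f x.1 x.2) :
    Measurable fun h => ∫⁻ O, f h O ∂(offerLaw σ h) := by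
  let κ : Kernel (History F n) (Offers F n) := ⟨offerLaw σ, measurable_offerLaw σ⟩
  have : IsMarkovKernel κ := ⟨fun h => inferInstanceAs (IsProbabilityMeasure (offerLaw σ h))⟩
  exact hf.lintegral_kernel_prod_right' (κ := κ)

/-- Joint measurability of a period flow. -/
def MeasurableFlow (g : PeriodFlow F n) : Prop :=
  ∀ w, Measurable fun x : History F n × Offers F n × Quality => g x.1 x.2.1 w x.2.2

theorem MeasurableFlow.add {f g : PeriodFlow F n} (hf : MeasurableFlow f)
    (hg : MeasurableFlow g) : MeasurableFlow fun h O w m => f h O w m + g h O w m :=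
  fun w => (hf w).add (hg w)

theorem MeasurableFlow.apply {g : PeriodFlow F n} (hg : MeasurableFlow g) (h : History F n)
    (O : Offers F n) (w : Choice n) : Measurable (g h O w) :=
  (hg w).comp (measurable_const.prodMk (measurable_const.prodMk measurable_id))

theorem measurable_expectStage {g : PeriodFlow F n} (hg : MeasurableFlow g) :
    Measurable fun x : History F n × Offers F n => expectStage σ x.1 x.2 (g x.1 x.2) := by
  unfold expectStage
  refine Finset.measurable_sum _ fun w _ => (σ.agent.measurable_buy w).mul ?_
  refine measurable_lintegral_signalLaw (X := History F n × Offers F n) measurable_snd w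
    (f := fun x m => g x.1 x.2 w m) ?_
  exact (hg w).comp (f := fun y : (History F n × Offers F n) × Quality => (y.1.1, y.1.2, y.2))
    (by fun_prop)

theorem measurable_expectStage_left {g : PeriodFlow F n} (hg : MeasurableFlow g)
    (h : History F n) : Measurable fun O => expectStage σ h O (g h O) :=
  (measurable_expectStage σ hg).comp (f := fun O => (h, O)) (by fun_prop)

theorem measurable_expectFlow {g : PeriodFlow F n} (hg : MeasurableFlow g) :
    Measurable (expectFlow σ g) :=
  measurable_lintegral_offerLaw σ (measurable_expectStage σ hg)

/-- The continuation value as a flow. -/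
def contFlow (f : History F n → ℝ≥0∞) : PeriodFlow F n :=
  fun h O w m => σ.agent.cont h O w m * f (append h (O, w, m))

variable {σ}

theorem measurableFlow_cont : MeasurableFlow fun h O w m => σ.agent.cont h O w m :=
  fun w => σ.agent.measurable_cont w

theorem measurableFlow_append {f : History F n → ℝ≥0∞} (hf : Measurable f) :
    MeasurableFlow fun h O w m => f (append h (O, w, m)) := fun w =>
  hf.comp (measurable_append.comp
    (f := fun x : History F n × Offers F n × Quality => (x.1, (x.2.1, w, x.2.2))) (by fun_prop))

theorem measurableFlow_contFlow {f : History F n → ℝ≥0∞} (hf : Measurable f) :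
    MeasurableFlow (contFlow σ f) :=
  fun w => (measurableFlow_cont w).mul (measurableFlow_append hf w)

theorem expectNext_eq (f : History F n → ℝ≥0∞) : expectNext σ f = expectFlow σ (contFlow σ f) :=
  rfl

theorem measurable_expectNext {f : History F n → ℝ≥0∞} (hf : Measurable f) :
    Measurable (expectNext σ f) :=
  measurable_expectFlow σ (measurableFlow_contFlow hf)

theorem measurable_expectNext_iterate {f : History F n → ℝ≥0∞} (hf : Measurable f) (s : ℕ) :
    Measurable ((expectNext σ)^[s] f) := by
  induction s with
  | zero => exact hf
  | succ s ih => rw [Function.iterate_succ_apply']; exact measurable_expectNext ih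

theorem measurable_expectTotal {g : PeriodFlow F n} (hg : MeasurableFlow g) :
    Measurable (expectTotal σ g) := by
  unfold expectTotal
  exact Measurable.tsum fun s =>
    measurable_expectNext_iterate (measurable_expectFlow σ hg) s

theorem measurableFlow_payment (i : Fin n) : MeasurableFlow (F := F) (payment i) := fun w => by
  by_cases h : w = some i
  · simpa [payment, h] using! (measurable_price (some i)).comp (measurable_fst.comp measurable_snd)
  · simp [payment, h]

theorem measurableFlow_reward : MeasurableFlow (reward σ) := fun w =>
  (measurable_const.sub (measurableFlow_cont w)).mul
    (ENNReal.measurable_ofReal.comp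
      (measurable_subtype_coe.comp (measurable_snd.comp measurable_snd)))

theorem measurableFlow_cost (k : ℝ) : MeasurableFlow (F := F) (n := n) (cost k) := fun w =>
  measurable_const.add ((measurable_price w).comp (measurable_fst.comp measurable_snd))

theorem measurableFlow_const (c : ℝ≥0∞) : MeasurableFlow (F := F) (n := n) fun _ _ _ _ => c :=
  fun _ => measurable_const

end Measurability

/-! ### Expected totals: recursion and comparison principles -/

section Totals

variable {F : Measure Quality} {n : ℕ} {σ : Profile F n}

theorem expectStage_mono {h : History F n} {O : Offers F n} {f g : Choice n → Quality → ℝ≥0∞}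
    (hfg : ∀ w m, f w m ≤ g w m) : expectStage σ h O f ≤ expectStage σ h O g := by
  unfold expectStage
  gcongr with w _ m
  exact hfg w m

theorem expectStage_add {h : History F n} {O : Offers F n} {f g : Choice n → Quality → ℝ≥0∞}
    (hf : ∀ w, Measurable (f w)) :
    expectStage σ h O (fun w m => f w m + g w m) =
      expectStage σ h O f + expectStage σ h O g := by
  simp only [expectStage, ← Finset.sum_add_distrib, ← mul_add]
  exact Finset.sum_congr rfl fun w _ => by rw [lintegral_add_left (hf w)]

theorem expectStage_const {h : History F n} {O : Offers F n} (c : ℝ≥0∞) :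
    expectStage σ h O (fun _ _ => c) = c := by
  simp [expectStage, ← Finset.sum_mul, σ.agent.sum_buy]

theorem expectFlow_mono {f g : PeriodFlow F n} {h : History F n}
    (hfg : ∀ O w m, f h O w m ≤ g h O w m) : expectFlow σ f h ≤ expectFlow σ g h :=
  lintegral_mono fun O => expectStage_mono (hfg O)

theorem expectFlow_add {f g : PeriodFlow F n} (hf : MeasurableFlow f) (h : History F n) :
    expectFlow σ (fun h O w m => f h O w m + g h O w m) h =
      expectFlow σ f h + expectFlow σ g h := by
  unfold expectFlow
  rw [← lintegral_add_left (measurable_expectStage_left σ hf h)]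
  exact lintegral_congr fun O => expectStage_add fun w => hf.apply h O w

theorem expectFlow_const (c : ℝ≥0∞) (h : History F n) :
    expectFlow σ (fun _ _ _ _ => c) h = c := by
  simp [expectFlow, expectStage_const]

theorem expectNext_mono {f g : History F n → ℝ≥0∞} (hfg : ∀ h, f h ≤ g h) (h : History F n) :
    expectNext σ f h ≤ expectNext σ g h :=
  expectFlow_mono (f := contFlow σ f) (g := contFlow σ g) fun _ _ _ => by
    unfold contFlow; gcongr; exact hfg _

theorem expectNext_add {f g : History F n → ℝ≥0∞} (hf : Measurable f) (h : History F n) :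
    expectNext σ (fun h => f h + g h) h = expectNext σ f h + expectNext σ g h := by
  simp only [expectNext_eq]
  rw [← expectFlow_add (measurableFlow_contFlow hf)]
  refine congrArg (fun g => expectFlow σ g h) ?_
  funext h O w m
  exact mul_add _ _ _

theorem expectNext_const_mul {f : History F n → ℝ≥0∞} (hf : Measurable f) (c : ℝ≥0∞)
    (h : History F n) : expectNext σ (fun h => c * f h) h = c * expectNext σ f h := by
  have hm := measurableFlow_contFlow (σ := σ) hf
  simp only [expectNext_eq, expectFlow]
  rw [← lintegral_const_mul _ (measurable_expectStage_left σ hm h)]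
  refine lintegral_congr fun O => ?_
  simp only [expectStage, Finset.mul_sum]
  refine Finset.sum_congr rfl fun w _ => ?_
  rw [mul_left_comm, ← lintegral_const_mul _ (hm.apply h O w)]
  simp only [contFlow, mul_left_comm]

theorem expectNext_zero (h : History F n) : expectNext σ (fun _ => 0) h = 0 := by
  simp [expectNext, expectStage]

/-- The expected total of `g` over the first `N` periods from `h` on. -/
def partialTotal (σ : Profile F n) (g : PeriodFlow F n) (N : ℕ) (h : History F n) : ℝ≥0∞ :=
  ∑ s ∈ Finset.range N, (expectNext σ)^[s] (expectFlow σ g) h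

theorem measurable_partialTotal {g : PeriodFlow F n} (hg : MeasurableFlow g) (N : ℕ) :
    Measurable (partialTotal σ g N) := by
  unfold partialTotal
  exact Finset.measurable_sum _ fun s _ =>
    measurable_expectNext_iterate (measurable_expectFlow σ hg) s

/-- Additivity of `expectNext` lets the first period be split off, which turns bounds on totals into
inductions on the horizon. -/
theorem partialTotal_succ {g : PeriodFlow F n} (hg : MeasurableFlow g) (N : ℕ)
    (h : History F n) :
    partialTotal σ g (N + 1) h = expectFlow σ g h + expectNext σ (partialTotal σ g N) h := by
  have key : ∀ M h, expectNext σ (partialTotal σ g M) h =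
      ∑ s ∈ Finset.range M, (expectNext σ)^[s + 1] (expectFlow σ g) h := by
    intro M h
    induction M with
    | zero =>
      have : partialTotal σ g 0 = fun _ => 0 := funext fun h => by simp [partialTotal]
      rw [this, expectNext_zero]
      simp
    | succ M ih =>
      rw [Finset.sum_range_succ, ← ih, Function.iterate_succ_apply',
        ← expectNext_add (measurable_partialTotal hg M)]
      refine congrArg (fun f => expectNext σ f h) (funext fun h => ?_)
      simp only [partialTotal, Finset.sum_range_succ]
  rw [key, partialTotal, Finset.sum_range_succ', add_comm]
  rfl

theorem partialTotal_le_expectTotal (g : PeriodFlow F n) (N : ℕ) (h : History F n) :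
    partialTotal σ g N h ≤ expectTotal σ g h :=
  ENNReal.sum_le_tsum _

theorem tendsto_partialTotal (g : PeriodFlow F n) (h : History F n) :
    Tendsto (fun N => partialTotal σ g N h) atTop (𝓝 (expectTotal σ g h)) :=
  ENNReal.tendsto_nat_tsum _

theorem expectFlow_le_expectTotal (g : PeriodFlow F n) (h : History F n) :
    expectFlow σ g h ≤ expectTotal σ g h := by
  simpa [partialTotal] using partialTotal_le_expectTotal (σ := σ) g 1 h

/-- A comparison principle for expected totals. -/
theorem expectTotal_le_of_flow {r c : PeriodFlow F n} (hr : MeasurableFlow r)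
    (hc : MeasurableFlow c) {V : History F n → ℝ≥0∞} (hV : Measurable V)
    (H : ∀ h, expectFlow σ r h + expectNext σ V h ≤ V h + expectFlow σ c h) (h : History F n) :
    expectTotal σ r h ≤ V h + expectTotal σ c h := by
  -- A supersolution property is iterated with `V` and the expenses added on the larger side, so
  -- that nothing is ever subtracted in `[0,∞]`.
  have key : ∀ N h, partialTotal σ r N h ≤ V h + partialTotal σ c N h := by
    intro N
    induction N with
    | zero => intro h; simp [partialTotal]
    | succ N ih =>
      intro h
      rw [partialTotal_succ hr, partialTotal_succ hc]
      calc expectFlow σ r h + expectNext σ (partialTotal σ r N) h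
          ≤ expectFlow σ r h + (expectNext σ V h + expectNext σ (partialTotal σ c N) h) := by
            rw [← expectNext_add hV]
            gcongr
            exact expectNext_mono ih h
        _ ≤ V h + expectFlow σ c h + expectNext σ (partialTotal σ c N) h := by
            rw [← add_assoc]; exact add_le_add_left (H h) _
        _ = _ := by rw [add_assoc]
  refine le_of_tendsto' (tendsto_partialTotal r h) fun N => (key N h).trans ?_
  gcongr
  exact partialTotal_le_expectTotal c N h

theorem expectFlow_add_expectNext {r : PeriodFlow F n} (hr : MeasurableFlow r)
    (V : History F n → ℝ≥0∞) (h : History F n) :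
    expectFlow σ r h + expectNext σ V h =
      ∫⁻ O, expectStage σ h O (fun w m => r h O w m + contFlow σ V h O w m) ∂(offerLaw σ h) := by
  rw [expectNext_eq, ← expectFlow_add hr]
  rfl

theorem add_expectFlow {c : PeriodFlow F n} (x : ℝ≥0∞) (h : History F n) :
    x + expectFlow σ c h = ∫⁻ O, (x + expectStage σ h O (c h O)) ∂(offerLaw σ h) := by
  rw [lintegral_add_left measurable_const]
  simp [expectFlow]

/-- A comparison principle for expected totals, stage by stage. -/
theorem expectTotal_le_of_stage {r c : PeriodFlow F n} (hr : MeasurableFlow r)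
    (hc : MeasurableFlow c) {V : History F n → ℝ≥0∞} (hV : Measurable V)
    (H : ∀ h, ∀ᵐ O ∂(offerLaw σ h),
      expectStage σ h O (fun w m => r h O w m + contFlow σ V h O w m) ≤
        V h + expectStage σ h O (c h O)) (h : History F n) :
    expectTotal σ r h ≤ V h + expectTotal σ c h :=
  expectTotal_le_of_flow hr hc hV (fun h => by
    rw [expectFlow_add_expectNext hr, add_expectFlow]
    exact lintegral_mono_ae (H h)) h

theorem contFlow_le {V : History F n → ℝ≥0∞} (h : History F n) (O : Offers F n) (w : Choice n)
    (m : Quality) : contFlow σ V h O w m ≤ V (append h (O, w, m)) :=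
  mul_le_of_le_one_left zero_le (σ.agent.cont_le_one h O w m)

theorem reward_add_contFlow_le {V : History F n → ℝ≥0∞} (h : History F n) (O : Offers F n)
    (w : Choice n) (m : Quality) :
    reward σ h O w m + contFlow σ V h O w m ≤
      max (ENNReal.ofReal m) (V (append h (O, w, m))) := by
  unfold reward contFlow
  calc _ ≤ (1 - σ.agent.cont h O w m) * max (ENNReal.ofReal m) (V (append h (O, w, m))) +
        σ.agent.cont h O w m * max (ENNReal.ofReal m) (V (append h (O, w, m))) := by
          gcongr
          · exact le_max_left _ _
          · exact le_max_right _ _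
    _ = _ := by
      rw [← add_mul, tsub_add_cancel_of_le (σ.agent.cont_le_one h O w m), one_mul]

theorem ofReal_quality_le_one (m : Quality) : ENNReal.ofReal (m : ℝ) ≤ 1 := by
  simpa using ENNReal.ofReal_le_ofReal m.2.2

theorem expectTotal_zero (σ : Profile F n) (h : History F n) :
    expectTotal σ (fun _ _ _ _ => 0) h = 0 := by
  have h0 : expectFlow σ (fun _ _ _ _ => 0 : PeriodFlow F n) = fun _ => 0 :=
    funext fun h => expectFlow_const 0 h
  have key : ∀ s h, (expectNext σ)^[s] (fun _ => 0) h = 0 := by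
    intro s
    induction s with
    | zero => intro h; rfl
    | succ s ih =>
      intro h
      rw [Function.iterate_succ_apply', funext ih]
      exact expectNext_zero h
  unfold expectTotal
  rw [h0]
  exact ENNReal.tsum_eq_zero.2 fun s => key s h

/-- The constant `1` is a supersolution: stopping yields at most `1` and continuing is valued at
`1`. -/
theorem expectTotal_reward_le_one (σ : Profile F n) (h : History F n) :
    expectTotal σ (reward σ) h ≤ 1 := by
  have := expectTotal_le_of_stage (σ := σ) (measurableFlow_reward) (measurableFlow_const 0)
    (V := fun _ => 1) measurable_const (fun h => ae_of_all _ fun O => by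
      rw [expectStage_const, add_zero]
      refine (expectStage_mono fun w m => (reward_add_contFlow_le h O w m).trans ?_).trans
        (expectStage_const 1).le
      exact max_le (ofReal_quality_le_one m) le_rfl) h
  rwa [expectTotal_zero, add_zero] at this

theorem expectTotal_add {f g : PeriodFlow F n} (hf : MeasurableFlow f) (h : History F n) :
    expectTotal σ (fun h O w m => f h O w m + g h O w m) h =
      expectTotal σ f h + expectTotal σ g h := by
  have key : ∀ s h, (expectNext σ)^[s] (expectFlow σ (fun h O w m => f h O w m + g h O w m)) h =
      (expectNext σ)^[s] (expectFlow σ f) h + (expectNext σ)^[s] (expectFlow σ g) h := by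
    intro s
    induction s with
    | zero => intro h; exact expectFlow_add hf h
    | succ s ih =>
      intro h
      simp only [Function.iterate_succ_apply']
      rw [funext ih, expectNext_add (measurable_expectNext_iterate (measurable_expectFlow σ hf) s)]
  simp only [expectTotal, key]
  exact ENNReal.tsum_add

theorem expectTotal_congr {f g : PeriodFlow F n} (hfg : f = g) (h : History F n) :
    expectTotal σ f h = expectTotal σ g h := by rw [hfg]

/-- Expenses are the search costs plus the payments to the brokers. -/
theorem expectTotal_cost (k : ℝ) (h : History F n) :
    expectTotal σ (cost k) h =
      expectTotal σ (fun _ _ _ _ => ENNReal.ofReal k) h + ∑ i, brokerPayoff σ i h := by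
  have hsum : ∀ s : Finset (Fin n), MeasurableFlow (F := F) (n := n)
      (fun h O w m => ∑ i ∈ s, payment i h O w m) ∧
      expectTotal σ (fun h O w m => ∑ i ∈ s, payment i h O w m) h =
        ∑ i ∈ s, brokerPayoff σ i h := by
    intro s
    induction s using Finset.induction_on with
    | empty =>
      refine ⟨by simpa using measurableFlow_const 0, ?_⟩
      simp only [Finset.sum_empty]
      exact expectTotal_zero σ h
    | insert i s his ih =>
      simp only [Finset.sum_insert his]
      exact ⟨(measurableFlow_payment i).add ih.1, by
        rw [expectTotal_add (measurableFlow_payment i), ih.2]; rfl⟩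
  rw [← (hsum Finset.univ).2, ← expectTotal_add (measurableFlow_const _)]
  refine expectTotal_congr ?_ h
  funext h O w m
  cases w with
  | none => simp [cost, payment, price]
  | some i => simp [cost, payment, Finset.sum_ite_eq]

/-- The total of a flow is this period's flow plus the continuation total. -/
theorem expectTotal_eq {g : PeriodFlow F n} (hg : MeasurableFlow g) (h : History F n) :
    expectTotal σ g h = expectFlow σ g h + expectNext σ (expectTotal σ g) h := by
  refine le_antisymm ?_ ?_
  · refine le_of_tendsto' (tendsto_partialTotal g h) fun N => ?_
    refine (Finset.sum_le_sum_of_subset (Finset.range_mono N.le_succ)).trans ?_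
    change partialTotal σ g (N + 1) h ≤ _
    rw [partialTotal_succ hg]
    refine add_le_add_right (expectNext_mono ?_ h) _
    exact fun h => partialTotal_le_expectTotal g N h
  · have hmono : Monotone fun N => fun h => partialTotal σ g N h := fun M N hMN h =>
      Finset.sum_le_sum_of_subset (Finset.range_mono hMN)
    -- Monotone convergence is applied twice, over the realization and then over the offers.
    have hmeas : ∀ N, Measurable (partialTotal σ g N) := measurable_partialTotal hg
    have hstage : ∀ O w, Tendsto
        (fun N => ∫⁻ m, contFlow σ (partialTotal σ g N) h O w m ∂(signalLaw O w)) atTop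
        (𝓝 (∫⁻ m, contFlow σ (expectTotal σ g) h O w m ∂(signalLaw O w))) := by
      intro O w
      refine lintegral_tendsto_of_tendsto_of_monotone
        (fun N => ((measurableFlow_contFlow (hmeas N)).apply h O w).aemeasurable)
        (ae_of_all _ fun m M N hMN => ?_) (ae_of_all _ fun m => ?_)
      · change σ.agent.cont h O w m * _ ≤ σ.agent.cont h O w m * _
        gcongr
        exact hmono hMN _
      · refine ENNReal.Tendsto.const_mul (tendsto_partialTotal g _) (Or.inr ?_)
        exact ne_top_of_le_ne_top ENNReal.one_ne_top (σ.agent.cont_le_one h O w m)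
    have hnext : Tendsto (fun N => expectNext σ (partialTotal σ g N) h) atTop
        (𝓝 (expectNext σ (expectTotal σ g) h)) := by
      refine lintegral_tendsto_of_tendsto_of_monotone
        (fun N => (measurable_expectStage_left σ
          (measurableFlow_contFlow (hmeas N)) h).aemeasurable)
        (ae_of_all _ fun O M N hMN => expectStage_mono fun w m => ?_) (ae_of_all _ fun O => ?_)
      · gcongr
        exact hmono hMN _
      · refine tendsto_finsetSum _ fun w _ => ENNReal.Tendsto.const_mul (hstage O w) (Or.inr ?_)
        refine ne_top_of_le_ne_top ENNReal.one_ne_top ?_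
        rw [← σ.agent.sum_buy h O]
        exact Finset.single_le_sum (fun _ _ => zero_le) (Finset.mem_univ w)
    refine le_of_tendsto' (tendsto_const_nhds.add hnext) fun N => ?_
    rw [← partialTotal_succ hg]
    exact partialTotal_le_expectTotal g (N + 1) h

/-- A value function that solves the agent's Bellman equation is his payoff. -/
theorem expectTotal_reward_eq {k : ℝ} (hk : 0 < k) {V : History F n → ℝ≥0∞}
    (hV : Measurable V) (hV1 : ∀ h, V h ≤ 1)
    (H : ∀ h, expectFlow σ (reward σ) h + expectNext σ V h = V h + expectFlow σ (cost k) h)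
    (h : History F n) :
    expectTotal σ (reward σ) h = V h + expectTotal σ (cost k) h ∧
      expectTotal σ (cost k) h ≠ ⊤ := by
  -- The Bellman equation is iterated `N` times. What remains is `V` on the event that the search is
  -- still going on after `N` periods.
  have key : ∀ N h, V h + partialTotal σ (cost k) N h =
      partialTotal σ (reward σ) N h + (expectNext σ)^[N] V h := by
    intro N
    induction N with
    | zero => intro h; simp [partialTotal]
    | succ N ih =>
      intro h
      rw [partialTotal_succ (measurableFlow_cost k), partialTotal_succ measurableFlow_reward,
        ← add_assoc, ← H, add_assoc, ← expectNext_add hV, add_assoc,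
        Function.iterate_succ_apply', ← expectNext_add (measurable_partialTotal
          measurableFlow_reward N), ← funext ih]
  have hVN : ∀ N h, (expectNext σ)^[N] V h ≤ (expectNext σ)^[N] (fun _ => 1) h := by
    intro N
    induction N with
    | zero => exact hV1
    | succ N ih =>
      intro h
      simp only [Function.iterate_succ_apply']
      exact expectNext_mono ih h
  have hone : ∀ N h, (expectNext σ)^[N] (fun _ => 1) h ≤ 1 := by
    intro N
    induction N with
    | zero => intro h; exact le_rfl
    | succ N ih =>
      intro h
      rw [Function.iterate_succ_apply']
      refine (expectNext_mono ih h).trans ?_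
      refine (expectFlow_mono (f := contFlow σ fun _ => 1) (g := fun _ _ _ _ => 1)
        fun O w m => contFlow_le _ _ _ _).trans ?_
      exact (expectFlow_const 1 h).le
  have hk0 : ENNReal.ofReal k ≠ 0 := by simpa using hk
  have hC : expectTotal σ (cost k) h ≠ ⊤ := by
    refine ne_top_of_le_ne_top (b := 2) (by simp) ?_
    refine le_of_tendsto' (tendsto_partialTotal _ h) fun N => ?_
    calc partialTotal σ (cost k) N h ≤ V h + partialTotal σ (cost k) N h := le_add_self
      _ = _ := key N h
      _ ≤ 1 + 1 := by
        gcongr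
        · exact (partialTotal_le_expectTotal _ N h).trans (expectTotal_reward_le_one σ h)
        · exact (hVN N h).trans (hone N h)
      _ = 2 := one_add_one_eq_two
  refine ⟨?_, hC⟩
  have hterm : ∀ N h, ENNReal.ofReal k * (expectNext σ)^[N] (fun _ => 1) h ≤
      (expectNext σ)^[N] (expectFlow σ (cost k)) h := by
    intro N
    induction N with
    | zero =>
      intro h
      simp only [Function.iterate_zero, id, mul_one]
      refine (expectFlow_const (σ := σ) _ h).symm.le.trans (expectFlow_mono fun O w m => ?_)
      exact le_self_add
    | succ N ih =>
      intro h
      simp only [Function.iterate_succ_apply']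
      refine le_trans ?_ (expectNext_mono ih h)
      have h1 := measurable_expectNext_iterate (σ := σ) (f := fun _ => 1) measurable_const N
      rw [expectNext_const_mul h1]
  -- Transversality: each period costs at least `k > 0`, so finite expenses make the survival
  -- probabilities summable. They tend to zero, and the remainder with them because `V ≤ 1`.
  have hsum : ∑' N, (expectNext σ)^[N] (fun _ => 1) h ≠ ⊤ := by
    have h2 : ENNReal.ofReal k * ∑' N, (expectNext σ)^[N] (fun _ => 1) h ≠ ⊤ := by
      rw [← ENNReal.tsum_mul_left]
      exact ne_top_of_le_ne_top hC (ENNReal.tsum_le_tsum fun N => hterm N h)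
    intro h3
    rw [h3, ENNReal.mul_top hk0] at h2
    exact h2 rfl
  have hlim : Tendsto (fun N => (expectNext σ)^[N] V h) atTop (𝓝 0) :=
    tendsto_of_tendsto_of_tendsto_of_le_of_le tendsto_const_nhds
      (ENNReal.tendsto_atTop_zero_of_tsum_ne_top hsum) (fun _ => zero_le) fun N => hVN N h
  have h1 : Tendsto (fun N => V h + partialTotal σ (cost k) N h) atTop
      (𝓝 (V h + expectTotal σ (cost k) h)) :=
    tendsto_const_nhds.add (tendsto_partialTotal _ h)
  have h2 : Tendsto (fun N => V h + partialTotal σ (cost k) N h) atTop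
      (𝓝 (expectTotal σ (reward σ) h + 0)) := by
    simp only [key]
    exact (tendsto_partialTotal _ h).add hlim
  rw [tendsto_nhds_unique h1 h2, add_zero]

/-- A lower bound for totals when the search goes on with probability at least `q`. -/
theorem geometric_le_expectTotal {g : PeriodFlow F n} {a q : ℝ≥0∞}
    (ha : ∀ h, a ≤ expectFlow σ g h)
    (hq : ∀ h (x : ℝ≥0∞), q * x ≤ expectNext σ (fun _ => x) h) (h : History F n) :
    a * (1 - q)⁻¹ ≤ expectTotal σ g h := by
  have key : ∀ N h, a * q ^ N ≤ (expectNext σ)^[N] (expectFlow σ g) h := by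
    intro N
    induction N with
    | zero => intro h; simpa using ha h
    | succ N ih =>
      intro h
      rw [Function.iterate_succ_apply']
      refine le_trans ?_ (expectNext_mono ih h)
      refine le_trans ?_ (hq h _)
      rw [pow_succ, mul_comm q, mul_assoc]
  rw [← ENNReal.tsum_geometric, ← ENNReal.tsum_mul_left]
  exact ENNReal.tsum_le_tsum fun N => key N h

end Totals

/-! ### The excess function of a distribution -/

section Excess

/-- The expected excess of the quality over `u`. -/
def excess (G : Measure Quality) (u : ℝ) : ℝ := ∫ m, max ((m : ℝ) - u) 0 ∂G

variable {G : Measure Quality} [IsProbabilityMeasure G]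

theorem integrable_quality : Integrable (fun m : Quality => (m : ℝ)) G :=
  Integrable.of_bound (by fun_prop) 1 (ae_of_all _ fun m => by
    rw [Real.norm_eq_abs, abs_of_nonneg m.2.1]; exact m.2.2)

theorem integrable_excess (u : ℝ) : Integrable (fun m : Quality => max ((m : ℝ) - u) 0) G :=
  (integrable_quality.sub (integrable_const u)).sup (integrable_const 0)

theorem excess_nonneg (G : Measure Quality) (u : ℝ) : 0 ≤ excess G u :=
  integral_nonneg fun _ => le_max_right _ _

theorem excess_antitone : Antitone (excess G) := fun u v huv =>
  integral_mono (integrable_excess v) (integrable_excess u) fun m => by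
    exact max_le_max (by linarith) le_rfl

theorem excess_le_excess_add (u v : ℝ) (huv : u ≤ v) : excess G u ≤ excess G v + (v - u) := by
  have : excess G v + (v - u) = ∫ m, (max ((m : ℝ) - v) 0 + (v - u)) ∂G := by
    rw [integral_add (integrable_excess v) (integrable_const _)]; simp [excess]
  rw [this]
  refine integral_mono (integrable_excess u) ((integrable_excess v).add (integrable_const _)) ?_
  intro m
  refine max_le ?_ ?_
  · have := le_max_left ((m : ℝ) - v) 0
    linarith
  · have := le_max_right ((m : ℝ) - v) 0
    linarith

omit [IsProbabilityMeasure G] in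
theorem excess_zero : excess G 0 = priorMean G := by
  refine integral_congr_ae (ae_of_all _ fun m => ?_)
  simp [m.2.1]

omit [IsProbabilityMeasure G] in
theorem excess_one : excess G 1 = 0 := by
  have : ∀ m : Quality, max ((m : ℝ) - 1) 0 = 0 := fun m => max_eq_right (by linarith [m.2.2])
  simp [excess, this]

theorem sub_le_excess (u : ℝ) : priorMean G - u ≤ excess G u := by
  have : priorMean G - u = ∫ m : Quality, ((m : ℝ) - u) ∂G := by
    rw [integral_sub integrable_quality (integrable_const u)]; simp [priorMean]
  rw [this]
  exact integral_mono (integrable_quality.sub (integrable_const u)) (integrable_excess u)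
    fun m => le_max_left _ _

theorem excess_continuous : Continuous (excess G) := by
  refine (LipschitzWith.of_le_add_mul 1 fun u v => ?_).continuous
  rw [NNReal.coe_one, one_mul, Real.dist_eq]
  rcases le_total u v with h | h
  · have := excess_le_excess_add (G := G) u v h
    rw [abs_sub_comm, abs_of_nonneg (by linarith)]
    exact this
  · exact (excess_antitone h).trans (le_add_of_nonneg_right (abs_nonneg _))

/-- Equality would force the two truncated excesses to agree almost surely. They differ wherever the
quality exceeds `v`, so the excess at `v` would vanish. -/
theorem excess_lt_excess {u v : ℝ} (huv : u < v) (hv : 0 < excess G v) :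
    excess G v < excess G u := by
  refine lt_of_le_of_ne (excess_antitone huv.le) fun heq => ?_
  have h0 : ∫ m : Quality, (max ((m : ℝ) - u) 0 - max ((m : ℝ) - v) 0) ∂G = 0 := by
    rw [integral_sub (integrable_excess u) (integrable_excess v)]
    exact sub_eq_zero.2 heq.symm
  rw [integral_eq_zero_iff_of_nonneg (fun m => sub_nonneg.2 (max_le_max (by linarith) le_rfl))
    ((integrable_excess u).sub (integrable_excess v))] at h0
  have h1 : excess G v = 0 := by
    refine integral_eq_zero_of_ae ?_
    filter_upwards [h0] with m hm
    simp only [Pi.zero_apply] at hm ⊢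
    refine max_eq_right ?_
    by_contra hlt
    rw [not_le] at hlt
    rw [max_eq_left (by linarith), max_eq_left hlt.le] at hm
    linarith
  exact hv.ne' h1

theorem le_of_excess_le {u v : ℝ} (hu : 0 < excess G u) (h : excess G u ≤ excess G v) :
    v ≤ u := by
  by_contra hlt
  rw [not_le] at hlt
  by_cases hv : 0 < excess G v
  · exact absurd (excess_lt_excess hlt hv) (not_lt.2 h)
  · linarith

theorem add_excess_mono : Monotone fun u => u + excess G u := fun u v huv => by
  have := excess_le_excess_add (G := G) u v huv
  simp only
  linarith

theorem add_excess_le_one {u : ℝ} (hu : u ≤ 1) : u + excess G u ≤ 1 := by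
  simpa [excess_one] using add_excess_mono (G := G) hu

/-- An agent with continuation payoff `v` who observes `m` gets `max m v = v + (m - v)^+`. This is
the bridge between stage payoffs in `[0,∞]` and the real-valued excess function. -/
theorem lintegral_max_ofReal {v : ℝ} (hv : 0 ≤ v) :
    ∫⁻ m, max (ENNReal.ofReal (m : ℝ)) (ENNReal.ofReal v) ∂G =
      ENNReal.ofReal (v + excess G v) := by
  have h1 : ∀ m : Quality, max (ENNReal.ofReal (m : ℝ)) (ENNReal.ofReal v) =
      ENNReal.ofReal (v + max ((m : ℝ) - v) 0) := fun m => by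
    rw [← ENNReal.ofReal_max]
    congr 1
    rw [← max_add_add_left]; simp
  simp only [h1]
  rw [← ofReal_integral_eq_lintegral_ofReal
    (f := fun m : Quality => v + max ((m : ℝ) - v) 0)
    ((integrable_const v).add (integrable_excess v))
    (ae_of_all _ fun m => add_nonneg hv (le_max_right _ _)),
    integral_add (integrable_const v) (integrable_excess v)]
  simp [excess]

omit [IsProbabilityMeasure G] in
theorem setIntegral_eq_excess (u : ℝ) :
    ∫ θ in {θ : Quality | u ≤ (θ : ℝ)}, ((θ : ℝ) - u) ∂G = excess G u := by
  rw [← integral_indicator (measurableSet_le measurable_const measurable_subtype_coe)]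
  refine integral_congr_ae (ae_of_all _ fun θ => ?_)
  by_cases h : u ≤ (θ : ℝ)
  · simp [Set.indicator, h]
  · simp [Set.indicator, h, (not_le.1 h).le]

end Excess

/-! ### The full-information payoff and the threshold search cost -/

section McCall

variable {F : Measure Quality} [IsProbabilityMeasure F] {k : ℝ}

theorem priorMean_le_one : priorMean F ≤ 1 := by
  have := add_excess_le_one (G := F) zero_le_one
  rwa [zero_add, excess_zero] at this

/-- The supremum in the definition runs over a singleton, since the excess function is injective
where it is positive. -/
theorem mcCallPayoff_eq {u : ℝ} (hk : 0 < k) (hu : excess F u = k) : mcCallPayoff F k = u := by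
  have : {u : ℝ | k = ∫ θ in {θ : Quality | u ≤ (θ : ℝ)}, ((θ : ℝ) - u) ∂F} = {u} := by
    ext v
    simp only [setIntegral_eq_excess, Set.mem_ofPred_eq, Set.mem_singleton_iff]
    refine ⟨fun hv => ?_, fun hv => by rw [hv, hu]⟩
    exact le_antisymm (le_of_excess_le (by rw [hu]; exact hk) (by rw [hu, ← hv]))
      (le_of_excess_le (by rw [← hv]; exact hk) (by rw [hu, ← hv]))
  rw [mcCallPayoff, this, csSup_singleton]

theorem exists_excess_eq (hk : 0 < k) (hk1 : k < priorMean F) :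
    ∃ u ∈ Set.Ioo (0 : ℝ) 1, excess F u = k := by
  have := intermediate_value_Ioo' (zero_le_one' ℝ) (excess_continuous (G := F)).continuousOn
  rw [excess_one, excess_zero] at this
  exact this ⟨hk, hk1⟩

theorem excess_mcCallPayoff (hk : 0 < k) (hk1 : k < priorMean F) :
    excess F (mcCallPayoff F k) = k := by
  obtain ⟨u, -, hu⟩ := exists_excess_eq hk hk1
  rw [mcCallPayoff_eq hk hu, hu]

theorem mcCallPayoff_mem (hk : 0 < k) (hk1 : k < priorMean F) :
    mcCallPayoff F k ∈ Set.Ioo (0 : ℝ) 1 := by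
  obtain ⟨u, hmem, hu⟩ := exists_excess_eq hk hk1
  rwa [mcCallPayoff_eq hk hu]

theorem le_mcCallPayoff (hk : 0 < k) (hk1 : k < priorMean F) {u : ℝ} (hu : k ≤ excess F u) :
    u ≤ mcCallPayoff F k :=
  le_of_excess_le (by rwa [excess_mcCallPayoff hk hk1]) (by rwa [excess_mcCallPayoff hk hk1])

theorem autarky_le_mcCall (hk : 0 < k) (hk1 : k < priorMean F) :
    autarkyPayoff F k ≤ mcCallPayoff F k := by
  refine le_mcCallPayoff hk hk1 ?_
  have := sub_le_excess (G := F) (autarkyPayoff F k)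
  simp only [autarkyPayoff] at this ⊢
  linarith

/-- The value of full information to an agent whose continuation payoff is the autarky payoff,
gross of the search cost. -/
def autarkyInformed (F : Measure Quality) (k : ℝ) : ℝ :=
  autarkyPayoff F k + excess F (autarkyPayoff F k)

theorem priorMean_le_autarkyInformed : priorMean F ≤ autarkyInformed F k := by
  have := sub_le_excess (G := F) (autarkyPayoff F k)
  simp only [autarkyInformed]
  linarith

/-- The map `u ↦ u + excess F u` is the mean of `max θ u`, hence increasing, and the autarky payoff
falls with `k`. -/
theorem autarkyInformed_antitone : Antitone (autarkyInformed F) := fun k l h =>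
  add_excess_mono (G := F) (by simp only [autarkyPayoff]; linarith)

theorem measure_singleton_eq_zero (hF : F ≪ (volume : Measure Quality)) (x : ℝ) :
    ¬ ∀ᵐ θ : Quality ∂F, (θ : ℝ) = x := by
  intro h
  have hs : MeasurableSet (Subtype.val ⁻¹' {x} : Set Quality) :=
    measurable_subtype_coe (measurableSet_singleton x)
  have h1 : F (Subtype.val ⁻¹' {x}) = 0 := by
    refine hF ?_
    rw [Measure.Subtype.volume_def, Measure.comap_apply _ Subtype.val_injective
      (fun s hs => (MeasurableEmbedding.subtype_coe measurableSet_Icc).measurableSet_image.2 hs) _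
      hs]
    exact measure_mono_null (Set.image_preimage_subset _ _) (by simp)
  have h2 : F (Subtype.val ⁻¹' {x})ᶜ = 0 := h
  have h3 := measure_add_measure_compl (μ := F) hs
  rw [h1, h2] at h3
  simp at h3

theorem priorMean_pos (hF : F ≪ (volume : Measure Quality)) : 0 < priorMean F := by
  refine lt_of_le_of_ne (integral_nonneg fun θ => θ.2.1) fun h => ?_
  refine measure_singleton_eq_zero hF 0 ?_
  exact (integral_eq_zero_iff_of_nonneg (fun θ : Quality => θ.2.1) integrable_quality).1 h.symm

/-- Write `d = m + E(θ - m)^+`. If the excess at `d` vanished, then `θ ≤ d` almost surely, so `(θ -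
m)^+` would be bounded by its own mean and hence constant. This makes `F` a point mass, which
absolute continuity excludes. -/
theorem excess_pos_of_free (hF : F ≪ (volume : Measure Quality)) :
    0 < excess F (autarkyInformed F 0) := by
  set d := autarkyInformed F 0 with hd
  have hmd : priorMean F ≤ d := priorMean_le_autarkyInformed
  refine lt_of_le_of_ne (excess_nonneg F d) fun h => ?_
  have h1 := (integral_eq_zero_iff_of_nonneg (fun θ : Quality => le_max_right ((θ : ℝ) - d) 0)
    (integrable_excess d)).1 h.symm
  have hle : ∀ᵐ θ : Quality ∂F, (θ : ℝ) ≤ d := by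
    filter_upwards [h1] with θ hθ
    simp only [Pi.zero_apply] at hθ
    linarith [le_max_left ((θ : ℝ) - d) 0]
  have hd' : d = priorMean F + excess F (priorMean F) := by
    simp [hd, autarkyInformed, autarkyPayoff]
  have h2 : ∀ᵐ θ : Quality ∂F, d - priorMean F - max ((θ : ℝ) - priorMean F) 0 = 0 := by
    refine (integral_eq_zero_iff_of_nonneg_ae ?_
      ((integrable_const _).sub (integrable_excess _))).1 ?_
    · filter_upwards [hle] with θ hθ
      simp only [Pi.zero_apply]
      exact sub_nonneg.2 (max_le (by linarith) (by linarith))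
    · rw [integral_sub' (integrable_const _) (integrable_excess _)]
      simp only [integral_const, probReal_univ, smul_eq_mul, one_mul]
      change d - priorMean F - excess F (priorMean F) = 0
      linarith
  -- If `m < d`, the constant `(θ - m)^+ = d - m` is positive and `θ = d`. If `m = d`, then `θ ≤ d`
  -- has mean `d`, so again `θ = d`.
  rcases hmd.lt_or_eq with hlt | heq
  · refine measure_singleton_eq_zero hF d ?_
    filter_upwards [h2] with θ hθ
    rcases max_cases ((θ : ℝ) - priorMean F) 0 with h | h <;> linarith
  · refine measure_singleton_eq_zero hF d ?_
    have h3 : ∀ᵐ θ : Quality ∂F, d - (θ : ℝ) = 0 := by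
      refine (integral_eq_zero_iff_of_nonneg_ae ?_
        ((integrable_const d).sub integrable_quality)).1 ?_
      · filter_upwards [hle] with θ hθ
        simpa using hθ
      · rw [integral_sub' (integrable_const _) integrable_quality]
        simp only [integral_const, probReal_univ, smul_eq_mul, one_mul]
        change d - priorMean F = 0
        linarith
    filter_upwards [h3] with θ hθ
    linarith

/-- The threshold search cost: full information at the autarky continuation payoff is worth as
much as the full-information payoff. -/
theorem exists_threshold (hF : F ≪ (volume : Measure Quality)) :
    ∃ ks, 0 < ks ∧ ks < priorMean F ∧ excess F (autarkyInformed F ks) = ks ∧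
      (∀ k, 0 < k → k ≤ ks → autarkyInformed F k ≤ mcCallPayoff F k) ∧
      (∀ k, ks < k → k < priorMean F → mcCallPayoff F k < autarkyInformed F k) := by
  have hm := priorMean_pos hF
  have hcont : Continuous fun k => excess F (autarkyInformed F k) - k := by
    have h1 : Continuous (autarkyPayoff F) := continuous_const.sub continuous_id
    exact (excess_continuous.comp (h1.add (excess_continuous.comp h1))).sub continuous_id
  have hright : excess F (autarkyInformed F (priorMean F)) - priorMean F < 0 := by
    have h1 : autarkyInformed F (priorMean F) = priorMean F := by
      simp [autarkyInformed, autarkyPayoff, excess_zero]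
    rw [h1]
    by_cases h : 0 < excess F (priorMean F)
    · have := excess_lt_excess hm h
      rw [excess_zero] at this
      linarith
    · linarith
  have hleft : 0 < excess F (autarkyInformed F 0) - 0 := by
    rw [sub_zero]; exact excess_pos_of_free hF
  obtain ⟨ks, ⟨hks0, hks1⟩, hks⟩ :=
    intermediate_value_Ioo' hm.le hcont.continuousOn ⟨hright, hleft⟩
  simp only at hks
  -- Raising `k` to `l` lowers `D` by `l - k` minus the strict increase of the excess at the autarky
  -- payoff, hence by less than `l - k`. The excess function is 1-Lipschitz, so `excess F D` rises
  -- by less than `l - k`.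
  have hanti : ∀ k l, 0 < k → k < l → l ≤ priorMean F →
      excess F (autarkyInformed F l) - l < excess F (autarkyInformed F k) - k := by
    intro k l hk hkl hl
    have h1 := excess_le_excess_add (G := F) _ _ (autarkyInformed_antitone (F := F) hkl.le)
    have h2 : excess F (autarkyPayoff F k) < excess F (autarkyPayoff F l) := by
      refine excess_lt_excess (by simp only [autarkyPayoff]; linarith) ?_
      have := sub_le_excess (G := F) (autarkyPayoff F k)
      simp only [autarkyPayoff] at this ⊢
      linarith
    simp only [autarkyInformed, autarkyPayoff] at h1 h2 ⊢
    linarith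
  refine ⟨ks, hks0, hks1, by linarith, fun k hk hkk => ?_, fun k hkk hk1 => ?_⟩
  · refine le_mcCallPayoff hk (by linarith) ?_
    rcases hkk.lt_or_eq with h | h
    · linarith [hanti k ks hk h hks1.le]
    · rw [h]; linarith
  · by_contra hle
    rw [not_lt] at hle
    have h1 := hanti ks k hks0 hkk hk1.le
    have h2 := excess_antitone (G := F) hle
    rw [excess_mcCallPayoff (by linarith) hk1] at h2
    linarith

/-- Equality would give the excess function the same positive value `ks` at the autarky payoff and
at the prior mean, although it is strictly decreasing there. -/
theorem priorMean_lt_autarkyInformed {ks : ℝ} (h0 : 0 < ks)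
    (hks : excess F (autarkyInformed F ks) = ks) : priorMean F < autarkyInformed F ks := by
  refine lt_of_le_of_ne priorMean_le_autarkyInformed fun h => ?_
  rw [← h] at hks
  have h1 := excess_lt_excess (G := F) (u := autarkyPayoff F ks) (v := priorMean F)
    (by simp only [autarkyPayoff]; linarith) (by linarith)
  simp only [autarkyInformed, autarkyPayoff] at h h1
  linarith

end McCall

/-! ### Constructions of signals -/

section Signals

variable {F : Measure Quality} [IsProbabilityMeasure F]

instance (G : Signal F) : IsProbabilityMeasure G.1 := G.2.1

omit [IsProbabilityMeasure F] in
theorem excess_signal_le (G : Signal F) (u : ℝ) : excess G.1 u ≤ excess F u := G.2.2.2 u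

theorem integral_convexComb {μ ν : Measure Quality} [IsProbabilityMeasure μ]
    [IsProbabilityMeasure ν] {t : ℝ} (ht : t ∈ Set.Icc (0 : ℝ) 1) {f : Quality → ℝ}
    (hμ : Integrable f μ) (hν : Integrable f ν) :
    ∫ m, f m ∂(ENNReal.ofReal t • μ + ENNReal.ofReal (1 - t) • ν) =
      t * ∫ m, f m ∂μ + (1 - t) * ∫ m, f m ∂ν := by
  rw [integral_add_measure (hμ.smul_measure ENNReal.ofReal_ne_top)
    (hν.smul_measure ENNReal.ofReal_ne_top), integral_smul_measure, integral_smul_measure,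
    ENNReal.toReal_ofReal ht.1, ENNReal.toReal_ofReal (by linarith [ht.2])]
  rfl

theorem isProbabilityMeasure_convexComb {μ ν : Measure Quality} [IsProbabilityMeasure μ]
    [IsProbabilityMeasure ν] {t : ℝ} (ht : t ∈ Set.Icc (0 : ℝ) 1) :
    IsProbabilityMeasure (ENNReal.ofReal t • μ + ENNReal.ofReal (1 - t) • ν) := ⟨by
  simp only [Measure.add_apply, Measure.smul_apply, measure_univ, smul_eq_mul, mul_one]
  rw [← ENNReal.ofReal_add ht.1 (by linarith [ht.2])]
  simp⟩

/-- Full information with probability `t`, and no information otherwise. -/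
theorem exists_signal_mix (F : Measure Quality) [IsProbabilityMeasure F] {t : ℝ}
    (ht : t ∈ Set.Icc (0 : ℝ) 1) :
    ∃ G : Signal F, ∀ u,
      excess G.1 u = t * excess F u + (1 - t) * max (priorMean F - u) 0 := by
  have hG : ∀ u, excess (ENNReal.ofReal t • F +
      ENNReal.ofReal (1 - t) • Measure.dirac (priorMeanPoint F)) u =
        t * excess F u + (1 - t) * max (priorMean F - u) 0 := fun u => by
    rw [excess, integral_convexComb ht (integrable_excess u) (integrable_excess u),
      integral_dirac, coe_priorMeanPoint]
    rfl
  refine ⟨⟨_, isProbabilityMeasure_convexComb ht, ?_, fun u => ?_⟩, hG⟩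
  · rw [integral_convexComb ht integrable_quality integrable_quality, integral_dirac,
      coe_priorMeanPoint]
    simp only [priorMean]
    ring
  · change excess _ u ≤ excess F u
    rw [hG]
    have h1 : max (priorMean F - u) 0 ≤ excess F u :=
      max_le (sub_le_excess u) (excess_nonneg F u)
    nlinarith [ht.2]

/-- A signal with one realization, of probability `a`, for the qualities in the upper tail and
one for all others. The upper tail is detected with probability `c`. -/
theorem exists_signal_cutoff (F : Measure Quality) [IsProbabilityMeasure F] {c : ℝ} (hc0 : 0 < c)
    (hc1 : c ≤ 1) (v : ℝ) :
    ∃ (G : Signal F) (a x : ℝ), 0 ≤ a ∧ a ≤ c ∧ x ≤ a ∧ 0 ≤ x ∧ x ≤ priorMean F ∧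
      x - a * v = c * excess F v ∧
      (∀ u, excess G.1 u = max (x - a * u) 0 + max (priorMean F - x - (1 - a) * u) 0) ∧
      ENNReal.ofReal (1 - a) ≤
        G.1 {m : Quality | (m : ℝ) = (priorMean F - x) / (1 - a)} := by
  set A : Set Quality := {θ : Quality | v ≤ (θ : ℝ)}
  have hA : MeasurableSet A := measurableSet_le measurable_const measurable_subtype_coe
  -- `f` is the probability of the high realization given the quality. Below, `a` is the mass of the
  -- high realization and `x` that mass times its posterior mean.
  set f : Quality → ℝ := A.indicator fun _ => c with hf
  have hf0 : ∀ θ, 0 ≤ f θ := fun θ => Set.indicator_nonneg (fun _ _ => hc0.le) θ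
  have hf1 : ∀ θ, f θ ≤ 1 := fun θ => Set.indicator_le' (fun _ _ => hc1) (fun _ _ => zero_le_one) θ
  have hfm : Measurable f := measurable_const.indicator hA
  have hint : ∀ g : Quality → ℝ, Integrable g F → Integrable (fun θ => f θ * g θ) F := by
    intro g hg
    exact hg.bdd_mul (c := 1) hfm.aestronglyMeasurable (ae_of_all _ fun θ => by
      rw [Real.norm_eq_abs, abs_of_nonneg (hf0 θ)]; exact hf1 θ)
  have hfi : Integrable f F := by simpa using hint (fun _ => 1) (integrable_const 1)
  have hqi := integrable_quality (G := F)
  have hfq := hint _ hqi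
  set a := ∫ θ, f θ ∂F with ha
  set x := ∫ θ : Quality, f θ * (θ : ℝ) ∂F with hx
  set m := priorMean F with hm
  have ha0 : 0 ≤ a := integral_nonneg hf0
  have hac : a ≤ c := by
    have := integral_mono hfi (integrable_const c) fun θ =>
      Set.indicator_le' (fun _ _ => le_rfl) (fun _ _ => hc0.le) θ
    simpa using this
  have ha1 : a ≤ 1 := hac.trans hc1
  have hx0 : 0 ≤ x := integral_nonneg fun θ => mul_nonneg (hf0 θ) θ.2.1
  have hxa : x ≤ a := integral_mono hfq hfi fun θ => mul_le_of_le_one_right (hf0 θ) θ.2.2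
  have hxm : x ≤ m := integral_mono hfq hqi fun θ => mul_le_of_le_one_left θ.2.1 (hf1 θ)
  have hb : m - x ≤ 1 - a := by
    have : ∫ θ : Quality, (θ : ℝ) - f θ * θ ∂F ≤ ∫ θ, 1 - f θ ∂F := by
      refine integral_mono (hqi.sub hfq) ((integrable_const 1).sub hfi) fun θ => ?_
      have h1 := hf1 θ
      have h2 := θ.2.2
      nlinarith
    rw [integral_sub hqi hfq, integral_sub (integrable_const 1) hfi] at this
    simp only [integral_const, probReal_univ, smul_eq_mul, mul_one] at this
    exact this
  -- Above `v` the integrand is `c (θ - v)` and below `v` it is zero, so pooling the upper tail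
  -- loses nothing at the cutoff itself.
  have hcut : x - a * v = c * excess F v := by
    rw [hx, ha, ← integral_mul_const, ← integral_sub hfq (hfi.mul_const v), excess,
      ← integral_const_mul]
    refine integral_congr_ae (ae_of_all _ fun θ => ?_)
    by_cases h : θ ∈ A
    · have h' : v ≤ (θ : ℝ) := h
      simp [hf, h, h', ← mul_sub]
    · have h' : (θ : ℝ) ≤ v := (not_le.1 (show ¬ v ≤ (θ : ℝ) from h)).le
      simp [hf, h, h']
  -- Jensen's inequality on each of the two pools shows that merging qualities lowers the excess.
  -- The bounds sum to the mean-preserving contraction property.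
  have hJ1 : ∀ u, max (x - a * u) 0 ≤ ∫ θ : Quality, f θ * max ((θ : ℝ) - u) 0 ∂F := fun u => by
    refine max_le ?_ (integral_nonneg fun θ => mul_nonneg (hf0 θ) (le_max_right _ _))
    rw [hx, ha, ← integral_mul_const, ← integral_sub hfq (hfi.mul_const u)]
    refine integral_mono (hfq.sub (hfi.mul_const u)) (hint _ (integrable_excess u)) fun θ => ?_
    simp only
    rw [← mul_sub]
    exact mul_le_mul_of_nonneg_left (le_max_left _ _) (hf0 θ)
  have hJ2 : ∀ u, max (m - x - (1 - a) * u) 0 ≤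
      excess F u - ∫ θ : Quality, f θ * max ((θ : ℝ) - u) 0 ∂F := fun u => by
    rw [excess, ← integral_sub (integrable_excess u) (hint _ (integrable_excess u))]
    refine max_le ?_ (integral_nonneg fun θ => ?_)
    · have h1 : m - x - (1 - a) * u =
          ∫ θ : Quality, (((θ : ℝ) - f θ * θ) - (1 - f θ) * u) ∂F := by
        have i1 : Integrable (fun θ : Quality => (θ : ℝ) - f θ * θ) F := hqi.sub hfq
        have i2 : Integrable (fun θ => (1 - f θ) * u) F :=
          ((integrable_const 1).sub hfi).mul_const u
        rw [integral_sub i1 i2, integral_sub hqi hfq, integral_mul_const, integral_sub (integrable_const 1) hfi]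
        simp [hm, priorMean, ha, hx]
      rw [h1]
      refine integral_mono ((hqi.sub hfq).sub (((integrable_const 1).sub hfi).mul_const u))
        ((integrable_excess u).sub (hint _ (integrable_excess u))) fun θ => ?_
      have h2 := le_max_left ((θ : ℝ) - u) 0
      have h3 := hf1 θ
      simp only
      nlinarith
    · have h2 := le_max_right ((θ : ℝ) - u) 0
      have h3 := hf1 θ
      simp only [Pi.zero_apply]
      nlinarith
  have hpt1 : x / a ∈ Set.Icc (0 : ℝ) 1 := ⟨div_nonneg hx0 ha0, div_le_one_of_le₀ hxa ha0⟩
  have hpt2 : (m - x) / (1 - a) ∈ Set.Icc (0 : ℝ) 1 :=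
    ⟨div_nonneg (by linarith) (by linarith), div_le_one_of_le₀ hb (by linarith)⟩
  -- If `a = 0` then `x = 0`, so the default value of the division is harmless. The same holds for
  -- the other pool when `a = 1`.
  have hscale1 : a * (x / a) = x := by
    rcases ha0.lt_or_eq with h | h
    · field_simp
    · rw [← h] at hxa ⊢; linarith
  have hscale2 : (1 - a) * ((m - x) / (1 - a)) = m - x := by
    rcases ha1.lt_or_eq with h | h
    · have : 1 - a ≠ 0 := by linarith
      field_simp
    · rw [h] at hb ⊢; linarith
  set p : Quality := ⟨x / a, hpt1⟩
  set q : Quality := ⟨(m - x) / (1 - a), hpt2⟩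
  have hG : ∀ u, excess (ENNReal.ofReal a • Measure.dirac p +
      ENNReal.ofReal (1 - a) • Measure.dirac q) u =
        max (x - a * u) 0 + max (m - x - (1 - a) * u) 0 := fun u => by
    rw [excess, integral_convexComb ⟨ha0, ha1⟩ (integrable_excess u) (integrable_excess u),
      integral_dirac, integral_dirac, mul_max_of_nonneg _ _ ha0,
      mul_max_of_nonneg _ _ (by linarith : 0 ≤ 1 - a), mul_sub, mul_sub]
    simp only [p, q, hscale1, hscale2, mul_zero]
  refine ⟨⟨_, isProbabilityMeasure_convexComb ⟨ha0, ha1⟩, ?_, fun u => ?_⟩, a, x, ha0, hac, hxa,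
    hx0, hxm, hcut, hG, ?_⟩
  · rw [integral_convexComb ⟨ha0, ha1⟩ integrable_quality integrable_quality, integral_dirac,
      integral_dirac]
    simp only [p, q, hscale1, hscale2]
    simp [hm, priorMean]
  · change excess _ u ≤ excess F u
    rw [hG]
    linarith [hJ1 u, hJ2 u]
  · have hq : Measure.dirac q {z : Quality | (z : ℝ) = (m - x) / (1 - a)} = 1 :=
      Measure.dirac_apply_of_mem (show (q : ℝ) = _ from rfl)
    simp only [Measure.add_apply, Measure.smul_apply, smul_eq_mul, hq, mul_one]
    exact le_add_self

end Signals

/-- Infinite expenses `b` make the left side `-∞`, so only the reward has to be finite. -/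
theorem coe_sub_coe_le {a b x : ℝ≥0∞} (ha : a ≠ ⊤) (h : a ≤ x + b) :
    (a : EReal) - (b : EReal) ≤ (x : EReal) := by
  have h' : (a : EReal) ≤ x + b := by
    rw [← EReal.coe_ennreal_add]; exact EReal.coe_ennreal_le_coe_ennreal_iff.2 h
  by_cases hb : b = ⊤
  · subst hb
    lift a to ℝ≥0 using ha
    simp
  · exact EReal.sub_le_of_le_add h'

theorem coe_sub_coe_eq {a b x : ℝ≥0∞} (hb : b ≠ ⊤) (h : a = x + b) :
    (a : EReal) - (b : EReal) = (x : EReal) := by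
  rw [h, EReal.coe_ennreal_add]
  lift b to ℝ≥0 using hb
  exact EReal.add_sub_cancel_right

theorem add_le_of_coe_le_coe_sub {a b x : ℝ≥0∞} (ha : a ≠ ⊤)
    (h : (x : EReal) ≤ (a : EReal) - (b : EReal)) : x + b ≤ a := by
  have hb : b ≠ ⊤ := by
    rintro rfl
    lift a to ℝ≥0 using ha
    simp at h
  rw [← EReal.coe_ennreal_le_coe_ennreal_iff, EReal.coe_ennreal_add]
  lift b to ℝ≥0 using hb
  lift a to ℝ≥0 using ha
  exact EReal.add_le_of_le_sub h

/-! ### One-shot deviation principle for the agent -/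

section Verification

variable {F : Measure Quality} {n : ℕ} {σ : Profile F n}

theorem expectStage_le_add {h : History F n} {O : Offers F n} {f g : Choice n → Quality → ℝ≥0∞}
    {y : ℝ≥0∞} (H : ∀ w, σ.agent.buy h O w ≠ 0 →
      ∫⁻ m, f w m ∂(signalLaw O w) ≤ y + ∫⁻ m, g w m ∂(signalLaw O w)) :
    expectStage σ h O f ≤ y + expectStage σ h O g := by
  calc expectStage σ h O f
      ≤ ∑ w, σ.agent.buy h O w * (y + ∫⁻ m, g w m ∂(signalLaw O w)) := by
        refine Finset.sum_le_sum fun w _ => ?_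
        by_cases hw : σ.agent.buy h O w = 0
        · simp [hw]
        · gcongr
          exact H w hw
    _ = y + expectStage σ h O g := by
        simp only [mul_add, Finset.sum_add_distrib, ← Finset.sum_mul, σ.agent.sum_buy, one_mul,
          expectStage]

theorem add_le_expectStage {h : History F n} {O : Offers F n} {f g : Choice n → Quality → ℝ≥0∞}
    {y : ℝ≥0∞} (H : ∀ w, σ.agent.buy h O w ≠ 0 →
      y + ∫⁻ m, g w m ∂(signalLaw O w) ≤ ∫⁻ m, f w m ∂(signalLaw O w)) :
    y + expectStage σ h O g ≤ expectStage σ h O f := by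
  calc y + expectStage σ h O g
      = ∑ w, σ.agent.buy h O w * (y + ∫⁻ m, g w m ∂(signalLaw O w)) := by
        simp only [mul_add, Finset.sum_add_distrib, ← Finset.sum_mul, σ.agent.sum_buy, one_mul,
          expectStage]
    _ ≤ expectStage σ h O f := by
        refine Finset.sum_le_sum fun w _ => ?_
        by_cases hw : σ.agent.buy h O w = 0
        · simp [hw]
        · gcongr
          exact H w hw

theorem lintegral_cost (k : ℝ) (h : History F n) (O : Offers F n) (w : Choice n) :
    ∫⁻ m, cost k h O w m ∂(signalLaw O w) = ENNReal.ofReal k + price O w := by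
  simp [cost]

theorem reward_add_cont_total_le_one (σ : Profile F n) (h : History F n) (O : Offers F n)
    (w : Choice n) (m : Quality) :
    reward σ h O w m + σ.agent.cont h O w m * expectTotal σ (reward σ) (append h (O, w, m)) ≤ 1 :=
  (reward_add_contFlow_le (V := expectTotal σ (reward σ)) h O w m).trans
    (max_le (ofReal_quality_le_one m) (expectTotal_reward_le_one σ _))

theorem expectTotalAtOffers_reward_le_one (σ : Profile F n) (h : History F n) (O : Offers F n) :
    expectTotalAtOffers σ (reward σ) h O ≤ 1 :=
  (expectStage_mono fun w m => reward_add_cont_total_le_one σ h O w m).trans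
    (expectStage_const 1).le

theorem expectTotalAtOffers_eq {g : PeriodFlow F n} (hg : MeasurableFlow g) (h : History F n)
    (O : Offers F n) : expectTotalAtOffers σ g h O =
      expectStage σ h O (g h O) + expectStage σ h O (contFlow σ (expectTotal σ g) h O) :=
  expectStage_add fun w => hg.apply h O w

/-- The one-shot deviation principle for the agent: `V` is the value at the beginning of a
period and `X` the value of choosing among offers, gross of the search cost. -/
theorem agent_verification {k : ℝ} (hk : 0 < k) {V : History F n → ℝ≥0∞} (hV : Measurable V)
    (hV1 : ∀ h, V h ≤ 1) {X : History F n → Offers F n → ℝ≥0∞}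
    (hXge : ∀ h O w, ∫⁻ m, max (ENNReal.ofReal (m : ℝ)) (V (append h (O, w, m)))
      ∂(signalLaw O w) ≤ X h O + price O w)
    (hXle : ∀ h O w, σ.agent.buy h O w ≠ 0 → X h O + price O w ≤
      ∫⁻ m, max (ENNReal.ofReal (m : ℝ)) (V (append h (O, w, m))) ∂(signalLaw O w))
    (hcont : ∀ h O w m, σ.agent.cont h O w m =
      if ENNReal.ofReal (m : ℝ) < V (append h (O, w, m)) then 1 else 0)
    (hXV : ∀ h, ∀ᵐ O ∂(offerLaw σ h), X h O = V h + ENNReal.ofReal k)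
    (hkX : ∀ h O, ENNReal.ofReal k ≤ X h O) :
    (∀ (h : History F n) (A : AgentStrategy F n),
      agentPayoff k (σ.withAgent A) h ≤ agentPayoff k σ h) ∧
    (∀ (h : History F n) (O : Offers F n) (A : AgentStrategy F n),
      agentPayoffAtOffers k (σ.withAgent A) h O ≤ agentPayoffAtOffers k σ h O) ∧
    (∀ (h : History F n) (O : Offers F n) (w : Choice n) (m : Quality) (A : AgentStrategy F n),
      agentPayoffAtSignal k (σ.withAgent A) h O w m ≤ agentPayoffAtSignal k σ h O w m) ∧
    ∀ h, agentPayoff k σ h = V h := by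
  -- The truncated subtraction is a true one because `k ≤ X`.
  have hY : ∀ h O, X h O - ENNReal.ofReal k + ENNReal.ofReal k = X h O := fun h O =>
    tsub_add_cancel_of_le (hkX h O)
  have hYV : ∀ h, ∀ᵐ O ∂(offerLaw σ h), X h O - ENNReal.ofReal k = V h := fun h => by
    filter_upwards [hXV h] with O hO
    rw [hO, ENNReal.add_sub_cancel_right ENNReal.ofReal_ne_top]
  -- upper bounds, for an arbitrary strategy of the agent
  have hstage : ∀ A h O, expectStage (σ.withAgent A) h O
      (fun w m => reward (σ.withAgent A) h O w m + contFlow (σ.withAgent A) V h O w m) ≤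
      X h O - ENNReal.ofReal k + expectStage (σ.withAgent A) h O (cost k h O) := by
    intro A h O
    refine expectStage_le_add fun w _ => ?_
    rw [lintegral_cost, ← add_assoc, hY]
    exact (lintegral_mono fun m => reward_add_contFlow_le h O w m).trans (hXge h O w)
  have htot : ∀ A h, expectTotal (σ.withAgent A) (reward (σ.withAgent A)) h ≤
      V h + expectTotal (σ.withAgent A) (cost k) h := by
    intro A
    refine expectTotal_le_of_stage measurableFlow_reward (measurableFlow_cost k) hV fun h => ?_
    filter_upwards [hYV h] with O hO
    rw [← hO]
    exact hstage A h O
  have hpay : ∀ A h, agentPayoff k (σ.withAgent A) h ≤ V h := fun A h =>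
    coe_sub_coe_le (ne_top_of_le_ne_top ENNReal.one_ne_top (expectTotal_reward_le_one _ h))
      (htot A h)
  have hpayO : ∀ A h O, agentPayoffAtOffers k (σ.withAgent A) h O ≤
      (X h O - ENNReal.ofReal k : ℝ≥0∞) := by
    intro A h O
    refine coe_sub_coe_le (ne_top_of_le_ne_top ENNReal.one_ne_top
      (expectTotalAtOffers_reward_le_one _ h O)) ?_
    rw [expectTotalAtOffers_eq (measurableFlow_cost k), ← add_assoc]
    refine le_trans ?_ (add_le_add_left (hstage A h O) _)
    rw [← expectStage_add fun w =>
      (measurableFlow_reward.add (measurableFlow_contFlow hV)).apply h O w]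
    refine expectStage_mono fun w m => ?_
    rw [add_assoc]
    refine add_le_add_right ?_ _
    rw [contFlow, contFlow, ← mul_add]
    gcongr
    exact htot A _
  have hpayS : ∀ A h O w m, agentPayoffAtSignal k (σ.withAgent A) h O w m ≤
      (max (ENNReal.ofReal (m : ℝ)) (V (append h (O, w, m))) : ℝ≥0∞) := by
    intro A h O w m
    refine coe_sub_coe_le (ne_top_of_le_ne_top ENNReal.one_ne_top
      (reward_add_cont_total_le_one _ h O w m)) ?_
    refine le_trans ?_ (add_le_add_left (reward_add_contFlow_le (σ := σ.withAgent A) h O w m) _)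
    rw [add_assoc, contFlow, ← mul_add]
    gcongr
    exact htot A _
  -- the payoffs under the candidate profile
  have hmax : ∀ h O w m, reward σ h O w m + contFlow σ V h O w m =
      max (ENNReal.ofReal (m : ℝ)) (V (append h (O, w, m))) := by
    intro h O w m
    rw [reward, contFlow, hcont]
    split_ifs with hlt
    · simp [max_eq_right hlt.le]
    · simp [max_eq_left (not_lt.1 hlt)]
  have hstageEq : ∀ h O, expectStage σ h O
      (fun w m => reward σ h O w m + contFlow σ V h O w m) =
      X h O - ENNReal.ofReal k + expectStage σ h O (cost k h O) := by
    intro h O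
    refine le_antisymm (hstage σ.agent h O) (add_le_expectStage fun w hw => ?_)
    rw [lintegral_cost, ← add_assoc, hY]
    simp only [hmax]
    exact hXle h O w hw
  have htotEq : ∀ h, expectTotal σ (reward σ) h = V h + expectTotal σ (cost k) h ∧
      expectTotal σ (cost k) h ≠ ⊤ := by
    refine expectTotal_reward_eq hk hV hV1 fun h => ?_
    rw [expectFlow_add_expectNext measurableFlow_reward, add_expectFlow]
    refine lintegral_congr_ae ?_
    filter_upwards [hYV h] with O hO
    rw [hstageEq, hO]
  have hpayEq : ∀ h, agentPayoff k σ h = V h := fun h =>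
    coe_sub_coe_eq (htotEq h).2 (htotEq h).1
  have hpayOEq : ∀ h O, agentPayoffAtOffers k σ h O = (X h O - ENNReal.ofReal k : ℝ≥0∞) := by
    intro h O
    have heq : expectTotalAtOffers σ (reward σ) h O =
        X h O - ENNReal.ofReal k + expectTotalAtOffers σ (cost k) h O := by
      rw [expectTotalAtOffers_eq (measurableFlow_cost k), ← add_assoc, ← hstageEq,
        ← expectStage_add fun w =>
          (measurableFlow_reward.add (measurableFlow_contFlow hV)).apply h O w]
      refine congrArg (expectStage σ h O) (funext fun w => funext fun m => ?_)
      rw [add_assoc, contFlow, contFlow, ← mul_add, ← (htotEq _).1]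
    refine coe_sub_coe_eq (ne_top_of_le_ne_top ENNReal.one_ne_top ?_) heq
    exact (le_add_self.trans heq.symm.le).trans (expectTotalAtOffers_reward_le_one σ h O)
  have hpaySEq : ∀ h O w m, agentPayoffAtSignal k σ h O w m =
      (max (ENNReal.ofReal (m : ℝ)) (V (append h (O, w, m))) : ℝ≥0∞) := by
    intro h O w m
    refine coe_sub_coe_eq (ENNReal.mul_ne_top ?_ (htotEq _).2) ?_
    · exact ne_top_of_le_ne_top ENNReal.one_ne_top (σ.agent.cont_le_one h O w m)
    · rw [← hmax, add_assoc, contFlow, ← mul_add, ← (htotEq _).1]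
  exact ⟨fun h A => (hpay A h).trans (hpayEq h).ge,
    fun h O A => (hpayO A h O).trans (hpayOEq h O).ge,
    fun h O w m A => (hpayS A h O w m).trans (hpaySEq h O w m).ge, hpayEq⟩

end Verification

/-! ### Automaton strategies and their equilibrium conditions -/

/-- A pure-offer automaton. All brokers make the same offer in each state. An agent who buys a
deviating offer moves the play to `pun`; otherwise it moves to `next` if no broker deviated and
to `rew` if some broker did. -/
structure Automaton (F : Measure Quality) (n : ℕ) (S : Type) where
  init : S
  pun : S
  rew : S
  next : S → S
  offer : S → Offer F
  val : S → ℝ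
  pick : S → Choice n → ℝ≥0∞
  sum_pick : ∀ s, ∑ w, pick s w = 1

namespace Automaton

variable {F : Measure Quality} {n : ℕ} {S : Type} (M : Automaton F n S)

/-- The offers that the brokers are supposed to make. -/
def offers (s : S) : Offers F n := fun _ => M.offer s

open Classical in
/-- The transition function. -/
def step (s : S) (O : Offers F n) (w : Choice n) : S :=
  if ∃ i, w = some i ∧ O i ≠ M.offer s then M.pun
  else if O = M.offers s then M.next s else M.rew

/-- The state after a finite sequence of stages. -/
def stateAfter : (t : ℕ) → (Fin t → Stage F n) → S
  | 0, _ => M.init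
  | t + 1, z => M.step (stateAfter t (Fin.init z)) (z (Fin.last t)).1 (z (Fin.last t)).2.1

/-- The state at a history. -/
def state (h : History F n) : S := M.stateAfter h.1 h.2

theorem state_initial : M.state (initial F n) = M.init := rfl

theorem state_append (h : History F n) (z : Stage F n) :
    M.state (append h z) = M.step (M.state h) z.1 z.2.1 := by
  simp [state, append, stateAfter]

theorem step_offers (s : S) (w : Choice n) : M.step s (M.offers s) w = M.next s := by
  simp [step, offers]

theorem step_of_buy_deviation {s : S} {O : Offers F n} {i : Fin n} (hi : O i ≠ M.offer s) :
    M.step s O (some i) = M.pun := by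
  simp [step, hi]

theorem step_eq_or (s : S) (O : Offers F n) (w : Choice n) :
    M.step s O w = M.pun ∨ M.step s O w = M.next s ∨ M.step s O w = M.rew := by
  unfold step
  split_ifs <;> simp

/-- The agent's gross value of the choice `w`. -/
def gross (s : S) (O : Offers F n) (w : Choice n) : ℝ≥0∞ :=
  ∫⁻ m, max (ENNReal.ofReal (m : ℝ)) (ENNReal.ofReal (M.val (M.step s O w))) ∂(signalLaw O w)

/-- The agent's value of the best choice, gross of the search cost. -/
def best (s : S) (O : Offers F n) : ℝ≥0∞ := ⨆ w, M.gross s O w - price O w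

/-- The choice `w` is optimal. -/
def Optimal (s : S) (O : Offers F n) (w : Choice n) : Prop :=
  M.best s O + price O w ≤ M.gross s O w

theorem gross_le (s : S) (O : Offers F n) (w : Choice n) :
    M.gross s O w ≤ M.best s O + price O w :=
  tsub_le_iff_right.1 (le_iSup (fun w => M.gross s O w - price O w) w)

theorem le_best {s : S} {O : Offers F n} {w : Choice n} {x : ℝ≥0∞}
    (hx : x + price O w ≤ M.gross s O w) : x ≤ M.best s O :=
  (ENNReal.le_sub_of_add_le_right (price_ne_top O w) hx).trans
    (le_iSup (fun w => M.gross s O w - price O w) w)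

theorem ofReal_priorMean_le_best [IsProbabilityMeasure F] (s : S) (O : Offers F n) :
    ENNReal.ofReal (priorMean F) ≤ M.best s O := by
  refine M.le_best (w := none) ?_
  simp only [price, add_zero, gross, signalLaw]
  rw [lintegral_dirac' _ (by fun_prop), coe_priorMeanPoint]
  exact le_max_left _ _

/-- The maximum over finitely many choices is attained. It is positive because the null offer is
worth at least the prior mean, so the truncated subtraction at the maximizer is genuine. -/
theorem exists_optimal [IsProbabilityMeasure F] (hF : 0 < priorMean F) (s : S)
    (O : Offers F n) : ∃ w, M.Optimal s O w := by
  obtain ⟨w, hw⟩ := exists_eq_ciSup_of_finite (f := fun w => M.gross s O w - price O w)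
  refine ⟨w, ?_⟩
  have hb : 0 < M.gross s O w - price O w := by
    rw [hw]
    exact (ENNReal.ofReal_pos.2 hF).trans_le (M.ofReal_priorMean_le_best s O)
  unfold Optimal best
  rw [← hw, tsub_add_cancel_of_le (tsub_pos_iff_lt.1 hb).le]

section Strategies

variable [Finite S] [MeasurableSpace S] [DiscreteMeasurableSpace S]

instance : DiscreteMeasurableSpace (Choice n) := ⟨fun _ => trivial⟩

theorem measurable_of_offers {Y : Type*} [MeasurableSpace Y] {f : S → Offers F n → Y}
    (hf : ∀ s, Measurable (f s)) : Measurable fun x : S × Offers F n => f x.1 x.2 :=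
  measurable_from_prod_countable_right hf

omit [Finite S] [DiscreteMeasurableSpace S] in
theorem measurable_step (s : S) (w : Choice n) : Measurable fun O => M.step s O w := by
  unfold step
  refine Measurable.ite ?_ measurable_const (Measurable.ite ?_ measurable_const measurable_const)
  · refine MeasurableSet.congr (s := ⋃ i, {O : Offers F n | w = some i ∧ O i ≠ M.offer s})
      (MeasurableSet.iUnion fun i => ?_) (by ext; simp)
    have hi : MeasurableSet {O : Offers F n | O i = M.offer s} :=
      (measurable_pi_apply i : Measurable fun O : Offers F n => O i)
        (measurableSet_singleton (M.offer s))
    exact (MeasurableSet.const (w = some i)).inter hi.compl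
  · exact measurableSet_singleton _

theorem measurable_state : Measurable M.state := by
  have hstep : Measurable fun x : S × Offers F n × Choice n => M.step x.1 x.2.1 x.2.2 :=
    measurable_from_prod_countable_right fun s =>
      measurable_from_prod_countable_left fun w => M.measurable_step s w
  have key : ∀ t, Measurable (M.stateAfter t) := by
    intro t
    induction t with
    | zero => exact measurable_const
    | succ t ih =>
      have h1 : Measurable fun z : Fin (t + 1) → Stage F n => M.stateAfter t (Fin.init z) :=
        ih.comp (measurable_pi_lambda _ fun j => measurable_pi_apply _)
      have h2 : Measurable fun z : Fin (t + 1) → Stage F n => z (Fin.last t) :=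
        measurable_pi_apply _
      exact hstep.comp (h1.prodMk ((measurable_fst.comp h2).prodMk
        ((measurable_fst.comp measurable_snd).comp h2)))
  intro s hs
  exact MeasurableSpace.measurableSet_iInf.2 fun t => key t hs

omit [Finite S] in
theorem measurable_gross (s : S) (w : Choice n) : Measurable fun O => M.gross s O w := by
  refine measurable_lintegral_signalLaw measurable_id w
    (f := fun O m => max (ENNReal.ofReal (m : ℝ)) (ENNReal.ofReal (M.val (M.step s O w)))) ?_
  have : Measurable fun O => ENNReal.ofReal (M.val (M.step s O w)) :=
    (Measurable.of_discrete (f := fun s => ENNReal.ofReal (M.val s))).comp (M.measurable_step s w)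
  exact (ENNReal.measurable_ofReal.comp (measurable_subtype_coe.comp measurable_snd)).max
    (this.comp measurable_fst)

omit [Finite S] in
theorem measurable_best (s : S) : Measurable (M.best s) :=
  Measurable.iSup fun w => (M.measurable_gross s w).sub (measurable_price w)

omit [Finite S] in
theorem measurableSet_optimal (s : S) (w : Choice n) : MeasurableSet {O | M.Optimal s O w} :=
  measurableSet_le ((M.measurable_best s).add (measurable_price w)) (M.measurable_gross s w)

open Classical in
/-- Indicator of the optimal choices. -/
def optInd (s : S) (O : Offers F n) (w : Choice n) : ℝ≥0∞ := if M.Optimal s O w then 1 else 0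

open Classical in
/-- The purchase probabilities: `pick` on path, uniform over the optimal choices off path. -/
def buyProb (s : S) (O : Offers F n) (w : Choice n) : ℝ≥0∞ :=
  if O = M.offers s then M.pick s w else M.optInd s O w / ∑ w', M.optInd s O w'

omit [Finite S] in
theorem measurable_buyProb (s : S) (w : Choice n) : Measurable fun O => M.buyProb s O w := by
  have hopt : ∀ w, Measurable fun O => M.optInd s O w := fun w =>
    Measurable.ite (M.measurableSet_optimal s w) measurable_const measurable_const
  refine Measurable.ite (measurableSet_singleton _) measurable_const ?_
  exact (hopt w).div (Finset.measurable_sum _ fun w _ => hopt w)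

omit [Finite S] [MeasurableSpace S] [DiscreteMeasurableSpace S] in
theorem sum_buyProb [IsProbabilityMeasure F] (hF : 0 < priorMean F) (s : S) (O : Offers F n) :
    ∑ w, M.buyProb s O w = 1 := by
  by_cases hO : O = M.offers s
  · simp [buyProb, hO, M.sum_pick]
  · simp only [buyProb, hO, if_false, div_eq_mul_inv, ← Finset.sum_mul]
    refine ENNReal.mul_inv_cancel ?_ ?_
    · obtain ⟨w, hw⟩ := M.exists_optimal hF s O
      intro h0
      have := (Finset.sum_eq_zero_iff.1 h0) w (Finset.mem_univ w)
      simp [optInd, hw] at this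
    · refine ENNReal.sum_ne_top.2 fun w _ => ?_
      unfold optInd
      split_ifs <;> simp

/-- The agent's strategy. -/
def agentStrategy [IsProbabilityMeasure F] (hF : 0 < priorMean F) : AgentStrategy F n where
  buy h O w := M.buyProb (M.state h) O w
  cont h O w m := {q : ℝ≥0∞ × ℝ≥0∞ | q.1 < q.2}.indicator 1
    (ENNReal.ofReal (m : ℝ), ENNReal.ofReal (M.val (M.step (M.state h) O w)))
  sum_buy h O := M.sum_buyProb hF _ O
  cont_le_one h O w m := Set.indicator_le' (fun _ _ => le_rfl) (fun _ _ => zero_le_one) _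
  measurable_buy w := (measurable_of_offers fun s => M.measurable_buyProb s w).comp
    (f := fun x : History F n × Offers F n => (M.state x.1, x.2))
    ((M.measurable_state.comp measurable_fst).prodMk measurable_snd)
  measurable_cont w := by
    have h1 : Measurable fun x : S × Offers F n => ENNReal.ofReal (M.val (M.step x.1 x.2 w)) :=
      measurable_of_offers fun s => (Measurable.of_discrete
        (f := fun s => ENNReal.ofReal (M.val s))).comp (M.measurable_step s w)
    have h2 : Measurable fun x : History F n × Offers F n × Quality =>
        ENNReal.ofReal (M.val (M.step (M.state x.1) x.2.1 w)) :=
      h1.comp (f := fun x : History F n × Offers F n × Quality => (M.state x.1, x.2.1))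
        ((M.measurable_state.comp measurable_fst).prodMk (measurable_fst.comp measurable_snd))
    exact (measurable_one.indicator (measurableSet_lt measurable_fst measurable_snd)).comp
      ((ENNReal.measurable_ofReal.comp (measurable_subtype_coe.comp
        (measurable_snd.comp measurable_snd))).prodMk h2)

/-- The strategy profile. -/
def profile [IsProbabilityMeasure F] (hF : 0 < priorMean F) : Profile F n where
  broker _ := ⟨Kernel.deterministic (fun h => M.offer (M.state h))
    ((Measurable.of_discrete (f := M.offer)).comp M.measurable_state),
    Kernel.isMarkovKernel_deterministic _⟩
  agent := M.agentStrategy hF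

end Strategies

end Automaton

section OfferLaw

variable {F : Measure Quality} {n : ℕ} {σ : Profile F n}

theorem ae_offerLaw_of_dirac {h : History F n} {i : Fin n} {x : Offer F}
    (hx : (σ.broker i).1 h = Measure.dirac x) : ∀ᵐ O ∂(offerLaw σ h), O i = x := by
  refine (Measure.tendsto_eval_ae_ae (μ := fun i => (σ.broker i).1 h) (i := i)).eventually
    (p := fun y => y = x) ?_
  rw [hx, ae_dirac_eq]
  rfl

end OfferLaw

namespace Automaton

variable {F : Measure Quality} {n : ℕ} {S : Type} (M : Automaton F n S)
  [Finite S] [MeasurableSpace S] [DiscreteMeasurableSpace S] [IsProbabilityMeasure F]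
  {hF : 0 < priorMean F}

theorem broker_profile (i : Fin n) (h : History F n) :
    ((M.profile hF).broker i).1 h = Measure.dirac (M.offer (M.state h)) :=
  Kernel.deterministic_apply ((Measurable.of_discrete (f := M.offer)).comp M.measurable_state) h

theorem ae_offerLaw_profile (h : History F n) :
    ∀ᵐ O ∂(offerLaw (M.profile hF) h), O = M.offers (M.state h) := by
  filter_upwards [ae_all_iff.2 fun i => ae_offerLaw_of_dirac (M.broker_profile (hF := hF) i h)]
    with O hO
  exact funext hO

theorem ae_offerLaw_withBroker (i : Fin n) (τ : BrokerStrategy F n) (h : History F n) :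
    ∀ᵐ O ∂(offerLaw ((M.profile hF).withBroker i τ) h), ∀ j, j ≠ i → O j = M.offer (M.state h) := by
  refine ae_all_iff.2 fun j => ?_
  by_cases hj : j = i
  · simp [hj]
  · filter_upwards [ae_offerLaw_of_dirac (σ := (M.profile hF).withBroker i τ) (h := h) (i := j)
      (x := M.offer (M.state h))
      (by simpa [Profile.withBroker, hj] using M.broker_profile (hF := hF) j h)] with O hO _
    exact hO

/-- The Bellman equations of the agent on the path of the automaton. -/
structure Consistent (k : ℝ) : Prop where
  val_mem : ∀ s, M.val s ∈ Set.Icc (0 : ℝ) 1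
  pick_none : ∀ s, M.pick s none = 0
  bellman : ∀ s, M.val s + k + (M.offer s).1 =
    M.val (M.next s) + excess (M.offer s).2.1 (M.val (M.next s))
  priorMean_le : ∀ s, priorMean F ≤ M.val s + k
  next_le : ∀ s, M.val (M.next s) ≤ M.val s + k

variable {M} {k : ℝ}

omit [Finite S] [MeasurableSpace S] [DiscreteMeasurableSpace S] [IsProbabilityMeasure F] in
theorem Consistent.gross_some (hM : M.Consistent k) (hk : 0 < k) (s : S) (i : Fin n) :
    M.gross s (M.offers s) (some i) =
      ENNReal.ofReal (M.val s + k) + price (M.offers s) (some i) := by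
  have : IsProbabilityMeasure (M.offer s).2.1 := (M.offer s).2.2.1
  simp only [gross, step_offers, signalLaw, price, offers]
  rw [lintegral_max_ofReal (hM.val_mem _).1, ← hM.bellman, ENNReal.ofReal_add
    (by linarith [(hM.val_mem s).1]) (NNReal.coe_nonneg _), ENNReal.ofReal_coe_nnreal]

omit [Finite S] [MeasurableSpace S] [DiscreteMeasurableSpace S] in
theorem Consistent.best_offers (hM : M.Consistent k) (hk : 0 < k) (s : S) :
    M.best s (M.offers s) = ENNReal.ofReal (M.val s + k) := by
  refine le_antisymm (iSup_le fun w => ?_) ?_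
  · refine tsub_le_iff_right.2 ?_
    cases w with
    | none =>
      simp only [gross, step_offers, signalLaw, price, add_zero]
      rw [lintegral_dirac' _ (by fun_prop), coe_priorMeanPoint]
      exact max_le (ENNReal.ofReal_le_ofReal (hM.priorMean_le s))
        (ENNReal.ofReal_le_ofReal (hM.next_le s))
    | some i => exact (hM.gross_some hk s i).le
  · obtain ⟨w, hw⟩ : ∃ w, M.pick s w ≠ 0 := by
      by_contra! h
      simpa [h] using M.sum_pick s
    cases w with
    | none => exact absurd (hM.pick_none s) hw
    | some i => exact M.le_best (hM.gross_some hk s i).ge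

omit [Finite S] [MeasurableSpace S] [DiscreteMeasurableSpace S] in
theorem Consistent.optimal_of_buyProb (hM : M.Consistent k) (hk : 0 < k) {s : S}
    {O : Offers F n} {w : Choice n} (hw : M.buyProb s O w ≠ 0) : M.Optimal s O w := by
  by_cases hO : O = M.offers s
  · subst hO
    cases w with
    | none => simp [buyProb, hM.pick_none] at hw
    | some i =>
      unfold Optimal
      rw [hM.best_offers hk, hM.gross_some hk]
  · by_contra hopt
    simp [buyProb, hO, optInd, hopt] at hw

theorem Consistent.agent_rational (hM : M.Consistent k) (hk : 0 < k) (hkm : k < priorMean F) :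
    (∀ (h : History F n) (A : AgentStrategy F n),
      agentPayoff k ((M.profile hF).withAgent A) h ≤ agentPayoff k (M.profile hF) h) ∧
    (∀ (h : History F n) (O : Offers F n) (A : AgentStrategy F n),
      agentPayoffAtOffers k ((M.profile hF).withAgent A) h O ≤
        agentPayoffAtOffers k (M.profile hF) h O) ∧
    (∀ (h : History F n) (O : Offers F n) (w : Choice n) (m : Quality) (A : AgentStrategy F n),
      agentPayoffAtSignal k ((M.profile hF).withAgent A) h O w m ≤
        agentPayoffAtSignal k (M.profile hF) h O w m) ∧
    ∀ h, agentPayoff k (M.profile hF) h = ENNReal.ofReal (M.val (M.state h)) := by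
  refine agent_verification hk (V := fun h => ENNReal.ofReal (M.val (M.state h)))
    (X := fun h O => M.best (M.state h) O) ?_ ?_ ?_ ?_ ?_ ?_ ?_
  · exact (Measurable.of_discrete (f := fun s => ENNReal.ofReal (M.val s))).comp
      M.measurable_state
  · intro h
    simpa using ENNReal.ofReal_le_ofReal (hM.val_mem (M.state h)).2
  · intro h O w
    simp only [state_append]
    exact M.gross_le _ O w
  · intro h O w hw
    simp only [state_append]
    exact hM.optimal_of_buyProb hk hw
  · intro h O w m
    simp only [state_append, profile, agentStrategy, Set.indicator_apply, Set.mem_ofPred_eq,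
      Pi.one_apply]
  · intro h
    filter_upwards [M.ae_offerLaw_profile h] with O hO
    rw [hO, hM.best_offers hk, ENNReal.ofReal_add (hM.val_mem _).1 hk.le]
  · intro h O
    exact (ENNReal.ofReal_le_ofReal hkm.le).trans (M.ofReal_priorMean_le_best _ O)

end Automaton

section Payment

variable {F : Measure Quality} {n : ℕ} {σ : Profile F n}

theorem expectStage_payment (i : Fin n) (h : History F n) (O : Offers F n) :
    expectStage σ h O (payment i h O) = σ.agent.buy h O (some i) * price O (some i) := by
  unfold expectStage
  rw [Finset.sum_eq_single (some i)]
  · simp [payment]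
  · intro w _ hw
    simp [payment, hw]
  · simp

theorem expectFlow_payment (i : Fin n) {h : History F n} {O : Offers F n}
    (hO : ∀ᵐ O' ∂(offerLaw σ h), O' = O) :
    expectFlow σ (payment i) h = σ.agent.buy h O (some i) * price O (some i) := by
  unfold expectFlow
  rw [lintegral_congr_ae (g := fun _ => σ.agent.buy h O (some i) * price O (some i))]
  · simp
  · filter_upwards [hO] with O' hO'
    rw [hO', expectStage_payment]

/-- An upper bound for a broker's payoff. -/
theorem brokerPayoff_le_of_stage {i : Fin n} {V : History F n → ℝ≥0∞} (hV : Measurable V)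
    (H : ∀ h, ∀ᵐ O ∂(offerLaw σ h),
      expectStage σ h O (fun w m => payment i h O w m + contFlow σ V h O w m) ≤ V h)
    (h : History F n) : brokerPayoff σ i h ≤ V h := by
  have := expectTotal_le_of_stage (measurableFlow_payment i) (measurableFlow_const 0) hV
    (fun h => by simpa [expectStage_const] using H h) h
  rwa [expectTotal_zero, add_zero] at this

end Payment

namespace Automaton

variable {F : Measure Quality} {n : ℕ} {S : Type} (M : Automaton F n S)

/-- Deviating brokers are deterred: nothing is paid after the current period, and the agent has a
choice that is at least as good as any deviating offer at price zero. -/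
structure Deterrent : Prop where
  price_next : ∀ s, (M.offer (M.next s)).1 = 0
  price_pun : (M.offer M.pun).1 = 0
  price_rew : (M.offer M.rew).1 = 0
  deter : ∀ s i (O : Offers F n), (∀ j, j ≠ i → O j = M.offer s) → O i ≠ M.offer s →
    ∃ w, ENNReal.ofReal (M.val M.pun + excess F (M.val M.pun)) + price O w ≤ M.gross s O w

variable {M} {k : ℝ} [IsProbabilityMeasure F]

/-- A deviating offer that is bought leads to `pun`, so its gross value is at most what full
information is worth there. Some choice already nets that amount, so an optimal purchase of a
deviating offer must have price zero. -/
theorem Deterrent.buyProb_mul_price (hD : M.Deterrent) (hM : M.Consistent k) (hk : 0 < k)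
    {s : S} {i : Fin n} {O : Offers F n} (hO : ∀ j, j ≠ i → O j = M.offer s) :
    M.buyProb s O (some i) * price O (some i) ≤ M.pick s (some i) * (M.offer s).1 := by
  by_cases hi : O i = M.offer s
  · have hO' : O = M.offers s := by
      funext j
      by_cases hj : j = i
      · rw [hj]; exact hi
      · exact hO j hj
    simp [hO', buyProb, price, offers]
  · suffices h : M.buyProb s O (some i) = 0 ∨ price O (some i) = 0 by
      rcases h with h | h <;> simp [h]
    by_contra! hne
    have hopt := hM.optimal_of_buyProb hk hne.1
    obtain ⟨w, hw⟩ := hD.deter s i O hO hi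
    have h1 := M.le_best hw
    have h2 : M.gross s O (some i) ≤
        ENNReal.ofReal (M.val M.pun + excess F (M.val M.pun)) := by
      have : IsProbabilityMeasure (O i).2.1 := (O i).2.2.1
      simp only [gross, M.step_of_buy_deviation hi, signalLaw]
      rw [lintegral_max_ofReal (hM.val_mem _).1]
      exact ENNReal.ofReal_le_ofReal (add_le_add_right (excess_signal_le _ _) _)
    have h3 : M.best s O + price O (some i) ≤ M.best s O + 0 := by
      rw [add_zero]; exact hopt.trans (h2.trans h1)
    have h4 : M.best s O ≠ ⊤ := by
      refine ne_top_of_le_ne_top (b := M.gross s O (some i)) ?_ (le_self_add.trans hopt)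
      exact ne_top_of_le_ne_top ENNReal.ofReal_ne_top h2
    exact hne.2 (nonpos_iff_eq_zero.1 ((ENNReal.add_le_add_iff_left h4).1 h3))

variable [Finite S] [MeasurableSpace S] [DiscreteMeasurableSpace S]

/-- The payment prescribed in the current state is a supersolution for a deviating broker: every
transition leads to a state with price zero, so its continuation term vanishes, and a deviation
raises no current revenue. -/
theorem Deterrent.brokerPayoff_withBroker_le (hD : M.Deterrent) (hM : M.Consistent k)
    (hk : 0 < k) (hF : 0 < priorMean F) (i : Fin n) (τ : BrokerStrategy F n) (h : History F n) :
    brokerPayoff ((M.profile hF).withBroker i τ) i h ≤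
      M.pick (M.state h) (some i) * (M.offer (M.state h)).1 := by
  refine brokerPayoff_le_of_stage
    (V := fun h => M.pick (M.state h) (some i) * ((M.offer (M.state h)).1 : ℝ≥0∞)) ?_ ?_ h
  · exact (Measurable.of_discrete (f := fun s => M.pick s (some i) *
      ((M.offer s).1 : ℝ≥0∞))).comp M.measurable_state
  · intro h
    filter_upwards [M.ae_offerLaw_withBroker i τ h] with O hO
    have hzero : ∀ w m, contFlow ((M.profile hF).withBroker i τ)
        (fun h => M.pick (M.state h) (some i) * ((M.offer (M.state h)).1 : ℝ≥0∞)) h O w m = 0 := by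
      intro w m
      have : (M.offer (M.step (M.state h) O w)).1 = 0 := by
        rcases M.step_eq_or (M.state h) O w with h1 | h1 | h1 <;> rw [h1]
        · exact hD.price_pun
        · exact hD.price_next _
        · exact hD.price_rew
      simp [contFlow, state_append, this]
    simp only [hzero, add_zero]
    refine (expectStage_payment i h O).le.trans ?_
    exact hD.buyProb_mul_price hM hk hO

theorem brokerPayoff_profile_ge (hF : 0 < priorMean F) (i : Fin n) (h : History F n) :
    M.pick (M.state h) (some i) * (M.offer (M.state h)).1 ≤ brokerPayoff (M.profile hF) i h := by
  refine le_trans ?_ (expectFlow_le_expectTotal (payment i) h)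
  rw [expectFlow_payment i (M.ae_offerLaw_profile h)]
  simp [profile, agentStrategy, buyProb, price, offers]

omit [IsProbabilityMeasure F] in
theorem withBroker_self (σ : Profile F n) (i : Fin n) : σ.withBroker i (σ.broker i) = σ := by
  simp [Profile.withBroker]

theorem Deterrent.mem_equilibriumPayoffs (hD : M.Deterrent) (hM : M.Consistent k)
    (hk : 0 < k) (hkm : k < priorMean F) {y : Fin (n + 1) → ℝ}
    (hy : ∀ i : Fin n, y i.castSucc = (M.pick M.init (some i)).toReal * (M.offer M.init).1)
    (hlast : y (Fin.last n) = M.val M.init) : y ∈ equilibriumPayoffs F n k := by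
  have hF := hk.trans hkm
  obtain ⟨h1, h2, h3, h4⟩ := hM.agent_rational (hF := hF) hk hkm
  refine ⟨M.profile hF, ⟨fun h i τ => ?_, h1, h2, h3⟩, fun i => ?_, ?_⟩
  · exact (hD.brokerPayoff_withBroker_le hM hk hF i τ h).trans (M.brokerPayoff_profile_ge hF i h)
  · have heq : brokerPayoff (M.profile hF) i (initial F n) =
        M.pick M.init (some i) * (M.offer M.init).1 := by
      refine le_antisymm ?_ (M.brokerPayoff_profile_ge hF i (initial F n))
      conv_lhs => rw [← withBroker_self (M.profile hF) i]
      exact hD.brokerPayoff_withBroker_le hM hk hF i _ (initial F n)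
    have hp : M.pick M.init (some i) ≠ ⊤ := by
      refine ne_top_of_le_ne_top ENNReal.one_ne_top ?_
      rw [← M.sum_pick M.init]
      exact Finset.single_le_sum (fun _ _ => zero_le) (Finset.mem_univ _)
    rw [heq, hy]
    lift M.pick M.init (some i) to ℝ≥0 using hp with p
    simp [EReal.coe_ennreal_mul]
    rfl
  · rw [h4, hlast, M.state_initial, EReal.coe_ennreal_ofReal,
      max_eq_left (hM.val_mem _).1]

end Automaton

namespace Automaton

variable {F : Measure Quality} {n : ℕ} {S : Type} {M : Automaton F n S}

theorem offers_ne {s : S} {O : Offers F n} {i : Fin n} (hi : O i ≠ M.offer s) :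
    O ≠ M.offers s := fun h => hi (by rw [h]; rfl)

theorem step_none_of_deviation {s : S} {O : Offers F n} (hO : O ≠ M.offers s) :
    M.step s O none = M.rew := by
  simp [step, hO]

theorem step_some_of_deviation {s : S} {O : Offers F n} (hO : O ≠ M.offers s) {j : Fin n}
    (hj : O j = M.offer s) : M.step s O (some j) = M.rew := by
  simp [step, hO, hj]

theorem ofReal_le_gross_none [IsProbabilityMeasure F] {s : S} {O : Offers F n}
    (hO : O ≠ M.offers s) :
    ENNReal.ofReal (M.val M.rew) ≤ M.gross s O none := by
  simp only [gross, step_none_of_deviation hO, signalLaw]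
  rw [lintegral_dirac' _ (by fun_prop)]
  exact le_max_right _ _

theorem gross_some_of_deviation {s : S} {O : Offers F n} (hO : O ≠ M.offers s)
    {j : Fin n} (hj : O j = M.offer s) (hv : 0 ≤ M.val M.rew) :
    M.gross s O (some j) =
      ENNReal.ofReal (M.val M.rew + excess (M.offer s).2.1 (M.val M.rew)) := by
  have : IsProbabilityMeasure (M.offer s).2.1 := (M.offer s).2.2.1
  simp only [gross, step_some_of_deviation hO hj, signalLaw, hj]
  rw [lintegral_max_ofReal hv]

/-- The choice of an offer of another broker deters the deviator. -/
theorem deter_of_other {x : ℝ} (hn : 1 < n) {s : S} {i : Fin n} {O : Offers F n}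
    (hO : ∀ j, j ≠ i → O j = M.offer s) (hi : O i ≠ M.offer s) (hv : 0 ≤ M.val M.rew)
    (hx0 : 0 ≤ x)
    (hx : x + (M.offer s).1 ≤ M.val M.rew + excess (M.offer s).2.1 (M.val M.rew)) :
    ∃ w, ENNReal.ofReal x + price O w ≤ M.gross s O w := by
  have : Nontrivial (Fin n) := Fin.nontrivial_iff_two_le.2 hn
  obtain ⟨j, hj⟩ := exists_ne i
  refine ⟨some j, ?_⟩
  rw [gross_some_of_deviation (offers_ne hi) (hO j hj) hv]
  simp only [price, hO j hj]
  rw [← ENNReal.ofReal_coe_nnreal, ← ENNReal.ofReal_add hx0 (NNReal.coe_nonneg _)]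
  exact ENNReal.ofReal_le_ofReal hx

end Automaton

/-! ### Equilibria by reward and punishment -/

section Constructions

variable {F : Measure Quality} [IsProbabilityMeasure F] {k : ℝ} {n : ℕ}

theorem exists_full_signal (F : Measure Quality) [IsProbabilityMeasure F] :
    ∃ G : Signal F, ∀ u, excess G.1 u = excess F u := by
  obtain ⟨G, hG⟩ := exists_signal_mix F (t := 1) (by simp)
  exact ⟨G, fun u => by rw [hG]; ring⟩

theorem exists_null_signal (F : Measure Quality) [IsProbabilityMeasure F] :
    ∃ G : Signal F, ∀ u, excess G.1 u = max (priorMean F - u) 0 := by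
  obtain ⟨G, hG⟩ := exists_signal_mix F (t := 0) (by simp)
  exact ⟨G, fun u => by rw [hG]; ring⟩

omit [IsProbabilityMeasure F] in
theorem mem_surplusSet_of_agent {x : ℝ}
    (h : (Fin.snoc (α := fun _ => ℝ) (fun _ => 0) x : Fin (n + 1) → ℝ) ∈
      equilibriumPayoffs F n k) :
    x ∈ surplusSet (equilibriumPayoffs F n k) :=
  ⟨_, h, by simp [Fin.sum_univ_castSucc]⟩

/-- The agent always buys from the first broker. -/
def pickFirst (hn : 0 < n) : Choice n → ℝ≥0∞ := fun w => if w = some ⟨0, hn⟩ then 1 else 0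

theorem sum_pickFirst (hn : 0 < n) : ∑ w, pickFirst hn w = 1 := by
  simp [pickFirst]

/-- Competition in which every broker gives full information away. -/
theorem mcCall_mem_surplusSet (hk : 0 < k) (hkm : k < priorMean F) (hn : 1 < n) :
    mcCallPayoff F k ∈ surplusSet (equilibriumPayoffs F n k) := by
  obtain ⟨G, hG⟩ := exists_full_signal F
  have hn0 : 0 < n := by omega
  have hu := mcCallPayoff_mem hk hkm
  have hex := excess_mcCallPayoff hk hkm
  have hlo := autarky_le_mcCall hk hkm
  let M : Automaton F n (Fin 1) :=
    { init := 0, pun := 0, rew := 0, next := fun _ => 0, offer := fun _ => (0, G)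
      val := fun _ => mcCallPayoff F k
      pick := fun _ => pickFirst hn0
      sum_pick := fun _ => sum_pickFirst hn0 }
  have hM : M.Consistent k :=
    { val_mem := fun _ => ⟨hu.1.le, hu.2.le⟩
      pick_none := fun _ => by simp [M, pickFirst]
      bellman := fun _ => by simp [M, hG, hex]
      priorMean_le := fun _ => by simp only [autarkyPayoff] at hlo; simp only [M]; linarith
      next_le := fun _ => by simp only [M]; linarith }
  have hD : M.Deterrent :=
    { price_next := fun _ => rfl
      price_pun := rfl
      price_rew := rfl
      -- Punishment and reward coincide here. A deviator has nothing better than full information,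
      -- which another broker still gives away.
      deter := fun s i O hO hi => by
        refine Automaton.deter_of_other hn hO hi hu.1.le
          (add_nonneg hu.1.le (excess_nonneg _ _)) ?_
        simp [M, hG] }
  refine mem_surplusSet_of_agent (hD.mem_equilibriumPayoffs hM hk hkm (fun i => ?_) ?_)
  · simp [M]
  · simp [M]

/-- An automaton with an initial state, a state in which the agent gets his autarky payoff, and a
state in which he gets the full-information payoff. -/
def rewardPunish (k : ℝ) (P : ℝ≥0) (G G' G'' : Signal F) (next : Fin 3) (v : ℝ)
    (q : Choice n → ℝ≥0∞) (hq : ∑ w, q w = 1) : Automaton F n (Fin 3) where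
  init := 0
  pun := 1
  rew := 2
  next := ![next, 1, 2]
  offer := ![(P, G), (0, G'), (0, G'')]
  val := ![v, autarkyPayoff F k, mcCallPayoff F k]
  pick := fun _ => q
  sum_pick := fun _ => hq

/-- States `1` and `2` are absorbing, with uninformative and efficient search respectively, so their
Bellman equations say that the excess at their own value is `k`. Only state `0` is constrained by
the remaining hypotheses. Its successor value `x` is kept general so that state `0` may loop or lead
to efficient search. -/
theorem rewardPunish_consistent (hk : 0 < k) (hkm : k < priorMean F) {P : ℝ≥0}
    {G G' G'' : Signal F} {c : Fin 3} {v : ℝ} {q : Choice n → ℝ≥0∞} {hq : ∑ w, q w = 1}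
    (hv : v ∈ Set.Icc (0 : ℝ) 1) (hq0 : q none = 0) {x : ℝ}
    (hx : x = ![v, autarkyPayoff F k, mcCallPayoff F k] c)
    (hb : v + k + P = x + excess G.1 x) (hvm : priorMean F ≤ v + k) (hxv : x ≤ v + k)
    (hG' : excess G'.1 (autarkyPayoff F k) = k)
    (hG'' : ∀ u, excess G''.1 u = excess F u) :
    (rewardPunish k P G G' G'' c v q hq).Consistent k := by
  have hu := mcCallPayoff_mem hk hkm
  have hex := excess_mcCallPayoff hk hkm
  have hlo := autarky_le_mcCall hk hkm
  have hm1 := priorMean_le_one (F := F)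
  have hauto : autarkyPayoff F k = priorMean F - k := rfl
  subst hx
  constructor
  · intro s
    fin_cases s
    · exact hv
    · exact ⟨by simp [rewardPunish]; linarith, by simp [rewardPunish]; linarith⟩
    · exact ⟨hu.1.le, hu.2.le⟩
  · intro s
    exact hq0
  · intro s
    fin_cases s
    · exact hb
    · simp [rewardPunish, hG']
    · simp [rewardPunish, hG'', hex]
  · intro s
    fin_cases s
    · exact hvm
    · simp [rewardPunish, hauto]
    · simp [rewardPunish]; linarith
  · intro s
    fin_cases s
    · exact hxv
    · simp [rewardPunish, hk.le]
    · simp [rewardPunish, hk.le]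

/-- When search costs are low, every surplus between the autarky payoff and the full-information
payoff is an equilibrium surplus. -/
theorem Icc_subset_surplusSet (hk : 0 < k) (hkm : k < priorMean F) (hn : 0 < n)
    (hD : autarkyInformed F k ≤ mcCallPayoff F k) {w : ℝ}
    (hw : w ∈ Set.Icc (autarkyPayoff F k) (mcCallPayoff F k)) :
    w ∈ surplusSet (equilibriumPayoffs F n k) := by
  have hu := mcCallPayoff_mem hk hkm
  have hex := excess_mcCallPayoff hk hkm
  have hauto : autarkyPayoff F k = priorMean F - k := rfl
  obtain ⟨hw1, hw2⟩ := hw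
  -- The cost `k` lies between the excess at `w` of no information (because `w ≥ m - k`) and of full
  -- information (because `w ≤ ū`). The weight `t` interpolates, and makes `w` a stationary value at
  -- price zero.
  obtain ⟨t, ht, htk⟩ : ∃ t ∈ Set.Icc (0 : ℝ) 1,
      t * excess F w + (1 - t) * max (priorMean F - w) 0 = k := by
    have h1 : k ≤ excess F w := hex.symm.le.trans (excess_antitone hw2)
    have h2 : max (priorMean F - w) 0 ≤ k := max_le (by linarith) hk.le
    rcases (h2.trans h1).lt_or_eq with h | h
    · have hpos : 0 < excess F w - max (priorMean F - w) 0 := by linarith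
      refine ⟨(k - max (priorMean F - w) 0) / (excess F w - max (priorMean F - w) 0),
        ⟨div_nonneg (by linarith) hpos.le, div_le_one_of_le₀ (by linarith) hpos.le⟩, ?_⟩
      field_simp
      ring
    · exact ⟨1, by simp, by linarith⟩
  obtain ⟨G, hG⟩ := exists_signal_mix F ht
  obtain ⟨G', hG'⟩ := exists_null_signal F
  obtain ⟨G'', hG''⟩ := exists_full_signal F
  have hM : (rewardPunish k 0 G G' G'' 0 w (pickFirst hn) (sum_pickFirst hn)).Consistent k := by
    refine rewardPunish_consistent (x := w) hk hkm ⟨by linarith, by linarith [hu.2]⟩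
      (by simp [pickFirst]) rfl ?_ (by linarith) (by linarith) ?_ hG''
    · rw [hG, htk]; simp
    · rw [hG', hauto, sub_sub_cancel, max_eq_left hk.le]
  have hDet : (rewardPunish k 0 G G' G'' 0 w (pickFirst hn) (sum_pickFirst hn)).Deterrent := by
    refine ⟨fun s => ?_, rfl, rfl, fun s i O _ hi => ⟨none, ?_⟩⟩
    · fin_cases s <;> rfl
    · simp only [price, add_zero]
      -- The null offer after a deviation leads to the full-information payoff, which is at least
      -- the punished agent's value of any deviating offer.
      exact (ENNReal.ofReal_le_ofReal hD).trans
        (Automaton.ofReal_le_gross_none (Automaton.offers_ne hi))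
  refine mem_surplusSet_of_agent (hDet.mem_equilibriumPayoffs hM hk hkm (fun i => ?_) ?_)
  · simp [rewardPunish]
  · simp [rewardPunish]

/-- With several brokers, payoff profiles with positive payoffs of the brokers, an inefficiently
low surplus and a high payoff of the agent are equilibrium payoffs. -/
theorem mem_equilibriumPayoffs_of_competition (hk : 0 < k) (hkm : k < priorMean F) (hn : 1 < n)
    {ε : ℝ} (hε : 0 < ε) (hεk : ε ≤ k ^ 2)
    (hD : autarkyInformed F k ≤ mcCallPayoff F k + ε) (hmu : priorMean F ≤ mcCallPayoff F k)
    {y : Fin (n + 1) → ℝ} (hy : ∀ i : Fin n, 0 < y i.castSucc)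
    (hlast : mcCallPayoff F k - k + ε < y (Fin.last n))
    (hsum : ∑ j, y j ≤ mcCallPayoff F k) : y ∈ equilibriumPayoffs F n k := by
  have hu := mcCallPayoff_mem hk hkm
  have hex := excess_mcCallPayoff hk hkm
  have hlo := autarky_le_mcCall hk hkm
  have hm1 := priorMean_le_one (F := F)
  have hauto : autarkyPayoff F k = priorMean F - k := rfl
  set u := mcCallPayoff F k with hudef
  set P : ℝ := ∑ i : Fin n, y i.castSucc with hP
  set v := y (Fin.last n) with hv
  have hPpos : 0 < P := by
    have : Nonempty (Fin n) := ⟨⟨0, by omega⟩⟩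
    exact Finset.sum_pos (fun i _ => hy i) Finset.univ_nonempty
  have hPv : P + v ≤ u := by rwa [Fin.sum_univ_castSucc] at hsum
  have hk1 : k < 1 := hkm.trans_le hm1
  -- The Bellman equation of the first period is `v + k + P = u + t k`. As `m ≤ u`, no information
  -- has zero excess at `u`, so the mixture has excess `t k` there.
  set t : ℝ := (P + v - (u - k)) / k with ht
  have htk : t * k = P + v - (u - k) := by rw [ht]; field_simp
  have ht01 : t ∈ Set.Icc (0 : ℝ) 1 :=
    ⟨div_nonneg (by linarith) hk.le, div_le_one_of_le₀ (by linarith) hk.le⟩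
  obtain ⟨G, hG⟩ := exists_signal_mix F ht01
  obtain ⟨G'', hG''⟩ := exists_full_signal F
  -- In the punishment state brokers detect the upper tail `θ ≥ u` with probability only `k`. This
  -- is worthless at the autarky continuation payoff, yet worth `k ^ 2` at the continuation payoff
  -- `u`.
  obtain ⟨G', a, x, ha0, hak, hxa, hx0, hxm, hcut, hG', -⟩ :=
    exists_signal_cutoff F hk hk1.le u
  rw [hex, ← sq] at hcut
  have hGu : excess G.1 u = t * k := by
    rw [hG, hex, max_eq_right (by linarith), mul_zero, add_zero]
  -- Both realizations are at least the autarky payoff. For the lower one this uses `x ≤ a ≤ k`: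
  -- removing so little mass lowers the mean by too little to make search attractive. So the excess
  -- equals that of the mean.
  have hG'lo : excess G'.1 (autarkyPayoff F k) = k := by
    have h1 : a * autarkyPayoff F k ≤ a * u := mul_le_mul_of_nonneg_left hlo ha0
    have h2 : 0 ≤ a * autarkyPayoff F k := mul_nonneg ha0 (by linarith)
    rw [hG', max_eq_left (by nlinarith), max_eq_left (by nlinarith)]
    rw [hauto]
    ring
  have hG'u : k ^ 2 ≤ excess G'.1 u := by
    rw [hG', hcut]
    exact (le_max_left _ _).trans (le_add_of_nonneg_right (le_max_right _ _))
  -- All brokers charge the same price `P`. Each gets her target payoff by selling with probability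
  -- proportional to it.
  let q : Choice n → ℝ≥0∞ := fun w => w.elim 0 fun i => ENNReal.ofReal (y i.castSucc / P)
  have hq : ∑ w, q w = 1 := by
    rw [Fintype.sum_option]
    simp only [q, Option.elim, zero_add]
    rw [← ENNReal.ofReal_sum_of_nonneg fun i _ => div_nonneg (hy i).le hPpos.le,
      ← Finset.sum_div, div_self hPpos.ne', ENNReal.ofReal_one]
  let P' : ℝ≥0 := ⟨P, hPpos.le⟩
  have hM : (rewardPunish k P' G G' G'' 2 v q hq).Consistent k := by
    refine rewardPunish_consistent (x := u) hk hkm ⟨by linarith, by linarith [hu.2]⟩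
      rfl rfl ?_ (by linarith) (by linarith) hG'lo hG''
    rw [hGu, htk]
    change v + k + P = _
    ring
  have hD0 : 0 ≤ autarkyInformed F k :=
    (hk.le.trans hkm.le).trans priorMean_le_autarkyInformed
  have hDet : (rewardPunish k P' G G' G'' 2 v q hq).Deterrent := by
    refine ⟨fun s => ?_, rfl, rfl, fun s i O hO hi => ?_⟩
    · fin_cases s <;> rfl
    -- After a deviation the agent can buy from another broker, with continuation payoff `u`. In the
    -- three states this nets `v + k`, at least `u + k ^ 2`, and `u + k`. Each is at least `u + ε`,
    -- hence at least the punished value of full information.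
    · refine Automaton.deter_of_other hn hO hi hu.1.le hD0 ?_
      change autarkyInformed F k + _ ≤ u + excess _ u
      fin_cases s
      · change autarkyInformed F k + P ≤ u + excess G.1 u
        rw [hGu, htk]
        linarith
      · change autarkyInformed F k + ((0 : ℝ≥0) : ℝ) ≤ u + excess G'.1 u
        rw [NNReal.coe_zero]
        linarith
      · change autarkyInformed F k + ((0 : ℝ≥0) : ℝ) ≤ u + excess G''.1 u
        rw [NNReal.coe_zero, hG'', hex]
        nlinarith
  refine hDet.mem_equilibriumPayoffs hM hk hkm (fun i => ?_) rfl
  change _ = (ENNReal.ofReal (y i.castSucc / P)).toReal * P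
  rw [ENNReal.toReal_ofReal (div_nonneg (hy i).le hPpos.le), div_mul_cancel₀ _ hPpos.ne']

end Constructions

theorem add_le_add_of_coe_sub_le {a b c d : ℝ≥0∞} (ha : a ≠ ⊤) (hb : b ≠ ⊤) (hc : c ≠ ⊤)
    (hd : d ≠ ⊤) (h : (a : EReal) - (b : EReal) ≤ (c : EReal) - (d : EReal)) :
    a + d ≤ c + b := by
  lift a to ℝ≥0 using ha
  lift b to ℝ≥0 using hb
  lift c to ℝ≥0 using hc
  lift d to ℝ≥0 using hd
  simp only [EReal.coe_nnreal_eq_coe_real] at h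
  rw [← EReal.coe_sub, ← EReal.coe_sub, EReal.coe_le_coe_iff] at h
  rw [← ENNReal.coe_add, ← ENNReal.coe_add, ENNReal.coe_le_coe, ← NNReal.coe_le_coe]
  push_cast
  linarith

/-! ### Deviations in a single period -/

section Locality

variable {F : Measure Quality} {n : ℕ}

/-- Continuation totals depend on the agent's strategy at later histories only. -/
theorem expectTotal_congr_of_length {σ σ' : Profile F n} (hb : σ.broker = σ'.broker) {L : ℕ}
    (hbuy : ∀ h : History F n, L ≤ h.1 → σ.agent.buy h = σ'.agent.buy h)
    (hcont : ∀ h : History F n, L ≤ h.1 → σ.agent.cont h = σ'.agent.cont h)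
    {g g' : PeriodFlow F n} (hg : ∀ h : History F n, L ≤ h.1 → g h = g' h) (h : History F n)
    (hL : L ≤ h.1) : expectTotal σ g h = expectTotal σ' g' h := by
  have hoffer : offerLaw σ = offerLaw σ' := by
    funext h; simp [offerLaw, hb]
  have key : ∀ s, ∀ h : History F n, L ≤ h.1 →
      (expectNext σ)^[s] (expectFlow σ g) h = (expectNext σ')^[s] (expectFlow σ' g') h := by
    intro s
    induction s with
    | zero =>
      intro h hL
      simp [expectFlow, expectStage, hoffer, hbuy h hL, hg h hL]
    | succ s ih =>
      intro h hL
      simp only [Function.iterate_succ_apply', expectNext, expectStage, hoffer, hbuy h hL,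
        hcont h hL]
      have : ∀ z : Stage F n, (expectNext σ)^[s] (expectFlow σ g) (append h z) =
          (expectNext σ')^[s] (expectFlow σ' g') (append h z) := fun z =>
        ih _ (hL.trans (Nat.le_succ _))
      simp only [this]
  exact tsum_congr fun s => key s h hL

namespace AgentStrategy

/-- The agent's strategy in which `w₀` is always bought. -/
def withBuy (A : AgentStrategy F n) (w₀ : Choice n) : AgentStrategy F n :=
  { A with
    buy := fun _ _ w => if w = w₀ then 1 else 0
    sum_buy := fun _ _ => by simp
    measurable_buy := fun _ => measurable_const }

/-- The agent's strategy in which the search always stops. -/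
def withStop (A : AgentStrategy F n) : AgentStrategy F n :=
  { A with
    cont := fun _ _ _ _ => 0
    cont_le_one := fun _ _ _ _ => zero_le_one
    measurable_cont := fun _ => measurable_const }

/-- The agent's strategy in which the search never stops. -/
def withSearch (A : AgentStrategy F n) : AgentStrategy F n :=
  { A with
    cont := fun _ _ _ _ => 1
    cont_le_one := fun _ _ _ _ => le_rfl
    measurable_cont := fun _ => measurable_const }

/-- The strategy `B` in period `t` and the strategy `A` in all other periods. -/
def override (A B : AgentStrategy F n) (t : ℕ) : AgentStrategy F n :=
  have ht : MeasurableSet {h : History F n | h.1 = t} :=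
    MeasurableSpace.measurableSet_iInf.2 fun s => by
      change MeasurableSet (Sigma.mk s ⁻¹' {h : History F n | h.1 = t})
      exact MeasurableSet.const (s = t)
  { buy := fun h O w => if h.1 = t then B.buy h O w else A.buy h O w
    cont := fun h O w m => if h.1 = t then B.cont h O w m else A.cont h O w m
    sum_buy := fun h O => by
      split_ifs
      · exact B.sum_buy h O
      · exact A.sum_buy h O
    cont_le_one := fun h O w m => by
      split_ifs
      · exact B.cont_le_one h O w m
      · exact A.cont_le_one h O w m
    measurable_buy := fun w =>
      Measurable.ite (measurable_fst ht) (B.measurable_buy w) (A.measurable_buy w)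
    measurable_cont := fun w =>
      Measurable.ite (measurable_fst ht) (B.measurable_cont w) (A.measurable_cont w) }

end AgentStrategy

variable {σ : Profile F n}

/-- The override acts only on histories of the length of `h`, and all later histories are longer.
Two flows are needed because `reward` itself depends on the agent's strategy. -/
theorem expectTotal_override_append {g g' : PeriodFlow F n} (B : AgentStrategy F n)
    (h : History F n) (z : Stage F n)
    (hg : ∀ h' : History F n, h.1 + 1 ≤ h'.1 → g' h' = g h') :
    expectTotal (σ.withAgent (σ.agent.override B h.1)) g' (append h z) =
      expectTotal σ g (append h z) := by
  refine expectTotal_congr_of_length (σ := σ.withAgent (σ.agent.override B h.1)) (σ' := σ)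
    (L := h.1 + 1) rfl (fun h' hL => ?_) (fun h' hL => ?_) hg
    (append h z) (le_refl (h.1 + 1))
  · simp [Profile.withAgent, AgentStrategy.override, show h'.1 ≠ h.1 by omega]
  · simp [Profile.withAgent, AgentStrategy.override, show h'.1 ≠ h.1 by omega]

theorem reward_override (B : AgentStrategy F n) (h h' : History F n) (hL : h.1 + 1 ≤ h'.1) :
    reward (σ.withAgent (σ.agent.override B h.1)) h' = reward σ h' := by
  funext O w m
  simp [reward, Profile.withAgent, AgentStrategy.override, show h'.1 ≠ h.1 by omega]

end Locality

/-! ### Bounds on payoffs in an arbitrary equilibrium -/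

section Equilibrium

variable {F : Measure Quality} [IsProbabilityMeasure F] {n : ℕ} {k : ℝ} {σ : Profile F n}

/-- An agent who searches without information and stops at once. -/
theorem agentPayoff_null_stop (hk : 0 < k) (hkm : k < priorMean F) (A : AgentStrategy F n)
    (h : History F n) :
    agentPayoff k (σ.withAgent (A.withBuy none).withStop) h = ENNReal.ofReal (autarkyPayoff F k) := by
  set σ' := σ.withAgent (A.withBuy none).withStop
  have hstage : ∀ h O f, expectStage σ' h O f = f none (priorMeanPoint F) := by
    intro h O f
    unfold expectStage
    rw [Finset.sum_eq_single none]
    · simp [σ', Profile.withAgent, AgentStrategy.withStop, AgentStrategy.withBuy, signalLaw]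
    · intro w _ hw
      simp [σ', Profile.withAgent, AgentStrategy.withStop, AgentStrategy.withBuy, hw]
    · simp
  have htot : ∀ g : PeriodFlow F n, MeasurableFlow g → ∀ x, (∀ O, g h O none (priorMeanPoint F) = x) →
      expectTotal σ' g h = x := by
    intro g hg x hx
    rw [expectTotal_eq hg]
    have hcont : σ'.agent.cont = fun _ _ _ _ => 0 := rfl
    simp [expectFlow, expectNext, hstage, hx, hcont]
  unfold agentPayoff
  rw [htot _ measurableFlow_reward (ENNReal.ofReal (priorMean F)) fun O => by
    simp [reward, σ', Profile.withAgent, AgentStrategy.withStop, coe_priorMeanPoint],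
    htot _ (measurableFlow_cost k) (ENNReal.ofReal k) fun O => by simp [cost, price]]
  refine coe_sub_coe_eq ENNReal.ofReal_ne_top ?_
  rw [← ENNReal.ofReal_add (by simp only [autarkyPayoff]; linarith) hk.le]
  simp [autarkyPayoff]

theorem IsEquilibrium.autarky_add_cost_le (hσ : IsEquilibrium k σ) (hk : 0 < k)
    (hkm : k < priorMean F) (h : History F n) :
    ENNReal.ofReal (autarkyPayoff F k) + expectTotal σ (cost k) h ≤
      expectTotal σ (reward σ) h := by
  refine add_le_of_coe_le_coe_sub
    (ne_top_of_le_ne_top ENNReal.one_ne_top (expectTotal_reward_le_one σ h)) ?_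
  rw [← agentPayoff_null_stop (σ := σ) hk hkm σ.agent h]
  exact hσ.agent_rational h _

theorem IsEquilibrium.cost_le_one (hσ : IsEquilibrium k σ) (hk : 0 < k)
    (hkm : k < priorMean F) (h : History F n) : expectTotal σ (cost k) h ≤ 1 :=
  (le_add_self.trans (hσ.autarky_add_cost_le hk hkm h)).trans (expectTotal_reward_le_one σ h)

theorem excess_signalLaw_le (O : Offers F n) (w : Choice n) (u : ℝ) :
    excess (signalLaw O w) u ≤ excess F u := by
  cases w with
  | none =>
    simp only [signalLaw, excess, integral_dirac, coe_priorMeanPoint]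
    exact max_le (sub_le_excess u) (excess_nonneg F u)
  | some i => exact excess_signal_le (O i).2 u

theorem lintegral_max_signalLaw_le (O : Offers F n) (w : Choice n) {u : ℝ} (hu : 0 ≤ u) :
    ∫⁻ m, max (ENNReal.ofReal (m : ℝ)) (ENNReal.ofReal u) ∂(signalLaw O w) ≤
      ENNReal.ofReal (u + excess F u) := by
  rw [lintegral_max_ofReal hu]
  exact ENNReal.ofReal_le_ofReal (add_le_add_right (excess_signalLaw_le O w u) u)

/-- The surplus is at most the full-information payoff. -/
theorem reward_add_payments_le (hk : 0 < k) (hkm : k < priorMean F) (σ : Profile F n)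
    (h : History F n) :
    expectTotal σ (reward σ) h + ∑ i, brokerPayoff σ i h ≤
      ENNReal.ofReal (mcCallPayoff F k) + expectTotal σ (cost k) h := by
  have hu := mcCallPayoff_mem hk hkm
  -- Payments cancel against expenses. What remains is search with free information, for which the
  -- constant `ū` is a supersolution because `ū + excess F ū = ū + k`.
  rw [expectTotal_cost, ← add_assoc]
  gcongr
  refine expectTotal_le_of_stage (V := fun _ => ENNReal.ofReal (mcCallPayoff F k))
    measurableFlow_reward (measurableFlow_const _) measurable_const
    (fun h => ae_of_all _ fun O => expectStage_le_add fun w _ => ?_) h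
  refine (lintegral_mono fun m => reward_add_contFlow_le h O w m).trans ?_
  refine (lintegral_max_signalLaw_le O w hu.1.le).trans ?_
  rw [excess_mcCallPayoff hk hkm, ENNReal.ofReal_add hu.1.le hk.le]
  simp

/-- The agent's equilibrium payoff from a history on. -/
def agentValue (k : ℝ) (σ : Profile F n) (h : History F n) : ℝ≥0∞ :=
  expectTotal σ (reward σ) h - expectTotal σ (cost k) h

omit [IsProbabilityMeasure F] in
theorem measurable_agentValue : Measurable (agentValue k σ) :=
  (measurable_expectTotal measurableFlow_reward).sub
    (measurable_expectTotal (measurableFlow_cost k))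

/-- The truncated subtraction in `agentValue` loses nothing in equilibrium, since the autarky
deviation makes the reward exceed the expenses. -/
theorem IsEquilibrium.agentValue_add_cost (hσ : IsEquilibrium k σ) (hk : 0 < k)
    (hkm : k < priorMean F) (h : History F n) :
    agentValue k σ h + expectTotal σ (cost k) h = expectTotal σ (reward σ) h :=
  tsub_add_cancel_of_le (le_add_self.trans (hσ.autarky_add_cost_le hk hkm h))

theorem IsEquilibrium.cost_ne_top (hσ : IsEquilibrium k σ) (hk : 0 < k)
    (hkm : k < priorMean F) (h : History F n) : expectTotal σ (cost k) h ≠ ⊤ :=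
  ne_top_of_le_ne_top ENNReal.one_ne_top (hσ.cost_le_one hk hkm h)

theorem IsEquilibrium.agentPayoff_eq (hσ : IsEquilibrium k σ) (hk : 0 < k)
    (hkm : k < priorMean F) (h : History F n) : agentPayoff k σ h = agentValue k σ h :=
  coe_sub_coe_eq (hσ.cost_ne_top hk hkm h) (hσ.agentValue_add_cost hk hkm h).symm

theorem IsEquilibrium.autarky_le_agentValue (hσ : IsEquilibrium k σ) (hk : 0 < k)
    (hkm : k < priorMean F) (h : History F n) :
    ENNReal.ofReal (autarkyPayoff F k) ≤ agentValue k σ h :=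
  ENNReal.le_sub_of_add_le_right (hσ.cost_ne_top hk hkm h) (hσ.autarky_add_cost_le hk hkm h)

theorem IsEquilibrium.agentValue_add_payments_le (hσ : IsEquilibrium k σ) (hk : 0 < k)
    (hkm : k < priorMean F) (h : History F n) :
    agentValue k σ h + ∑ i, brokerPayoff σ i h ≤ ENNReal.ofReal (mcCallPayoff F k) := by
  have := reward_add_payments_le hk hkm σ h
  rw [← hσ.agentValue_add_cost hk hkm, add_right_comm] at this
  exact (ENNReal.add_le_add_iff_right (hσ.cost_ne_top hk hkm h)).1 this

theorem IsEquilibrium.reward_add_contFlow (hσ : IsEquilibrium k σ) (hk : 0 < k)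
    (hkm : k < priorMean F) (h : History F n) (O : Offers F n) (w : Choice n) (m : Quality) :
    reward σ h O w m + contFlow σ (expectTotal σ (reward σ)) h O w m =
      reward σ h O w m + contFlow σ (agentValue k σ) h O w m +
        contFlow σ (expectTotal σ (cost k)) h O w m := by
  simp only [contFlow]
  rw [← hσ.agentValue_add_cost hk hkm, mul_add, add_assoc]

theorem IsEquilibrium.contFlow_cost_ne_top (hσ : IsEquilibrium k σ) (hk : 0 < k)
    (hkm : k < priorMean F) (h : History F n) (O : Offers F n) (w : Choice n) (m : Quality) :
    contFlow σ (expectTotal σ (cost k)) h O w m ≠ ⊤ :=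
  ne_top_of_le_ne_top (hσ.cost_ne_top hk hkm _) (contFlow_le h O w m)

/-- Stopping rationality is stated with rewards and expenses apart. The continuation expenses are
finite in equilibrium and cancel, leaving a statement about `agentValue`. -/
theorem IsEquilibrium.le_reward_add_contFlow (hσ : IsEquilibrium k σ) (hk : 0 < k)
    (hkm : k < priorMean F) (h : History F n) (O : Offers F n) (w : Choice n) (m : Quality)
    {x : ℝ≥0∞} {A : AgentStrategy F n}
    (hx : agentPayoffAtSignal k (σ.withAgent A) h O w m = x) :
    x ≤ reward σ h O w m + contFlow σ (agentValue k σ) h O w m := by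
  have h1 := hσ.stopping_rational h O w m A
  rw [hx] at h1
  have h2 := add_le_of_coe_le_coe_sub (ne_top_of_le_ne_top ENNReal.one_ne_top
    (reward_add_cont_total_le_one σ h O w m)) h1
  have h3 := hσ.reward_add_contFlow hk hkm h O w m
  unfold contFlow at h3
  rw [h3] at h2
  exact (ENNReal.add_le_add_iff_right (hσ.contFlow_cost_ne_top hk hkm h O w m)).1 h2

theorem IsEquilibrium.quality_le (hσ : IsEquilibrium k σ) (hk : 0 < k)
    (hkm : k < priorMean F) (h : History F n) (O : Offers F n) (w : Choice n) (m : Quality) :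
    ENNReal.ofReal (m : ℝ) ≤ reward σ h O w m + contFlow σ (agentValue k σ) h O w m := by
  refine hσ.le_reward_add_contFlow hk hkm h O w m (A := σ.agent.withStop) ?_
  simp [agentPayoffAtSignal, reward, Profile.withAgent, AgentStrategy.withStop]

/-- The deviation is to search on in this period and return to the equilibrium strategy afterwards,
which is why the search is forced in one period only. -/
theorem IsEquilibrium.agentValue_append_le (hσ : IsEquilibrium k σ) (hk : 0 < k)
    (hkm : k < priorMean F) (h : History F n) (O : Offers F n) (w : Choice n) (m : Quality) :
    agentValue k σ (append h (O, w, m)) ≤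
      reward σ h O w m + contFlow σ (agentValue k σ) h O w m := by
  refine hσ.le_reward_add_contFlow hk hkm h O w m
    (A := σ.agent.override σ.agent.withSearch h.1) ?_
  unfold agentPayoffAtSignal
  rw [expectTotal_override_append (g := reward σ) _ _ _ fun h' hL => reward_override _ _ _ hL,
    expectTotal_override_append (g := cost k) _ _ _ fun _ _ => rfl]
  simp only [Profile.withAgent, AgentStrategy.override, AgentStrategy.withSearch, reward,
    if_true, tsub_self, zero_mul, zero_add, one_mul]
  exact coe_sub_coe_eq (hσ.cost_ne_top hk hkm _) (hσ.agentValue_add_cost hk hkm _).symm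

/-- The agent searches on when the realization is below his continuation payoff. -/
theorem IsEquilibrium.cont_eq_one (hσ : IsEquilibrium k σ) (hk : 0 < k)
    (hkm : k < priorMean F) {h : History F n} {O : Offers F n} {w : Choice n} {m : Quality}
    (hm : ENNReal.ofReal (m : ℝ) < agentValue k σ (append h (O, w, m))) :
    σ.agent.cont h O w m = 1 := by
  have h1 := hσ.agentValue_append_le hk hkm h O w m
  have hc := σ.agent.cont_le_one h O w m
  by_contra hne
  have hlt : σ.agent.cont h O w m < 1 := lt_of_le_of_ne hc hne
  have hW : agentValue k σ (append h (O, w, m)) ≠ ⊤ :=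
    ne_top_of_le_ne_top ENNReal.one_ne_top
      (tsub_le_self.trans (expectTotal_reward_le_one σ _))
  refine absurd h1 (not_le.2 ?_)
  unfold reward contFlow
  set W := agentValue k σ (append h (O, w, m))
  set c := σ.agent.cont h O w m
  calc (1 - c) * ENNReal.ofReal (m : ℝ) + c * W < (1 - c) * W + c * W := by
        refine ENNReal.add_lt_add_right (ENNReal.mul_ne_top hlt.ne_top hW) ?_
        exact ENNReal.mul_lt_mul_right (tsub_pos_iff_lt.2 hlt).ne'
          (ENNReal.sub_ne_top ENNReal.one_ne_top) hm
    _ = W := by rw [← add_mul, tsub_add_cancel_of_le hc, one_mul]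

end Equilibrium

/-! ### Monopoly: full extraction when search costs are high -/

section Monopoly

variable {F : Measure Quality} [IsProbabilityMeasure F] {k : ℝ}

/-- A two-point signal with which a monopolist can extract the efficient surplus. -/
theorem exists_extraction_signal (hk : 0 < k) (hkm : k < priorMean F) :
    ∃ (G : Signal F) (a : ℝ), 0 < a ∧ a ≤ 1 ∧
      excess G.1 (autarkyPayoff F k) = k + a * (mcCallPayoff F k - autarkyPayoff F k) ∧
      (autarkyPayoff F k < mcCallPayoff F k →
        ENNReal.ofReal (1 - a) ≤ G.1 {m : Quality | (m : ℝ) < autarkyPayoff F k}) := by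
  obtain ⟨G, a, x, ha0, ha1, hxa, hx0, hxm, hcut, hG, hlow⟩ :=
    exists_signal_cutoff F zero_lt_one le_rfl (mcCallPayoff F k)
  have hu := mcCallPayoff_mem hk hkm
  have hlo := autarky_le_mcCall hk hkm
  have hauto : autarkyPayoff F k = priorMean F - k := rfl
  rw [excess_mcCallPayoff hk hkm, one_mul] at hcut
  have hau : 0 ≤ a * mcCallPayoff F k := mul_nonneg ha0 hu.1.le
  have hgap : 0 ≤ a * (mcCallPayoff F k - autarkyPayoff F k) :=
    mul_nonneg ha0 (by linarith)
  -- Positivity of `a` follows from `x = k + a ū ≥ k > 0` and `x ≤ a`. The lower realization has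
  -- total weight `m - x = lo - a ū`, so it lies below `lo` as soon as `lo < ū`.
  refine ⟨G, a, by linarith, ha1, ?_, fun hlt => hlow.trans (measure_mono fun m hm => ?_)⟩
  · rw [hG, max_eq_left (by linarith), max_eq_right (by rw [hauto] at hgap ⊢; linarith)]
    linarith
  · change (m : ℝ) = _ at hm
    change (m : ℝ) < _
    rw [hm]
    rcases ha1.lt_or_eq with h | h
    · rw [div_lt_iff₀ (by linarith)]
      have : 0 < a * (mcCallPayoff F k - autarkyPayoff F k) :=
        mul_pos (by linarith) (by linarith)
      rw [hauto] at this ⊢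
      linarith
    · rw [h, sub_self, div_zero, hauto]
      linarith

variable {σ : Profile F 1}

/-- Offers that are attractive even to an agent with the autarky continuation payoff are not
rejected. -/
theorem IsEquilibrium.buy_none_eq_zero (hσ : IsEquilibrium k σ) (hk : 0 < k)
    (hkm : k < priorMean F) {B : ℝ≥0∞} (hB : ∀ h, agentValue k σ h ≤ B)
    (hmB : ENNReal.ofReal (priorMean F) ≤ B) (h : History F 1) {O : Offers F 1}
    (hO : price O (some 0) + B < ∫⁻ m, max (ENNReal.ofReal (m : ℝ))
      (ENNReal.ofReal (autarkyPayoff F k)) ∂(signalLaw O (some 0))) :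
    σ.agent.buy h O none = 0 := by
  set R := expectTotal σ (reward σ)
  set C := expectTotal σ (cost k)
  set r : Choice 1 → ℝ≥0∞ := fun w =>
    ∫⁻ m, (reward σ h O w m + contFlow σ R h O w m) ∂(signalLaw O w) with hr
  set c : Choice 1 → ℝ≥0∞ := fun w =>
    ∫⁻ m, (cost k h O w m + contFlow σ C h O w m) ∂(signalLaw O w) with hc
  set e : Choice 1 → ℝ≥0∞ := fun w => ∫⁻ m, contFlow σ C h O w m ∂(signalLaw O w) with he
  have hceq : ∀ w, c w = ENNReal.ofReal k + price O w + e w := fun w => by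
    simp only [hc]
    rw [lintegral_add_left ((measurableFlow_cost k).apply h O w), lintegral_cost]
  have hr1 : ∀ w, r w ≤ 1 := fun w =>
    (lintegral_mono fun m => reward_add_cont_total_le_one σ h O w m).trans (by simp)
  have he1 : ∀ w, e w ≤ 1 := fun w =>
    (lintegral_mono fun m => (contFlow_le h O w m).trans (hσ.cost_le_one hk hkm _)).trans
      (by simp)
  have hsplit : ∀ w, r w = ∫⁻ m, (reward σ h O w m + contFlow σ (agentValue k σ) h O w m)
      ∂(signalLaw O w) + e w := fun w => by
    simp only [hr, he, R, C, hσ.reward_add_contFlow hk hkm h O w]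
    rw [lintegral_add_left ((measurableFlow_reward.add
      (measurableFlow_contFlow measurable_agentValue)).apply h O w)]
  -- Net of continuation expenses, rejecting yields the better of the prior mean and a continuation
  -- value, both at most `B`.
  have hnone : r none ≤ B + e none := by
    rw [hsplit]
    gcongr
    refine (lintegral_mono fun m => reward_add_contFlow_le h O none m).trans ?_
    simp only [signalLaw]
    refine (lintegral_mono fun m => max_le_max le_rfl (hB _)).trans ?_
    rw [lintegral_dirac, coe_priorMeanPoint]
    exact max_le hmB le_rfl
  -- Buying yields at least the better of the realization and the autarky payoff, whatever
  -- continuation follows.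
  have hsome : (∫⁻ m, max (ENNReal.ofReal (m : ℝ)) (ENNReal.ofReal (autarkyPayoff F k))
      ∂(signalLaw O (some 0))) + e (some 0) ≤ r (some 0) := by
    rw [hsplit]
    gcongr with m
    exact max_le (hσ.quality_le hk hkm h O _ m)
      ((hσ.autarky_le_agentValue hk hkm _).trans (hσ.agentValue_append_le hk hkm h O _ m))
  -- switching to the broker's offer for sure is not profitable
  have hRO : expectTotalAtOffers σ (reward σ) h O =
      σ.agent.buy h O none * r none + σ.agent.buy h O (some 0) * r (some 0) := by
    simp only [expectTotalAtOffers, expectStage, Fintype.sum_option, Fin.sum_univ_one]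
    rfl
  have hCO : expectTotalAtOffers σ (cost k) h O =
      σ.agent.buy h O none * c none + σ.agent.buy h O (some 0) * c (some 0) := by
    simp only [expectTotalAtOffers, expectStage, Fintype.sum_option, Fin.sum_univ_one]
    rfl
  have hdev : ∀ {g g' : PeriodFlow F 1}, (∀ h' : History F 1, h.1 + 1 ≤ h'.1 → g' h' = g h') →
      g' h = g h →
      expectTotalAtOffers
        (σ.withAgent (σ.agent.override (σ.agent.withBuy (some 0)) h.1)) g' h O =
      ∫⁻ m, (g h O (some 0) m + contFlow σ (expectTotal σ g) h O (some 0) m)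
        ∂(signalLaw O (some 0)) := by
    intro g g' hg hgh
    simp only [expectTotalAtOffers, expectStage, expectTotal_override_append _ _ _ hg, hgh]
    simp [Profile.withAgent, AgentStrategy.override, AgentStrategy.withBuy,
      contFlow]
  have hpr := hσ.purchase_rational h O (σ.agent.override (σ.agent.withBuy (some 0)) h.1)
  unfold agentPayoffAtOffers at hpr
  rw [hdev (g := reward σ) (fun h' hL => reward_override _ _ _ hL) (by
      funext O w m
      simp [reward, Profile.withAgent, AgentStrategy.override, AgentStrategy.withBuy]),
    hdev (g := cost k) (fun _ _ => rfl) rfl, hRO, hCO] at hpr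
  have hb := σ.agent.sum_buy h O
  rw [Fintype.sum_option, Fin.sum_univ_one] at hb
  set b₀ := σ.agent.buy h O none
  set b₁ := σ.agent.buy h O (some 0)
  have hb0 : b₀ ≠ ⊤ := ne_top_of_le_ne_top ENNReal.one_ne_top (hb ▸ le_self_add)
  have hb1 : b₁ ≠ ⊤ := ne_top_of_le_ne_top ENNReal.one_ne_top (hb ▸ le_add_self)
  have hrt : ∀ w, r w ≠ ⊤ := fun w => ne_top_of_le_ne_top ENNReal.one_ne_top (hr1 w)
  have het : ∀ w, e w ≠ ⊤ := fun w => ne_top_of_le_ne_top ENNReal.one_ne_top (he1 w)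
  have hct : ∀ w, c w ≠ ⊤ := fun w => by
    rw [hceq]
    exact ENNReal.add_ne_top.2 ⟨ENNReal.add_ne_top.2 ⟨ENNReal.ofReal_ne_top, price_ne_top O w⟩,
      het w⟩
  have hfin := add_le_add_of_coe_sub_le (hrt (some 0)) (hct (some 0))
    (ENNReal.add_ne_top.2 ⟨ENNReal.mul_ne_top hb0 (hrt _), ENNReal.mul_ne_top hb1 (hrt _)⟩)
    (ENNReal.add_ne_top.2 ⟨ENNReal.mul_ne_top hb0 (hct _), ENNReal.mul_ne_top hb1 (hct _)⟩) hpr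
  -- the offer is strictly better than the null offer
  have hstrict : r none + c (some 0) < r (some 0) + c none := by
    rw [hceq, hceq]
    simp only [price, add_zero] at hO ⊢
    calc r none + (ENNReal.ofReal k + ((O 0).1 : ℝ≥0∞) + e (some 0))
        ≤ B + e none + (ENNReal.ofReal k + ((O 0).1 : ℝ≥0∞) + e (some 0)) := by gcongr
      _ = ((O 0).1 : ℝ≥0∞) + B + (ENNReal.ofReal k + e none + e (some 0)) := by ring
      _ < (∫⁻ m, max (ENNReal.ofReal (m : ℝ)) (ENNReal.ofReal (autarkyPayoff F k))
          ∂(signalLaw O (some 0))) + (ENNReal.ofReal k + e none + e (some 0)) := by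
        refine ENNReal.add_lt_add_right ?_ hO
        exact ENNReal.add_ne_top.2 ⟨ENNReal.add_ne_top.2 ⟨ENNReal.ofReal_ne_top, het _⟩, het _⟩
      _ = (∫⁻ m, max (ENNReal.ofReal (m : ℝ)) (ENNReal.ofReal (autarkyPayoff F k))
          ∂(signalLaw O (some 0))) + e (some 0) + (ENNReal.ofReal k + e none) := by ring
      _ ≤ _ := by gcongr
  lift b₀ to ℝ≥0 using hb0 with x₀
  lift b₁ to ℝ≥0 using hb1 with x₁
  obtain ⟨r0, hr0⟩ : ∃ x : ℝ≥0, (x : ℝ≥0∞) = r none := ⟨_, ENNReal.coe_toNNReal (hrt none)⟩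
  obtain ⟨r1, hr1'⟩ : ∃ x : ℝ≥0, (x : ℝ≥0∞) = r (some 0) := ⟨_, ENNReal.coe_toNNReal (hrt (some 0))⟩
  obtain ⟨c0, hc0⟩ : ∃ x : ℝ≥0, (x : ℝ≥0∞) = c none := ⟨_, ENNReal.coe_toNNReal (hct none)⟩
  obtain ⟨c1, hc1⟩ : ∃ x : ℝ≥0, (x : ℝ≥0∞) = c (some 0) := ⟨_, ENNReal.coe_toNNReal (hct (some 0))⟩
  rw [← hr0, ← hr1', ← hc0, ← hc1] at hfin hstrict
  norm_cast at hfin hstrict hb ⊢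
  -- With `b₀ + b₁ = 1`, purchase rationality says that `b₀` times the net gain from buying is at
  -- most zero. That gain is positive.
  by_contra hne
  have hx0 : (0 : ℝ) < x₀ := by positivity
  rw [← NNReal.coe_le_coe] at hfin
  rw [← NNReal.coe_lt_coe] at hstrict
  rw [← NNReal.coe_inj] at hb
  push_cast at hfin hstrict hb
  have hx1 : (x₁ : ℝ) = 1 - x₀ := by linarith
  rw [hx1] at hfin
  nlinarith

/-- The strategy of a broker who always makes the same offer. -/
def constOffer {n : ℕ} (x : Offer F) : BrokerStrategy F n :=
  ⟨Kernel.const _ (Measure.dirac x), inferInstance⟩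

omit [IsProbabilityMeasure F] in
theorem ae_offerLaw_constOffer (x : Offer F) (h : History F 1) :
    ∀ᵐ O ∂(offerLaw (σ.withBroker 0 (constOffer x)) h), O = fun _ => x := by
  filter_upwards [ae_offerLaw_of_dirac (σ := σ.withBroker 0 (constOffer x)) (h := h) (i := 0)
    (x := x) (by
      change (Function.update σ.broker 0 (constOffer x) 0).1 h = _
      rw [Function.update_self]
      rfl)] with O hO
  funext i
  rw [Subsingleton.elim i 0, hO]

omit [IsProbabilityMeasure F] in
/-- A monopolist who always makes an offer that is bought for sure. -/
theorem le_brokerPayoff_constOffer {p : ℝ≥0} {G : Signal F} {q : ℝ≥0∞}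
    (hbuy : ∀ h, σ.agent.buy h (fun _ => (p, G)) (some 0) = 1)
    (hcont : ∀ h, q ≤ ∫⁻ m, σ.agent.cont h (fun _ => (p, G)) (some 0) m ∂G.1)
    (h : History F 1) :
    p * (1 - q)⁻¹ ≤ brokerPayoff (σ.withBroker 0 (constOffer (p, G))) 0 h := by
  set σ' := σ.withBroker 0 (constOffer (p, G))
  have hae : ∀ h, ∀ᵐ O ∂(offerLaw σ' h), O = fun _ => (p, G) := ae_offerLaw_constOffer (p, G)
  refine geometric_le_expectTotal (fun h => ?_) (fun h x => ?_) h
  · rw [expectFlow_payment 0 (hae h)]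
    change (p : ℝ≥0∞) ≤ σ.agent.buy h _ (some 0) * _
    rw [hbuy]
    simp [price]
  · have : ∀ᵐ O ∂(offerLaw σ' h), q * x ≤ expectStage σ' h O
        (fun w m => σ'.agent.cont h O w m * x) := by
      filter_upwards [hae h] with O hO
      rw [hO]
      refine le_trans ?_ (Finset.single_le_sum (fun _ _ => zero_le) (Finset.mem_univ (some 0)))
      change q * x ≤ σ.agent.buy h _ (some 0) * ∫⁻ m, σ.agent.cont h _ (some 0) m * x ∂G.1
      rw [hbuy, one_mul, lintegral_mul_const _ (measurableFlow_cont.apply h _ _)]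
      gcongr
      exact hcont h
    calc q * x = ∫⁻ _, q * x ∂(offerLaw σ' h) := by simp
      _ ≤ _ := lintegral_mono_ae this

omit [IsProbabilityMeasure F] in
theorem buy_some_eq_one {h : History F 1} {O : Offers F 1} (hb : σ.agent.buy h O none = 0) :
    σ.agent.buy h O (some 0) = 1 := by
  have := σ.agent.sum_buy h O
  rwa [Fintype.sum_option, Fin.sum_univ_one, hb, zero_add] at this

theorem IsEquilibrium.agentValue_add_brokerPayoff_le (hσ : IsEquilibrium k σ) (hk : 0 < k)
    (hkm : k < priorMean F) (h : History F 1) :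
    agentValue k σ h + brokerPayoff σ 0 h ≤ ENNReal.ofReal (mcCallPayoff F k) := by
  simpa using hσ.agentValue_add_payments_le hk hkm h

/-- When search costs are high, the agent cannot get more than the prior mean from a
monopolist. -/
theorem IsEquilibrium.agentValue_le_priorMean (hσ : IsEquilibrium k σ) (hk : 0 < k)
    (hkm : k < priorMean F) (hD : mcCallPayoff F k < autarkyInformed F k) (h : History F 1) :
    agentValue k σ h ≤ ENNReal.ofReal (priorMean F) := by
  set U := ⨆ h, agentValue k σ h with hU
  have hle : ∀ h, agentValue k σ h ≤ U := fun h => le_iSup (agentValue k σ) h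
  refine (hle h).trans ?_
  by_contra hlt
  rw [not_le] at hlt
  have hUu : U ≤ ENNReal.ofReal (mcCallPayoff F k) := iSup_le fun h =>
    le_self_add.trans (hσ.agentValue_add_brokerPayoff_le hk hkm h)
  have hUtop : U ≠ ⊤ := ne_top_of_le_ne_top ENNReal.ofReal_ne_top hUu
  have hu := mcCallPayoff_mem hk hkm
  obtain ⟨G, hG⟩ := exists_full_signal F
  have hUr : U.toReal ≤ mcCallPayoff F k := ENNReal.toReal_le_of_le_ofReal hu.1.le hUu
  -- The price is chosen so that `p + U` is the midpoint of `ū` and `D`. Being below `D`, it makes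
  -- the offer irresistible. Being above `ū`, it contradicts the surplus bound. It is non-negative
  -- because `U ≤ ū`.
  let p : ℝ≥0 := ⟨(autarkyInformed F k + mcCallPayoff F k) / 2 - U.toReal, by linarith⟩
  have hpU : (p : ℝ≥0∞) + U = ENNReal.ofReal ((autarkyInformed F k + mcCallPayoff F k) / 2) := by
    rw [← ENNReal.ofReal_toReal hUtop, ← ENNReal.ofReal_coe_nnreal,
      ← ENNReal.ofReal_add (NNReal.coe_nonneg p) ENNReal.toReal_nonneg]
    exact congrArg ENNReal.ofReal (sub_add_cancel _ _)
  have hbuy : ∀ h, σ.agent.buy h (fun _ => (p, G)) (some 0) = 1 := by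
    intro h
    refine buy_some_eq_one (hσ.buy_none_eq_zero hk hkm hle hlt.le h ?_)
    simp only [price, signalLaw]
    rw [lintegral_max_ofReal (by simp only [autarkyPayoff]; linarith), hG, hpU]
    exact (ENNReal.ofReal_lt_ofReal_iff (by change 0 < autarkyInformed F k; linarith [hu.1])).2
      (by change _ < autarkyInformed F k; linarith)
  -- A single sale suffices here, so the continuation probability is bounded below by `0` only.
  have hp : ∀ h, (p : ℝ≥0∞) ≤ brokerPayoff σ 0 h := fun h => by
    refine le_trans ?_ ((le_brokerPayoff_constOffer (q := 0) hbuy (fun _ => zero_le) h).trans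
      (hσ.broker_rational h 0 _))
    simp
  have hUp : U ≤ ENNReal.ofReal (mcCallPayoff F k) - p := iSup_le fun h =>
    ENNReal.le_sub_of_add_le_right ENNReal.coe_ne_top
      ((add_le_add_right (hp h) _).trans (hσ.agentValue_add_brokerPayoff_le hk hkm h))
  have hple : (p : ℝ≥0∞) ≤ ENNReal.ofReal (mcCallPayoff F k) :=
    (hp h).trans (le_add_self.trans (hσ.agentValue_add_brokerPayoff_le hk hkm h))
  have h1 : (p : ℝ≥0∞) + U ≤ ENNReal.ofReal (mcCallPayoff F k) := by
    rw [add_comm]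
    exact (add_le_add_left hUp _).trans (tsub_add_cancel_of_le hple).le
  rw [hpU, ENNReal.ofReal_le_ofReal_iff hu.1.le] at h1
  linarith

/-- When search costs are high, a monopolist extracts the efficient surplus. -/
theorem IsEquilibrium.le_brokerPayoff (hσ : IsEquilibrium k σ) (hk : 0 < k)
    (hkm : k < priorMean F) (hD : mcCallPayoff F k < autarkyInformed F k) (h : History F 1) :
    ENNReal.ofReal (mcCallPayoff F k - autarkyPayoff F k) ≤ brokerPayoff σ 0 h := by
  rcases (autarky_le_mcCall hk hkm).lt_or_eq with hlt | heq
  swap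
  · simp [heq]
  obtain ⟨G, a, ha0, ha1, hex, hlow⟩ := exists_extraction_signal hk hkm
  have hlo : 0 ≤ autarkyPayoff F k := by simp only [autarkyPayoff]; linarith
  have hauto : autarkyPayoff F k = priorMean F - k := rfl
  -- At autarky continuation the extraction signal is worth `m + a (ū - lo)`, and rejecting is worth
  -- at most `m`. So every price strictly below `a (ū - lo)` is accepted after every history. The
  -- supremum over such prices is taken at the end.
  have key : ∀ p : ℝ≥0, (p : ℝ≥0∞) <
      ENNReal.ofReal (a * (mcCallPayoff F k - autarkyPayoff F k)) →
      (p : ℝ≥0∞) ≤ ENNReal.ofReal a * brokerPayoff σ 0 h := by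
    intro p hp
    rw [← ENNReal.ofReal_coe_nnreal,
      ENNReal.ofReal_lt_ofReal_iff (mul_pos ha0 (by linarith))] at hp
    have hbuy : ∀ h, σ.agent.buy h (fun _ => (p, G)) (some 0) = 1 := by
      intro h
      refine buy_some_eq_one (hσ.buy_none_eq_zero hk hkm
        (hσ.agentValue_le_priorMean hk hkm hD) le_rfl h ?_)
      simp only [price, signalLaw]
      rw [lintegral_max_ofReal hlo, hex, ← ENNReal.ofReal_coe_nnreal,
        ← ENNReal.ofReal_add (NNReal.coe_nonneg p) (hk.trans hkm).le, ENNReal.ofReal_lt_ofReal_iff]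
      · linarith
      · linarith [NNReal.coe_nonneg p]
    -- Low realizations lie strictly below the autarky payoff, so in any equilibrium the agent
    -- searches on after them.
    have hcont : ∀ h, ENNReal.ofReal (1 - a) ≤
        ∫⁻ m, σ.agent.cont h (fun _ => (p, G)) (some 0) m ∂G.1 := by
      intro h
      refine (hlow hlt).trans ?_
      have hs : MeasurableSet {m : Quality | (m : ℝ) < autarkyPayoff F k} :=
        measurableSet_lt measurable_subtype_coe measurable_const
      rw [← lintegral_indicator_one hs]
      refine lintegral_mono fun m => ?_
      by_cases hm : (m : ℝ) < autarkyPayoff F k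
      · rw [hσ.cont_eq_one hk hkm]
        · exact Set.indicator_le' (fun _ _ => le_rfl) (fun _ _ => zero_le_one) m
        · refine lt_of_lt_of_le ?_ (hσ.autarky_le_agentValue hk hkm _)
          exact (ENNReal.ofReal_lt_ofReal_iff (by linarith [m.2.1])).2 hm
      · rw [Set.indicator_of_notMem (by simpa using hm)]
        exact zero_le
    have h1 := (le_brokerPayoff_constOffer hbuy hcont h).trans (hσ.broker_rational h 0 _)
    have h2 : 1 - ENNReal.ofReal (1 - a) = ENNReal.ofReal a := by
      rw [← ENNReal.ofReal_one, ← ENNReal.ofReal_sub _ (by linarith)]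
      simp
    rw [h2, ← div_eq_mul_inv] at h1
    rwa [ENNReal.div_le_iff' (by simpa using ha0) ENNReal.ofReal_ne_top] at h1
  have hle := ENNReal.le_of_forall_nnreal_lt key
  rw [ENNReal.ofReal_mul ha0.le] at hle
  exact (ENNReal.mul_le_mul_iff_right (by simpa using ha0) ENNReal.ofReal_ne_top).1 hle

/-- A monopolist who extracts the efficient surplus is an equilibrium outcome. -/
theorem monopoly_equilibriumPayoffs_nonempty (hk : 0 < k) (hkm : k < priorMean F) :
    (equilibriumPayoffs F 1 k).Nonempty := by
  obtain ⟨G, a, ha0, ha1, hex, hlow⟩ := exists_extraction_signal hk hkm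
  have hF := hk.trans hkm
  have hu := mcCallPayoff_mem hk hkm
  have hlohi := autarky_le_mcCall hk hkm
  have hauto : autarkyPayoff F k = priorMean F - k := rfl
  have hm1 := priorMean_le_one (F := F)
  set lo := autarkyPayoff F k
  set u := mcCallPayoff F k
  have hgap : 0 ≤ a * (u - lo) := mul_nonneg ha0.le (by linarith)
  let P : ℝ≥0 := ⟨a * (u - lo), hgap⟩
  let M : Automaton F 1 (Fin 1) :=
    { init := 0, pun := 0, rew := 0, next := fun _ => 0, offer := fun _ => (P, G)
      val := fun _ => lo
      pick := fun _ => pickFirst zero_lt_one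
      sum_pick := fun _ => sum_pickFirst zero_lt_one }
  have hM : M.Consistent k :=
    { val_mem := fun _ => ⟨by simp only [M]; linarith, by simp only [M]; linarith⟩
      pick_none := fun _ => by simp [M, pickFirst]
      bellman := fun _ => by
        change lo + k + a * (u - lo) = lo + excess G.1 lo
        rw [hex]; ring
      priorMean_le := fun _ => by simp only [M]; linarith
      next_le := fun _ => by simp only [M]; linarith }
  obtain ⟨h1, h2, h3, h4⟩ := hM.agent_rational (hF := hF) hk hkm
  set σ := M.profile hF with hσdef
  have hval : ∀ s, M.val s = lo := fun _ => rfl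
  -- The constant `ū - lo` is a supersolution for any strategy of the broker. The agent buys `w`
  -- only if its price plus `m` is at most the gross value, and continues exactly below `lo`. So `m`
  -- plus price plus continuation is at most `E max(m_t, ū) ≤ ū + k = m + (ū - lo)`.
  have hupper : ∀ τ h, brokerPayoff (σ.withBroker 0 τ) 0 h ≤ ENNReal.ofReal (u - lo) := by
    intro τ h
    refine brokerPayoff_le_of_stage (V := fun _ => ENNReal.ofReal (u - lo)) measurable_const
      (fun h => ae_of_all _ fun O => ?_) h
    refine le_trans (expectStage_le_add (g := fun _ _ => 0) (y := ENNReal.ofReal (u - lo))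
      fun w hw => ?_) (by rw [expectStage_const, add_zero])
    rw [lintegral_zero, add_zero]
    have hopt : M.Optimal (M.state h) O w := hM.optimal_of_buyProb hk hw
    have hmp := (add_le_add_left (M.ofReal_priorMean_le_best (M.state h) O) (price O w)).trans hopt
    have hpay : ∀ m, payment 0 h O w m ≤ price O w := fun m => by
      unfold payment
      split_ifs
      · exact le_rfl
      · exact zero_le
    have hcontm : Measurable fun m => contFlow (σ.withBroker 0 τ)
        (fun _ => ENNReal.ofReal (u - lo)) h O w m :=
      (measurableFlow_contFlow measurable_const).apply h O w
    refine (ENNReal.add_le_add_iff_left (a := ENNReal.ofReal (priorMean F))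
      ENNReal.ofReal_ne_top).1 ?_
    calc ENNReal.ofReal (priorMean F) + ∫⁻ m, (payment 0 h O w m + contFlow (σ.withBroker 0 τ)
          (fun _ => ENNReal.ofReal (u - lo)) h O w m) ∂(signalLaw O w)
        ≤ ENNReal.ofReal (priorMean F) + ∫⁻ m, (price O w + contFlow (σ.withBroker 0 τ)
          (fun _ => ENNReal.ofReal (u - lo)) h O w m) ∂(signalLaw O w) := by
          gcongr with m
          exact hpay m
      _ = ENNReal.ofReal (priorMean F) + price O w + ∫⁻ m, contFlow (σ.withBroker 0 τ)
          (fun _ => ENNReal.ofReal (u - lo)) h O w m ∂(signalLaw O w) := by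
          rw [lintegral_add_left measurable_const, ← add_assoc]
          simp
      _ ≤ M.gross (M.state h) O w + ∫⁻ m, contFlow (σ.withBroker 0 τ)
          (fun _ => ENNReal.ofReal (u - lo)) h O w m ∂(signalLaw O w) := by gcongr
      _ = ∫⁻ m, (max (ENNReal.ofReal (m : ℝ)) (ENNReal.ofReal lo) + contFlow (σ.withBroker 0 τ)
          (fun _ => ENNReal.ofReal (u - lo)) h O w m) ∂(signalLaw O w) := by
          rw [lintegral_add_right _ hcontm]
          rfl
      _ ≤ ∫⁻ m, max (ENNReal.ofReal (m : ℝ)) (ENNReal.ofReal u) ∂(signalLaw O w) := by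
          refine lintegral_mono fun m => ?_
          have hc : (σ.withBroker 0 τ).agent.cont h O w m =
              {q : ℝ≥0∞ × ℝ≥0∞ | q.1 < q.2}.indicator 1
                (ENNReal.ofReal (m : ℝ), ENNReal.ofReal lo) := rfl
          simp only [contFlow, hc]
          by_cases hlt : ENNReal.ofReal (m : ℝ) < ENNReal.ofReal lo
          · rw [Set.indicator_of_mem (show _ ∈ {q : ℝ≥0∞ × ℝ≥0∞ | q.1 < q.2} from hlt),
              max_eq_right hlt.le, Pi.one_apply, one_mul,
              ← ENNReal.ofReal_add (by linarith) (by linarith), add_sub_cancel]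
            exact le_max_right _ _
          · rw [Set.indicator_of_notMem (show _ ∉ {q : ℝ≥0∞ × ℝ≥0∞ | q.1 < q.2} from hlt),
              zero_mul, add_zero]
            exact max_le_max le_rfl (ENNReal.ofReal_le_ofReal hlohi)
      _ ≤ ENNReal.ofReal (u + excess F u) := lintegral_max_signalLaw_le O w hu.1.le
      _ = ENNReal.ofReal (priorMean F) + ENNReal.ofReal (u - lo) := by
          rw [excess_mcCallPayoff hk hkm, ← ENNReal.ofReal_add hF.le (by linarith), hauto]
          congr 1
          ring
  -- The price `a (ū - lo)` is collected each period and the search goes on with probability at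
  -- least `1 - a`, so the geometric series sums to at least `ū - lo`.
  have hself : ∀ h, ENNReal.ofReal (u - lo) ≤ brokerPayoff σ 0 h := by
    intro h
    rcases hlohi.lt_or_eq with hlt | heq
    swap
    · simp [heq]
    have hsame : brokerPayoff σ 0 h = brokerPayoff (σ.withBroker 0 (constOffer (P, G))) 0 h := by
      have : σ.withBroker 0 (constOffer (P, G)) = σ := by
        have hb : (constOffer (P, G) : BrokerStrategy F 1) = σ.broker 0 := by
          refine Subtype.ext (Kernel.ext fun h => ?_)
          rw [M.broker_profile]
          rfl
        rw [hb, Automaton.withBroker_self]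
      rw [this]
    rw [hsame]
    have h2 : 1 - ENNReal.ofReal (1 - a) = ENNReal.ofReal a := by
      rw [← ENNReal.ofReal_one, ← ENNReal.ofReal_sub _ (by linarith)]
      simp
    have h5 : (P : ℝ≥0∞) * (1 - ENNReal.ofReal (1 - a))⁻¹ = ENNReal.ofReal (u - lo) := by
      rw [h2, ← ENNReal.ofReal_coe_nnreal, ← ENNReal.ofReal_inv_of_pos ha0,
        ← ENNReal.ofReal_mul (NNReal.coe_nonneg P)]
      congr 1
      change a * (u - lo) * a⁻¹ = _
      field_simp
    rw [← h5]
    refine le_brokerPayoff_constOffer (fun h => ?_) (fun h => (hlow hlt).trans ?_) h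
    · have hoff : (fun _ => (P, G) : Offers F 1) = M.offers (M.state h) := rfl
      change M.buyProb _ _ _ = 1
      rw [hoff]
      simp [Automaton.buyProb, M, pickFirst]
    · have hs : MeasurableSet {m : Quality | (m : ℝ) < lo} :=
        measurableSet_lt measurable_subtype_coe measurable_const
      rw [← lintegral_indicator_one hs]
      refine lintegral_mono fun m => ?_
      have hc : σ.agent.cont h (fun _ => (P, G)) (some 0) m =
          {q : ℝ≥0∞ × ℝ≥0∞ | q.1 < q.2}.indicator 1
            (ENNReal.ofReal (m : ℝ), ENNReal.ofReal lo) := rfl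
      simp only [hc]
      by_cases hm : (m : ℝ) < lo
      · have hm' : ENNReal.ofReal (m : ℝ) < ENNReal.ofReal lo :=
          (ENNReal.ofReal_lt_ofReal_iff (by linarith [m.2.1])).2 hm
        rw [Set.indicator_of_mem (show _ ∈ {q : ℝ≥0∞ × ℝ≥0∞ | q.1 < q.2} from hm')]
        exact Set.indicator_le' (fun _ _ => le_rfl) (fun _ _ => zero_le_one) m
      · rw [Set.indicator_of_notMem (by simpa using hm)]
        exact zero_le
  have hself' : ∀ h, brokerPayoff σ 0 h = ENNReal.ofReal (u - lo) := fun h => by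
    refine le_antisymm ?_ (hself h)
    conv_lhs => rw [← Automaton.withBroker_self σ 0]
    exact hupper _ h
  refine ⟨Fin.snoc (α := fun _ => ℝ) (fun _ => u - lo) lo, σ, ⟨fun h i τ => ?_, h1, h2, h3⟩,
    fun i => ?_, ?_⟩
  · rw [Subsingleton.elim i 0]
    exact (hupper τ h).trans (hself h)
  · rw [Subsingleton.elim i 0, hself', EReal.coe_ennreal_ofReal, max_eq_left (by linarith),
      Fin.snoc_castSucc]
  · rw [h4, hval, EReal.coe_ennreal_ofReal, max_eq_left (by linarith), Fin.snoc_last]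

end Monopoly

/-! ### Payoff sets, uniqueness of the threshold, and the gain from competition -/

section Payoffs

variable {F : Measure Quality} [IsProbabilityMeasure F] {k : ℝ} {n : ℕ}

theorem eq_ofReal_of_coe_eq {y : ℝ} {a : ℝ≥0∞} (h : (y : EReal) = (a : EReal)) :
    0 ≤ y ∧ a = ENNReal.ofReal y := by
  have ha : a ≠ ⊤ := by
    rintro rfl
    simp at h
  lift a to ℝ≥0 using ha
  rw [EReal.coe_nnreal_eq_coe_real, EReal.coe_eq_coe_iff] at h
  rw [h]
  exact ⟨NNReal.coe_nonneg a, (ENNReal.ofReal_coe_nnreal).symm⟩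

theorem equilibriumPayoffs_bounds (hk : 0 < k) (hkm : k < priorMean F) {y : Fin (n + 1) → ℝ}
    (hy : y ∈ equilibriumPayoffs F n k) :
    (∀ i : Fin n, 0 ≤ y i.castSucc) ∧ autarkyPayoff F k ≤ y (Fin.last n) ∧
      ∑ j, y j ≤ mcCallPayoff F k := by
  obtain ⟨σ, hσ, hb, ha⟩ := hy
  have hb' := fun i => eq_ofReal_of_coe_eq (hb i)
  rw [hσ.agentPayoff_eq hk hkm] at ha
  obtain ⟨ha0, ha'⟩ := eq_ofReal_of_coe_eq ha
  refine ⟨fun i => (hb' i).1, ?_, ?_⟩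
  · have := hσ.autarky_le_agentValue hk hkm (initial F n)
    rwa [ha', ENNReal.ofReal_le_ofReal_iff ha0] at this
  · have := hσ.agentValue_add_payments_le hk hkm (initial F n)
    rw [ha', Finset.sum_congr rfl fun i _ => (hb' i).2,
      ← ENNReal.ofReal_sum_of_nonneg fun i _ => (hb' i).1,
      ← ENNReal.ofReal_add ha0 (Finset.sum_nonneg fun i _ => (hb' i).1),
      ENNReal.ofReal_le_ofReal_iff (mcCallPayoff_mem hk hkm).1.le] at this
    rw [Fin.sum_univ_castSucc]
    linarith

theorem surplusSet_subset_Icc (hk : 0 < k) (hkm : k < priorMean F) :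
    surplusSet (equilibriumPayoffs F n k) ⊆
      Set.Icc (autarkyPayoff F k) (mcCallPayoff F k) := by
  rintro _ ⟨y, hy, rfl⟩
  obtain ⟨h1, h2, h3⟩ := equilibriumPayoffs_bounds hk hkm hy
  refine ⟨?_, h3⟩
  simp only [Fin.sum_univ_castSucc]
  linarith [Finset.sum_nonneg fun i (_ : i ∈ Finset.univ) => h1 i]

/-- The broker gets at least `ū - lo`, the agent at least `lo`, and together they get at most `ū`,
so all three bounds bind. -/
theorem monopoly_payoffs (hk : 0 < k) (hkm : k < priorMean F)
    (hD : mcCallPayoff F k < autarkyInformed F k) {y : Fin 2 → ℝ}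
    (hy : y ∈ equilibriumPayoffs F 1 k) :
    y (Fin.last 1) = autarkyPayoff F k ∧ ∑ j, y j = mcCallPayoff F k := by
  obtain ⟨h1, h2, h3⟩ := equilibriumPayoffs_bounds hk hkm hy
  obtain ⟨σ, hσ, hb, -⟩ := hy
  obtain ⟨hb0, hb'⟩ := eq_ofReal_of_coe_eq (hb 0)
  have h4 := hσ.le_brokerPayoff hk hkm hD (initial F 1)
  rw [hb', ENNReal.ofReal_le_ofReal_iff hb0] at h4
  rw [Fin.sum_univ_castSucc, Fin.sum_univ_one] at h3 ⊢
  constructor <;> linarith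

theorem surplusSet_monopoly (hk : 0 < k) (hkm : k < priorMean F)
    (hD : mcCallPayoff F k < autarkyInformed F k) :
    surplusSet (equilibriumPayoffs F 1 k) = {mcCallPayoff F k} := by
  refine Set.eq_singleton_iff_nonempty_unique_mem.2
    ⟨(monopoly_equilibriumPayoffs_nonempty hk hkm).image _, ?_⟩
  rintro _ ⟨y, hy, rfl⟩
  exact (monopoly_payoffs hk hkm hD hy).2

theorem agentSet_monopoly (hk : 0 < k) (hkm : k < priorMean F)
    (hD : mcCallPayoff F k < autarkyInformed F k) :
    agentSet (equilibriumPayoffs F 1 k) = {autarkyPayoff F k} := by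
  refine Set.eq_singleton_iff_nonempty_unique_mem.2
    ⟨(monopoly_equilibriumPayoffs_nonempty hk hkm).image _, ?_⟩
  rintro _ ⟨y, hy, rfl⟩
  exact (monopoly_payoffs hk hkm hD hy).1

theorem isSurplusThreshold_of_crossing {ks : ℝ} (h0 : 0 < ks) (h1 : ks < priorMean F)
    (hlow : ∀ k, 0 < k → k ≤ ks → autarkyInformed F k ≤ mcCallPayoff F k)
    (hhigh : ∀ k, ks < k → k < priorMean F → mcCallPayoff F k < autarkyInformed F k) :
    IsSurplusThreshold F ks := by
  refine ⟨h0, h1, fun n hn => ⟨fun k hk hkk => ?_, fun k hkk hkm => ?_⟩⟩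
  · have hkm : k < priorMean F := by linarith
    exact Set.Subset.antisymm (surplusSet_subset_Icc hk hkm) fun w hw =>
      Icc_subset_surplusSet hk hkm hn (hlow k hk hkk) hw
  · have hk : 0 < k := by linarith
    have hmono := surplusSet_monopoly hk hkm (hhigh k hkk hkm)
    refine ⟨⟨fun x hx => (surplusSet_subset_Icc hk hkm hx).2, fun b hb => hb ?_⟩, ?_⟩
    · rcases hn.lt_or_eq with h | h
      · exact mcCall_mem_surplusSet hk hkm h
      · subst h
        rw [hmono]
        rfl
    · rw [hmono]
      exact isGLB_singleton

/-- At `ks` the full-information payoff equals `D`. The excess at `D - ε` is strictly larger than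
`ks`, so costs up to that level keep the payoff above `D - ε`. The minimum with a midpoint keeps the
bound below the prior mean. -/
theorem exists_mcCallPayoff_near {ks : ℝ} (h0 : 0 < ks) (h1 : ks < priorMean F)
    (hks : excess F (autarkyInformed F ks) = ks) {ε : ℝ} (hε : 0 < ε) :
    ∃ kss, ks < kss ∧ kss < priorMean F ∧
      ∀ k, ks < k → k ≤ kss → autarkyInformed F ks - ε ≤ mcCallPayoff F k := by
  have h2 := excess_lt_excess (G := F) (sub_lt_self (autarkyInformed F ks) hε)
    (by rw [hks]; exact h0)
  rw [hks] at h2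
  refine ⟨min (excess F (autarkyInformed F ks - ε)) ((ks + priorMean F) / 2),
    lt_min h2 (by linarith), (min_le_right _ _).trans_lt (by linarith), fun k hk hkk => ?_⟩
  obtain ⟨h3, h4⟩ := le_min_iff.1 hkk
  exact le_mcCallPayoff (by linarith) (by linarith) h3

/-- Between two thresholds a cost would make the one-broker surplus set both a nondegenerate
interval from `lo` to `ū` and a set with infimum `ū`. It remains to find such a cost with `lo < ū`.
-/
theorem IsSurplusThreshold.unique {ks ks' : ℝ} (h : IsSurplusThreshold F ks)
    (h' : IsSurplusThreshold F ks') (hks : excess F (autarkyInformed F ks) = ks)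
    (hlow : ∀ k, 0 < k → k ≤ ks → autarkyInformed F k ≤ mcCallPayoff F k) : ks' = ks := by
  obtain ⟨h0, h1, h2⟩ := h
  obtain ⟨h0', h1', h2'⟩ := h'
  have contra : ∀ k, autarkyPayoff F k < mcCallPayoff F k →
      surplusSet (equilibriumPayoffs F 1 k) =
        Set.Icc (autarkyPayoff F k) (mcCallPayoff F k) →
      ¬ IsGLB (surplusSet (equilibriumPayoffs F 1 k)) (mcCallPayoff F k) := by
    intro k hlt heq hglb
    rw [heq] at hglb
    exact absurd (hglb.1 (Set.left_mem_Icc.2 hlt.le)) (not_le.2 hlt)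
  rcases lt_trichotomy ks' ks with hlt | heq | hlt
  · refine absurd ((h2' 1 le_rfl).2 ks hlt h1).2 (contra ks ?_ ((h2 1 le_rfl).1 ks h0 le_rfl))
    have h3 := hlow ks h0 le_rfl
    have h4 := priorMean_le_autarkyInformed (F := F) (k := ks)
    simp only [autarkyPayoff]
    linarith
  · exact heq
  · have hD := priorMean_lt_autarkyInformed h0 hks
    -- The margin `D - m` is positive, so just above `ks` the full-information payoff is still at
    -- least `m`, and hence exceeds the autarky payoff.
    obtain ⟨kss, hk1, hk2, hk3⟩ := exists_mcCallPayoff_near h0 h1 hks (sub_pos.2 hD)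
    have hlt' : ks < min kss ks' := lt_min hk1 hlt
    refine absurd ((h2 1 le_rfl).2 (min kss ks') hlt' ((min_le_left _ _).trans_lt hk2)).2
      (contra _ ?_ ((h2' 1 le_rfl).1 _ (h0.trans hlt') (min_le_right _ _)))
    have h3 := hk3 _ hlt' (min_le_left _ _)
    have h4 : 0 < min kss ks' := h0.trans hlt'
    rw [autarkyPayoff]
    linarith

theorem exists_open_competition {ks : ℝ} (h0 : 0 < ks) (h1 : ks < priorMean F)
    (hks : excess F (autarkyInformed F ks) = ks)
    (hhigh : ∀ k, ks < k → k < priorMean F → mcCallPayoff F k < autarkyInformed F k) :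
    ∃ kss : ℝ, ks < kss ∧ kss < priorMean F ∧
      ∃ δ : ℝ, 0 < δ ∧
      ∀ k : ℝ, ks < k → k ≤ kss → ∀ n : ℕ, 1 < n →
        (equilibriumPayoffs F 1 k).Nonempty ∧
        BddBelow (surplusSet (equilibriumPayoffs F 1 k)) ∧
        BddAbove (agentSet (equilibriumPayoffs F 1 k)) ∧
        ∃ E : Set (Fin (n + 1) → ℝ), IsOpen E ∧ E.Nonempty ∧ E ⊆ equilibriumPayoffs F n k ∧
          BddAbove (surplusSet E) ∧ BddBelow (agentSet E) ∧
          sSup (surplusSet E) + δ < sInf (surplusSet (equilibriumPayoffs F 1 k)) ∧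
          sSup (agentSet (equilibriumPayoffs F 1 k)) + δ < sInf (agentSet E) := by
  have hD := priorMean_lt_autarkyInformed h0 hks
  set D := autarkyInformed F ks with hDdef
  set gap := D - priorMean F with hgap
  have hgap0 : 0 < gap := sub_pos.2 hD
  -- The bound `ks ^ 2` lets the punishment-state signal cover the shortfall of `ū` below `D`. The
  -- bound `ks / 4` leaves room between the agent's and the surplus constraints of `E`. The bound
  -- `gap / 2` keeps `ū` above the prior mean.
  set ε := min (ks ^ 2) (min (ks / 4) (gap / 2)) with hεdef
  have hε : 0 < ε := by positivity
  have hε1 : ε ≤ ks ^ 2 := min_le_left _ _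
  have hε2 : ε ≤ ks / 4 := (min_le_right _ _).trans (min_le_left _ _)
  have hε3 : ε ≤ gap / 2 := (min_le_right _ _).trans (min_le_right _ _)
  obtain ⟨kss, hk1, hk2, hnear⟩ := exists_mcCallPayoff_near h0 h1 hks hε
  refine ⟨kss, hk1, hk2, min (ks / 4) (gap / 4), by positivity, fun k hkk hkk' n hn => ?_⟩
  have hδ1 : min (ks / 4) (gap / 4) ≤ ks / 4 := min_le_left _ _
  have hδ2 : min (ks / 4) (gap / 4) ≤ gap / 4 := min_le_right _ _
  have hk : 0 < k := h0.trans hkk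
  have hkm : k < priorMean F := hkk'.trans_lt hk2
  have hkD := hhigh k hkk hkm
  have hu := hnear k hkk hkk'
  have hDk : autarkyInformed F k ≤ D := autarkyInformed_antitone hkk.le
  rw [surplusSet_monopoly hk hkm hkD, agentSet_monopoly hk hkm hkD, csInf_singleton,
    csSup_singleton]
  refine ⟨monopoly_equilibriumPayoffs_nonempty hk hkm, bddBelow_singleton, bddAbove_singleton, ?_⟩
  set u := mcCallPayoff F k with hudef
  -- The surplus falls short of the monopoly surplus `u` by at least `k / 2`. The agent gets more
  -- than `u - k + ε ≥ D - k`, which exceeds his monopoly payoff `m - k` by at least `gap`.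
  let E : Set (Fin (n + 1) → ℝ) := {y | (∀ i : Fin n, 0 < y i.castSucc) ∧
    u - k + ε < y (Fin.last n) ∧ ∑ j, y j < u - k / 2}
  have hEopen : IsOpen E := by
    refine IsOpen.inter ?_ (IsOpen.inter ?_ ?_)
    · have : {y : Fin (n + 1) → ℝ | ∀ i : Fin n, 0 < y i.castSucc} =
          ⋂ i : Fin n, {y | 0 < y i.castSucc} := by ext; simp
      change IsOpen {y : Fin (n + 1) → ℝ | ∀ i : Fin n, 0 < y i.castSucc}
      rw [this]
      exact isOpen_iInter_of_finite fun i =>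
        isOpen_lt continuous_const (continuous_apply i.castSucc)
    · exact isOpen_lt continuous_const (continuous_apply (Fin.last n))
    · exact isOpen_lt (continuous_finsetSum _ fun j _ => continuous_apply j) continuous_const
  have hEne : E.Nonempty := by
    have hn0 : (0 : ℝ) < n := by exact_mod_cast (by omega : 0 < n)
    -- The brokers share `k / 16` equally and the agent clears his bound by `k / 8`. Since `ε ≤ ks /
    -- 4 < k / 4`, the surplus stays below `u - k / 2`.
    refine ⟨Fin.snoc (α := fun _ => ℝ) (fun _ => k / 16 / n) (u - k + ε + k / 8),
      fun i => ?_, ?_, ?_⟩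
    · rw [Fin.snoc_castSucc]; positivity
    · rw [Fin.snoc_last]; linarith
    · simp only [Fin.sum_univ_castSucc, Fin.snoc_castSucc, Fin.snoc_last, Finset.sum_const,
        Finset.card_univ, Fintype.card_fin, nsmul_eq_mul]
      rw [mul_div_cancel₀ _ hn0.ne']
      linarith
  have hsurplus : ∀ x ∈ surplusSet E, x ≤ u - k / 2 := by
    rintro _ ⟨y, hy, rfl⟩
    exact hy.2.2.le
  have hagent : ∀ x ∈ agentSet E, u - k + ε ≤ x := by
    rintro _ ⟨y, hy, rfl⟩
    exact hy.2.1.le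
  refine ⟨E, hEopen, hEne, fun y hy => ?_, ⟨_, hsurplus⟩, ⟨_, hagent⟩, ?_, ?_⟩
  · refine mem_equilibriumPayoffs_of_competition hk hkm hn hε ?_ ?_ ?_ hy.1 hy.2.1 ?_
    · exact hε1.trans (pow_le_pow_left₀ h0.le hkk.le 2)
    · linarith
    · linarith
    · linarith [hy.2.2]
  · have := csSup_le (hEne.image _) hsurplus
    change sSup (surplusSet E) ≤ _ at this
    linarith
  · have := le_csInf (hEne.image _) hagent
    change _ ≤ sInf (agentSet E) at this
    simp only [autarkyPayoff]
    linarith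

end Payoffs

end PersuadedSearch

end

open PersuadedSearch in
theorem theorem3 (F : Measure Quality) [IsProbabilityMeasure F]
    (hF : F ≪ (volume : Measure Quality)) :
    (∃! ks : ℝ, IsSurplusThreshold F ks) ∧
    ∀ ks : ℝ, IsSurplusThreshold F ks →
      ∃ kss : ℝ, ks < kss ∧ kss < priorMean F ∧
      ∃ δ : ℝ, 0 < δ ∧
      ∀ k : ℝ, ks < k → k ≤ kss → ∀ n : ℕ, 1 < n →
        (equilibriumPayoffs F 1 k).Nonempty ∧
        BddBelow (surplusSet (equilibriumPayoffs F 1 k)) ∧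
        BddAbove (agentSet (equilibriumPayoffs F 1 k)) ∧
        ∃ E : Set (Fin (n + 1) → ℝ), IsOpen E ∧ E.Nonempty ∧ E ⊆ equilibriumPayoffs F n k ∧
          BddAbove (surplusSet E) ∧ BddBelow (agentSet E) ∧
          sSup (surplusSet E) + δ < sInf (surplusSet (equilibriumPayoffs F 1 k)) ∧
          sSup (agentSet (equilibriumPayoffs F 1 k)) + δ < sInf (agentSet E) := by
  obtain ⟨ks, h0, h1, hks, hlow, hhigh⟩ := exists_threshold hF
  have hthr := isSurplusThreshold_of_crossing h0 h1 hlow hhigh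
  refine ⟨⟨ks, hthr, fun ks' h' => hthr.unique h' hks hlow⟩, fun ks' h' => ?_⟩
  rw [hthr.unique h' hks hlow]
  exact exists_open_competition h0 h1 hks hhigh
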